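/- Let $(W,S)$ be a Coxeter system with $S$ finite and length function $\ell$. For $I\subseteq S$ let $W_I=\langle I\rangle$, and let $\Lambda$ be the set of $I\subseteq S$ with $W_I$ finite; for $I\in\Lambda$ let $w_I$ be the longest element of $W_I$. Write $I\sqsubset J$ if $I\subset J$ and $|I|=|J|-1$. Let $H_q$ be the Hecke algebra of $(W,S)$ over $\mathbb Z[q]$, generated by $T_s$ $(s\in S)$ subject to $T_s^2=(q-1)T_s+q$ and the braid relations, and let $T_w=T_{s_1}\cdots T_{s_l}$ for any reduced expression $w=s_1\cdots s_l$. For $I\in\Lambda$ put $x_I=\sum_{w\in W_I}T_w$. Let $E_q=\mathrm{End}_{H_q}\big(\bigoplus_{I\in\Lambda}x_IH_q\big)$ (endomorphisms of right $H_q$-modules) and $E_0=\mathbb Z\otimes_{\mathbb Z[q]}E_q$, where $\mathbb Z$ is a $\mathbb Z[q]$-algebra via $q\mapsto 0$. For $I\sqsubset J$ in $\Lambda$ let $u_{I,J}\in E_0$ be the image $1\otimes f$ of the inclusion $f:x_JH_q\hookrightarrow x_IH_q$, let $d_{J,I}\in E_0$ be the image of the map $x_IH_q\to x_JH_q$ given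 by left multiplication by $h_{J,I}=\sum_w T_w$, where $w$ runs over the elements of $W_J$ that are shortest in their coset $wW_I$, and for $K\in\Lambda$ let $1_K\in E_0$ be the image of the identity map of $x_KH_q$; each of these maps is extended by zero to the other summands. For $s\in S$ put $p_{\{s\}}=u_{\emptyset,\{s\}}d_{\{s\},\emptyset}$. **Theorem.** As a unital $\mathbb Z$-algebra with $1=\sum_{K\in\Lambda}1_K$, the algebra $E_0$ is generated by the elements $u_{I,J}$, $d_{J,I}$ and $1_K$, for $I,J,K\in\Lambda$ with $I\sqsubset J$, and the following, together with $1=\sum_{K\in\Lambda}1_K$, are defining relations: 1. $d_{J,I}u_{I,J}=1_J$ for all $I\sqsubset J$ in $\Lambda$; 2. $u_{I,J}u_{J,K}=u_{I,J'}u_{J',K}$ and $d_{K,J}d_{J,I}=d_{K,J'}d_{J',I}$ for all $I,J,J',K\in\Lambda$ with $I\sqsubset J\sqsubset K$ and $I\sqsubset J'\sqsubset K$; 3. $u_{\emptyset,I_1}\cdots u_{I_{m-1},I}\,d_{I,I_{m-1}}\cdots d_{I_2,I_1}d_{I_1,\emptyset}=p_{\{s_l\}}\cdots p_{\{s_2\}}p_{\{s_1\}}$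 for every non-empty $I\in\Lambda$, every chain $\emptyset=I_0\sqsubset I_1\sqsubset\cdots\sqsubset I_m=I$, and every reduced expression $w_I=s_l\cdots s_2s_1$ such that for each $i=1,\dots,m$ some final segment $s_{j_i}\cdots s_2s_1$ of it is a (reduced) expression of $w_{I_i}$; 4. $u_{I,J}1_J=u_{I,J}=1_Iu_{I,J}$ and $d_{J,I}1_I=d_{J,I}=1_Jd_{J,I}$ for all $I\sqsubset J$ in $\Lambda$, $1_I^2=1_I$ for all $I\in\Lambda$, and $1_I1_J=0$ for all $I\ne J$ in $\Lambda$. That is, the $\mathbb Z$-algebra homomorphism to $E_0$ from the unital $\mathbb Z$-algebra defined by these generators and relations, sending each generator to the element of $E_0$ of the same name, exists and is an isomorphism. -/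

import Mathlib

open scoped TensorProduct DirectSum Polynomial

namespace HeckeEndo

noncomputable section

/-! ### Coxeter combinatorics -/

section Coxeter

variable {B W : Type*} [Group W] {M : CoxeterMatrix B} (cs : CoxeterSystem M W)

/-- The parabolic subgroup `W_I` generated by the simple reflections in `I`. -/
def parabolic (I : Finset B) : Subgroup W :=
  Subgroup.closure (cs.simple '' (I : Set B))

/-- The set `Λ` of finitary subsets of the set of simple reflections, that is, of those `I` for
which `W_I` is finite. The set of simple reflections is identified with its index type `B`. -/
def Finitary : Type _ := {I : Finset B // (parabolic cs I : Set W).Finite}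

instance [Finite B] : Finite (Finitary cs) :=
  inferInstanceAs (Finite {I : Finset B // (parabolic cs I : Set W).Finite})

instance [Finite B] : Fintype (Finitary cs) := Fintype.ofFinite _

/-- The empty set is finitary. -/
def emp : Finitary cs := ⟨∅, by
  simp [parabolic]⟩

/-- Singletons are finitary. -/
def sing (s : B) : Finitary cs := ⟨{s}, by
  have h : IsOfFinOrder (cs.simple s) :=
    isOfFinOrder_iff_pow_eq_one.2 ⟨2, by norm_num, cs.simple_sq s⟩
  have h' : parabolic cs {s} = Subgroup.zpowers (cs.simple s) := by
    simp [parabolic, Subgroup.zpowers_eq_closure]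
  rw [h']
  exact h.finite_zpowers⟩

variable {cs} in
/-- The relation `I ⊏ J`: `I ⊂ J` and `|I| = |J| - 1`. -/
def Covers (I J : Finitary cs) : Prop :=
  I.1 ⊂ J.1 ∧ I.1.card + 1 = J.1.card

theorem covers_emp_sing (s : B) : Covers (emp cs) (sing cs s) := by
  simp [Covers, emp, sing]

/-- `w` is the longest element `w_I` of `W_I` (for finitary `I` it exists and is unique). -/
def IsLongest (I : Finset B) (w : W) : Prop :=
  w ∈ parabolic cs I ∧ ∀ v ∈ parabolic cs I, cs.length v ≤ cs.length w

/-- The set `D_I` of shortest representatives `d` of the right cosets `W_I d`. -/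
def minReps (I : Finset B) : Set W :=
  {d | ∀ v ∈ parabolic cs I, cs.length d ≤ cs.length (v * d)}

/-- Total orderings of a finitary set `I`, as chains `∅ = I₀ ⊏ I₁ ⊏ ⋯ ⊏ I_m = I`. -/
inductive Flag : Finitary cs → Type _
  | nil : Flag (emp cs)
  | snoc {I J : Finitary cs} (c : Flag I) (h : Covers I J) : Flag J

variable {cs} in
/-- The word `[s_l, …, s₂, s₁]` is a reduced expression associated with the chain
`∅ = I₀ ⊏ I₁ ⊏ ⋯ ⊏ I_m = I`: it is a reduced expression of `w_I`, and for every `i` some final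
segment `[s_{j_i}, …, s₁]` of it is a reduced expression of `w_{I_i}`. -/
def Flag.Adapted : {I : Finitary cs} → Flag cs I → List B → Prop
  | _, .nil, ω => ω = []
  | J, .snoc c _, ω =>
      cs.IsReduced ω ∧ IsLongest cs J.1 (cs.wordProd ω) ∧ ∃ v, v <:+ ω ∧ c.Adapted v

end Coxeter

/-! ### The Hecke algebra over `ℤ[q]` -/

section Hecke

variable {B : Type*} (M : CoxeterMatrix B)

/-- The Hecke relations `T_s² = (q - 1) T_s + q` and the braid relations
(for `m_{s,t} = ∞`, encoded as `M s t = 0`, the braid relation reads `1 = 1`). -/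
inductive HeckeRel : FreeAlgebra ℤ[X] B → FreeAlgebra ℤ[X] B → Prop
  | quad (s : B) :
      HeckeRel (FreeAlgebra.ι ℤ[X] s * FreeAlgebra.ι ℤ[X] s)
        ((Polynomial.X - 1 : ℤ[X]) • FreeAlgebra.ι ℤ[X] s + algebraMap ℤ[X] _ Polynomial.X)
  | braid (s t : B) (hst : s ≠ t) :
      HeckeRel (((CoxeterSystem.alternatingWord s t (M s t)).map (FreeAlgebra.ι ℤ[X])).prod)
        (((CoxeterSystem.alternatingWord t s (M s t)).map (FreeAlgebra.ι ℤ[X])).prod)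

/-- The Hecke algebra `H_q` over `ℤ[q]`; the polynomial variable is `q`. -/
abbrev HeckeAlg : Type _ := RingQuot (HeckeRel M)

/-- The generator `T_s` of the Hecke algebra. -/
def heckeT (s : B) : HeckeAlg M :=
  RingQuot.mkAlgHom ℤ[X] (HeckeRel M) (FreeAlgebra.ι ℤ[X] s)

end Hecke

section Endo

variable {B W : Type*} [Group W] {M : CoxeterMatrix B} (cs : CoxeterSystem M W)

/-- The element `T_w = T_{s₁} ⋯ T_{s_l}` for a reduced expression `w = s₁ ⋯ s_l`; by the braid
relations it does not depend on the reduced expression, so one is chosen. -/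
def basisT (w : W) : HeckeAlg M :=
  ((Classical.choose (cs.exists_isReduced w)).map (heckeT M)).prod

/-- The element `x_I = ∑_{w ∈ W_I} T_w`. -/
def xElt (I : Finitary cs) : HeckeAlg M :=
  ∑ w ∈ I.2.toFinset, basisT cs w

open Classical in
/-- The element `h_{J,I} = ∑ T_w`, where `w` runs over the elements of `W_J` with `w⁻¹ ∈ D_I`. -/
def hElt (J I : Finitary cs) : HeckeAlg M :=
  ∑ w ∈ J.2.toFinset with w⁻¹ ∈ minReps cs I.1, basisT cs w

/-- The right ideal `x_I H_q`, as a right `H_q`-module. -/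
def rightIdeal (I : Finitary cs) : Submodule (HeckeAlg M)ᵐᵒᵖ (HeckeAlg M) :=
  Submodule.span _ {xElt cs I}

/-- The right `H_q`-module `⨁_{I ∈ Λ} x_I H_q`. -/
abbrev PermModule : Type _ := ⨁ I : Finitary cs, rightIdeal cs I

/-- The Hecke endomorphism algebra `E_q = End_{H_q}(⨁_{I ∈ Λ} x_I H_q)`. -/
abbrev Endq : Type _ := Module.End (HeckeAlg M)ᵐᵒᵖ (PermModule cs)

/-- `f` is the element of `E_q` that maps the summand `x_I H_q` to the summand `x_J H_q` by left
multiplication by `a ∈ H_q` and is zero on all other summands. -/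
def IsLeftMul (a : HeckeAlg M) (I J : Finitary cs) (f : Endq cs) : Prop :=
  ∀ y : PermModule cs,
    ((f y J : rightIdeal cs J) : HeckeAlg M) = a * ((y I : rightIdeal cs I) : HeckeAlg M) ∧
      ∀ K, K ≠ J → f y K = 0

/-- A copy of the ring `ℤ`, to carry the `ℤ[q]`-algebra structure of the specialisation `q ↦ 0`
(a separate type keeps this structure away from the usual action of `ℤ[q]` on itself). -/
def SpecZ : Type := ℤ

instance : CommRing SpecZ := inferInstanceAs (CommRing ℤ)

/-- `ℤ` as a `ℤ[q]`-algebra through the specialisation `q ↦ 0`. -/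
instance : Algebra ℤ[X] SpecZ :=
  RingHom.toAlgebra (S := SpecZ) (Polynomial.constantCoeff (R := ℤ))

/-- The `0`-Hecke endomorphism algebra `E_0 = ℤ ⊗ E_q`, the specialisation of `E_q` at `q = 0`. -/
abbrev E0 : Type _ := SpecZ ⊗[ℤ[X]] Endq cs

end Endo

/-! ### The algebra given by generators and relations -/

section Presentation

variable {B W : Type*} [Group W] {M : CoxeterMatrix B} (cs : CoxeterSystem M W)

/-- The generators: `u I J _` stands for `u_{I,J}`, `d J I _` for `d_{J,I}` (both for `I ⊏ J`),
and `one K` for `1_K`. -/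
inductive Gen : Type _
  | u (I J : Finitary cs) (hIJ : Covers I J) : Gen
  | d (J I : Finitary cs) (hIJ : Covers I J) : Gen
  | one (K : Finitary cs) : Gen

/-- The free unital `ℤ`-algebra on the generators. -/
abbrev Free : Type _ := FreeAlgebra ℤ (Gen cs)

variable {cs}

/-- `u_{I,J}` in the free algebra. -/
def uF {I J : Finitary cs} (hIJ : Covers I J) : Free cs := FreeAlgebra.ι ℤ (Gen.u I J hIJ)

/-- `d_{J,I}` in the free algebra. -/
def dF {I J : Finitary cs} (hIJ : Covers I J) : Free cs := FreeAlgebra.ι ℤ (Gen.d J I hIJ)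

/-- `1_K` in the free algebra. -/
def oneF (K : Finitary cs) : Free cs := FreeAlgebra.ι ℤ (Gen.one K)

/-- The product `u_{∅,I₁} u_{I₁,I₂} ⋯ u_{I_{m-1},I}` along a chain. -/
def Flag.uProd : {I : Finitary cs} → Flag cs I → Free cs
  | _, .nil => 1
  | _, .snoc c hIJ => c.uProd * uF hIJ

/-- The product `d_{I,I_{m-1}} ⋯ d_{I₂,I₁} d_{I₁,∅}` along a chain. -/
def Flag.dProd : {I : Finitary cs} → Flag cs I → Free cs
  | _, .nil => 1
  | _, .snoc c hIJ => dF hIJ * c.dProd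

variable (cs)

/-- The element `p_{{s}} = u_{∅,{s}} d_{{s},∅}`. -/
def pF (s : B) : Free cs := uF (covers_emp_sing cs s) * dF (covers_emp_sing cs s)

/-- The defining relations. -/
inductive Rel [Finite B] : Free cs → Free cs → Prop
  | unit : Rel 1 (∑ K : Finitary cs, oneF K)
  | idem {I J : Finitary cs} (hIJ : Covers I J) : Rel (dF hIJ * uF hIJ) (oneF J)
  | sandwich_u {I J J' K : Finitary cs} (hIJ : Covers I J) (hJK : Covers J K)
      (hIJ' : Covers I J') (hJK' : Covers J' K) :
      Rel (uF hIJ * uF hJK) (uF hIJ' * uF hJK')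
  | sandwich_d {I J J' K : Finitary cs} (hIJ : Covers I J) (hJK : Covers J K)
      (hIJ' : Covers I J') (hJK' : Covers J' K) :
      Rel (dF hJK * dF hIJ) (dF hJK' * dF hIJ')
  | braid {I : Finitary cs} (hI : I ≠ emp cs) (c : Flag cs I) (ω : List B) (hω : c.Adapted ω) :
      Rel (c.uProd * c.dProd) ((ω.map (pF cs)).prod)
  | u_one {I J : Finitary cs} (hIJ : Covers I J) : Rel (uF hIJ * oneF J) (uF hIJ)
  | one_u {I J : Finitary cs} (hIJ : Covers I J) : Rel (oneF I * uF hIJ) (uF hIJ)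
  | d_one {I J : Finitary cs} (hIJ : Covers I J) : Rel (dF hIJ * oneF I) (dF hIJ)
  | one_d {I J : Finitary cs} (hIJ : Covers I J) : Rel (oneF J * dF hIJ) (dF hIJ)
  | one_sq (I : Finitary cs) : Rel (oneF I * oneF I) (oneF I)
  | one_orth {I J : Finitary cs} (hIJ : I ≠ J) : Rel (oneF I * oneF J) 0

/-- The unital `ℤ`-algebra given by the generators `u_{I,J}`, `d_{J,I}`, `1_K` and the defining
relations. -/
abbrev Presented [Finite B] : Type _ := RingQuot (Rel cs)

/-- The canonical map from the free algebra to the presented algebra. -/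
def mk [Finite B] : Free cs →ₐ[ℤ] Presented cs := RingQuot.mkAlgHom ℤ (Rel cs)

end Presentation

end

end HeckeEndo

/-! Modulo q the problem becomes matrix algebra over the 0-Hecke algebra H_0 = H_q/qH_q. Record an
endomorphism f by its entries f(x_I)_J. Since x_I² = P_I(q) x_I, where the Poincaré polynomial P_I
has constant term 1, each x_I is idempotent modulo q, and composition of endomorphisms reduces to
multiplication of matrices of entries (`toH0_entry_mul`). The ideal x_J H_q is cut out by the
equations T_i y = q y for i in J (`eq_xElt_mul_of_heckeT_mul_eq`), so it contains z whenever it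
contains qz; hence an endomorphism whose entries vanish modulo q is q times an endomorphism. Thus
E_0 embeds multiplicatively into the matrices over H_0 (`e0Mat_injective`), its (J,I)-entries a
satisfy x_J a x_I = a, and u_{I,J} and d_{J,I} both become x_J times a matrix unit.

The idempotents π_i = T_i + 1 make H_0 the universal ring on idempotents with braid relations
(`exists_h0Hom`), and x_J modulo q is the product of the π_i along any reduced word of w_J
(`toH0_xElt_eq_prod`). The relations of the theorem are then immediate for matrices.

Conversely, let P be the presented algebra. Relation 2 makes the products u_J and d_J along chains
from ∅ to J independent of the chain, relation 1 gives d_J u_J = 1_J, and relation 3 for two-element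
sets gives the braid relations of the idempotents p_{s}. So there is a homomorphism θ : H_0 → P with
π_s ↦ p_{s}, and relation 3 in general says θ(x_J) 1_∅ = u_J d_J. It follows that u_{K,J} d_J = d_K
θ(x_J), so the elements d_J θ(h) u_I span P (`mem_normalSpan`). Such an element depends only on x_J
h x_I, and its matrix in E_0 has exactly this entry, at place (J,I). Reading off the matrix and
reassembling the normal forms is therefore inverse to P → E_0 (`ofMatrix_e0Mat_toE0`,
`toE0_ofMatrix_e0Mat`).

The Coxeter input is proved from scratch: the order of s_i s_j from the geometric representation,
strong exchange from an action on W × ℤ/2, then deletion, coset representatives and Matsumoto's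
theorem. The basis T_w comes from the regular representation. -/

namespace HeckeEndo

/-! ### Coxeter groups: orders of products of two generators and strong exchange. -/

section Coxeter

/-! ### The geometric representation and the order of a product of two simple reflections -/

section Geometric

variable {B : Type*} (M : CoxeterMatrix B)

/-- The angle `2π/m`, with `m = ∞` (encoded as `0`) giving angle `0`. -/
noncomputable def coxAngle (i j : B) : ℝ := 2 * Real.pi / M i j

/-- The entries `-2 cos (π/m_{ij})` of twice the Gram matrix of the geometric representation. -/
noncomputable def coxEntry (i j : B) : ℝ := -(2 * Real.cos (Real.pi / M i j))

/-- The coroots of the geometric representation. -/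
noncomputable def coxCoroot (i : B) : Module.Dual ℝ (B →₀ ℝ) :=
  Finsupp.linearCombination ℝ (fun j => coxEntry M i j)

theorem coxCoroot_single (i j : B) : coxCoroot M i (Finsupp.single j 1) = coxEntry M i j := by
  simp [coxCoroot]

theorem coxCoroot_self (i : B) : coxCoroot M i (Finsupp.single i 1) = 2 := by
  simp [coxCoroot_single, coxEntry]

theorem coxEntry_comm (i j : B) : coxEntry M i j = coxEntry M j i := by
  simp [coxEntry, M.symmetric i j]

theorem coxEntry_mul (i j : B) :
    coxEntry M i j * coxEntry M j i - 2 = 2 * Real.cos (coxAngle M i j) := by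
  rw [coxEntry_comm M j i, coxAngle, coxEntry, mul_div_assoc, Real.cos_two_mul]
  ring

/-- The simple reflections of the geometric representation. -/
noncomputable def coxReflection (i : B) : (B →₀ ℝ) ≃ₗ[ℝ] (B →₀ ℝ) :=
  Module.reflection (coxCoroot_self M i)

-- Powers of a product of two reflections are given by Chebyshev polynomials S_n evaluated at t = 2
-- cos θ with θ = 2π/m, and S_n(2 cos θ) sin θ = sin((n+1)θ). For m = 2k the relevant value
-- S_{k-1}(t) vanishes because kθ = π; for m = 2k+1 the sum S_k(t) + S_{k-1}(t) vanishes because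
-- (k+1)θ = 2π - kθ.
open Polynomial.Chebyshev in
theorem coxReflection_pow_eq_one (i j : B) :
    (coxReflection M i * coxReflection M j) ^ M i j = 1 := by
  by_cases hij : i = j
  · subst hij
    rw [M.diagonal, pow_one]
    apply LinearEquiv.ext
    intro z
    exact Module.involutive_reflection (coxCoroot_self M i) z
  have h1 : M i j ≠ 1 := M.off_diagonal i j hij
  -- Dividing by sin θ requires m ≥ 3: for m = 2 the angle is π, and for m = ∞ (encoded 0) it is 0.
  rcases Nat.lt_or_ge (M i j) 3 with h3 | h3
  · interval_cases h : M i j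
    · simp
    · exact absurd rfl h1
    · have e : coxEntry M i j = 0 := by simp [coxEntry, h]
      have e' : coxEntry M j i = 0 := by rw [coxEntry_comm, e]
      apply LinearEquiv.ext
      intro z
      have a : coxCoroot M i (Finsupp.single i 1) = 2 := coxCoroot_self M i
      have a' : coxCoroot M j (Finsupp.single j 1) = 2 := coxCoroot_self M j
      have b : coxCoroot M i (Finsupp.single j 1) = 0 := by rw [coxCoroot_single, e]
      have b' : coxCoroot M j (Finsupp.single i 1) = 0 := by rw [coxCoroot_single, e']
      simp only [coxReflection, pow_two, LinearEquiv.mul_apply, Module.reflection_apply, map_sub,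
        map_smul, a, a', b, b', LinearEquiv.coe_one, id]
      module
  · have hm0 : (0 : ℝ) < M i j := by exact_mod_cast (by omega : 0 < M i j)
    have hpos : 0 < coxAngle M i j := by unfold coxAngle; positivity
    have hlt : coxAngle M i j < Real.pi := by
      unfold coxAngle
      rw [div_lt_iff₀ hm0]
      have : (3 : ℝ) ≤ M i j := by exact_mod_cast h3
      nlinarith [Real.pi_pos]
    have hsin : Real.sin (coxAngle M i j) ≠ 0 := (Real.sin_pos_of_pos_of_lt_pi hpos hlt).ne'
    have hS (n : ℤ) := S_two_mul_real_cos (coxAngle M i j) n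
    have hmθ : (M i j : ℝ) * coxAngle M i j = 2 * Real.pi := by
      unfold coxAngle; field_simp
    apply LinearEquiv.ext
    intro z
    have key := Module.reflection_mul_reflection_pow_apply (coxCoroot_self M i)
      (coxCoroot_self M j) (M i j) z (2 * Real.cos (coxAngle M i j))
      (by rw [coxCoroot_single, coxCoroot_single, coxEntry_mul])
    unfold coxReflection
    rw [key]
    rcases Nat.even_or_odd' (M i j) with ⟨k, hk | hk⟩
    · have z1 : (((M i j : ℕ) : ℤ) - 2) / 2 = k - 1 := by omega
      have z2 : (((M i j : ℕ) : ℤ) - 1) / 2 = k - 1 := by omega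
      have s0 : Polynomial.eval (2 * Real.cos (coxAngle M i j)) (S ℝ ((k : ℤ) - 1)) = 0 := by
        have := hS (k - 1)
        have h2 : (((k : ℤ) - 1 : ℤ) + 1 : ℝ) * coxAngle M i j = Real.pi := by
          rw [hk] at hmθ; push_cast at hmθ ⊢; linarith
        rw [h2, Real.sin_pi] at this
        exact (mul_eq_zero.1 this).resolve_right hsin
      rw [z1, z2, s0]; simp
    · have z1 : (((M i j : ℕ) : ℤ) - 2) / 2 = k - 1 := by omega
      have z2 : (((M i j : ℕ) : ℤ) - 1) / 2 = k := by omega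
      have z3 : (((M i j : ℕ) : ℤ) - 3) / 2 = k - 1 := by omega
      have z4 : (((M i j : ℕ) : ℤ)) / 2 = k := by omega
      have s0 : Polynomial.eval (2 * Real.cos (coxAngle M i j)) (S ℝ (k : ℤ)) +
          Polynomial.eval (2 * Real.cos (coxAngle M i j)) (S ℝ ((k : ℤ) - 1)) = 0 := by
        have h1 := hS (k - 1)
        have h2 := hS k
        have h3 : (((k : ℤ) : ℝ) + 1) * coxAngle M i j
            = 2 * Real.pi - (((k : ℤ) - 1 : ℤ) + 1 : ℝ) * coxAngle M i j := by
          rw [hk] at hmθ; push_cast at hmθ ⊢; linarith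
        rw [h3, Real.sin_two_pi_sub] at h2
        have : (Polynomial.eval (2 * Real.cos (coxAngle M i j)) (S ℝ (k : ℤ)) +
          Polynomial.eval (2 * Real.cos (coxAngle M i j)) (S ℝ ((k : ℤ) - 1))) *
            Real.sin (coxAngle M i j) = 0 := by
          rw [add_mul, h1, h2]; ring
        exact (mul_eq_zero.1 this).resolve_right hsin
      rw [z1, z2, z3, z4, s0]; simp

-- Apply the k-th power to the root e_i and compare coordinates. The e_j-coordinate forces
-- S_{k-1}(t) = 0 when the entry is nonzero, and then the e_i-coordinate gives S_k(t) = 1. For m ≥ 3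
-- this means cos kθ = 1; for m = ∞ it means k = 0, as S_{k-1}(2) = k.
open Polynomial.Chebyshev in
theorem dvd_of_coxReflection_pow_eq_one (i j : B) (k : ℕ)
    (h : (coxReflection M i * coxReflection M j) ^ k = 1) : M i j ∣ k := by
  by_cases hij : i = j
  · subst hij; simp
  have h1 : M i j ≠ 1 := M.off_diagonal i j hij
  have key := Module.reflection_mul_reflection_pow_apply_self (coxCoroot_self M i)
      (coxCoroot_self M j) k (2 * Real.cos (coxAngle M i j))
      (by rw [coxCoroot_single, coxCoroot_single, coxEntry_mul])
  unfold coxReflection at h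
  rw [h, coxCoroot_single M j i, LinearEquiv.coe_one, id] at key
  have ki := DFunLike.congr_fun key i
  have kj := DFunLike.congr_fun key j
  simp only [Finsupp.single_eq_same, Finsupp.coe_add, Finsupp.coe_smul, Pi.add_apply,
    Pi.smul_apply, smul_eq_mul, mul_one, Finsupp.single_eq_of_ne hij, mul_zero, add_zero,
    Finsupp.single_eq_of_ne (Ne.symm hij), zero_add]
    at ki kj
  replace kj := kj.symm
  rcases Nat.lt_or_ge (M i j) 3 with h3 | h3
  · interval_cases hm : M i j
    · have : coxEntry M j i ≠ 0 := by simp [coxEntry, M.symmetric j i, hm]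
      have kj := (mul_eq_zero.1 kj).resolve_right (by simpa using this)
      simp [coxAngle, hm] at kj
      subst kj; simp
    · exact absurd rfl h1
    -- For m = 2 the roots are orthogonal and the e_j-coordinate says nothing, but S_k(-2) +
    -- S_{k-1}(-2) = (-1)^k, so the e_i-coordinate alone forces k to be even.
    · have ht : 2 * Real.cos (coxAngle M i j) = -2 := by simp [coxAngle, hm]
      rw [ht, S_eval_neg_two, S_eval_neg_two] at ki
      by_contra hodd
      obtain ⟨r, rfl⟩ := Nat.not_even_iff_odd.1 (fun h => hodd h.two_dvd)
      have e1 : (((2 * r + 1 : ℕ) : ℤ)).negOnePow = -1 :=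
        Int.negOnePow_odd _ (by push_cast; exact odd_two_mul_add_one _)
      have e2 : (((2 * r + 1 : ℕ) : ℤ) - 1).negOnePow = 1 :=
        Int.negOnePow_even _ (by push_cast; simp)
      rw [e1, e2] at ki
      push_cast at ki
      linarith
  · have hm0 : (0 : ℝ) < M i j := by exact_mod_cast (by omega : 0 < M i j)
    have hpos : 0 < coxAngle M i j := by unfold coxAngle; positivity
    have hlt : coxAngle M i j < Real.pi := by
      unfold coxAngle
      rw [div_lt_iff₀ hm0]
      have : (3 : ℝ) ≤ M i j := by exact_mod_cast h3
      nlinarith [Real.pi_pos]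
    have hsin : Real.sin (coxAngle M i j) ≠ 0 := (Real.sin_pos_of_pos_of_lt_pi hpos hlt).ne'
    have hent : coxEntry M j i ≠ 0 := by
      rw [coxEntry_comm, coxEntry, neg_ne_zero]
      have : 0 < Real.cos (Real.pi / M i j) := by
        apply Real.cos_pos_of_mem_Ioo
        have := Real.pi_pos
        have h3' : (3 : ℝ) ≤ M i j := by exact_mod_cast h3
        constructor
        · have : 0 < Real.pi / M i j := by positivity
          linarith
        · rw [div_lt_div_iff₀ hm0 (by norm_num)]
          nlinarith
      positivity
    have kj := (mul_eq_zero.1 kj).resolve_right (by simpa using hent)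
    rw [kj, add_zero] at ki
    have e1 := S_two_mul_real_cos (coxAngle M i j) (k - 1)
    have e2 := S_two_mul_real_cos (coxAngle M i j) k
    rw [kj] at e1
    rw [← ki] at e2
    push_cast at e1 e2
    rw [sub_add_cancel, zero_mul] at e1
    rw [add_mul, Real.sin_add, ← e1, one_mul, one_mul, zero_mul, zero_add] at e2
    have hc : Real.cos ((k : ℝ) * coxAngle M i j) = 1 := by
      have : (Real.cos ((k : ℝ) * coxAngle M i j) - 1) * Real.sin (coxAngle M i j) = 0 := by
        rw [sub_mul, ← e2]; ring
      linarith [(mul_eq_zero.1 this).resolve_right hsin]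
    obtain ⟨n, hn⟩ := (Real.cos_eq_one_iff _).1 hc
    have : (k : ℝ) = n * M i j := by
      unfold coxAngle at hn
      field_simp at hn
      have := Real.pi_pos
      linarith
    have : (k : ℤ) = n * M i j := by exact_mod_cast this
    exact Int.natCast_dvd_natCast.1 ⟨n, by rw [this, mul_comm]⟩

end Geometric

variable {B W : Type*} [Group W] {M : CoxeterMatrix B} (cs : CoxeterSystem M W)

theorem coxReflection_isLiftable : M.IsLiftable (coxReflection M) :=
  coxReflection_pow_eq_one M

theorem dvd_of_simple_mul_simple_pow_eq_one (i j : B) (k : ℕ)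
    (h : (cs.simple i * cs.simple j) ^ k = 1) : M i j ∣ k := by
  apply dvd_of_coxReflection_pow_eq_one
  have := congrArg (cs.lift ⟨coxReflection M, coxReflection_isLiftable⟩) h
  rw [map_pow, map_mul, cs.lift_apply_simple, cs.lift_apply_simple, map_one] at this
  exact this

/-! ### The strong exchange property -/

open Classical in
/-- The permutation `(t, ε) ↦ (s t s, ε + [s = t])` of `W × ℤ/2`. -/
noncomputable def invAct (i : B) : Function.End (W × ZMod 2) := fun p =>
  (cs.simple i * p.1 * cs.simple i, p.2 + if cs.simple i = p.1 then 1 else 0)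

-- The second component thus counts, modulo 2, the occurrences of t in the right inversion sequence.
-- Once the action is known to factor through W, this parity depends only on the group element.
open Classical in
theorem invAct_word (ω : List B) (t : W) (e : ZMod 2) :
    (ω.map (invAct cs)).prod (t, e) =
      (cs.wordProd ω * t * (cs.wordProd ω)⁻¹, e + (List.count t (cs.rightInvSeq ω) : ℕ)) := by
  induction ω with
  | nil => simp; rfl
  | cons i ω ih =>
    have : (List.map (invAct cs) (i :: ω)).prod (t, e) =
      invAct cs i ((ω.map (invAct cs)).prod (t, e)) := by simp; rfl
    rw [this, ih]
    simp only [invAct, cs.wordProd_cons, CoxeterSystem.rightInvSeq, List.count_cons, mul_inv_rev,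
      cs.inv_simple, beq_iff_eq]
    have hiff : (cs.simple i = cs.wordProd ω * t * (cs.wordProd ω)⁻¹) ↔
        ((cs.wordProd ω)⁻¹ * cs.simple i * cs.wordProd ω = t) := by
      constructor
      · intro h; rw [h]; group
      · rintro rfl; group
    refine Prod.ext (by simp [mul_assoc]) ?_
    simp only [hiff]
    split_ifs <;> push_cast <;> ring

/-- The k-th and (m+k)-th reflections of the word (st)^m agree because (st)^m = 1. Hence every
reflection occurs an even number of times, which is what the Coxeter relations for `invAct` need. -/
theorem leftInvSeq_alternatingWord_take (i j : B) :
    (cs.leftInvSeq (CoxeterSystem.alternatingWord i j (2 * M i j))).take (M i j) =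
    (cs.leftInvSeq (CoxeterSystem.alternatingWord i j (2 * M i j))).drop (M i j) := by
  apply List.ext_getElem
  · simp; omega
  · intro k h1 h2
    have h1' : k < M i j := by simp at h1; omega
    rw [List.getElem_take, List.getElem_drop,
      cs.getElem_leftInvSeq_alternatingWord _ _ _ _ (by omega),
      cs.getElem_leftInvSeq_alternatingWord _ _ _ _ (by omega),
      cs.prod_alternatingWord_eq_mul_pow, cs.prod_alternatingWord_eq_mul_pow]
    have o1 : ¬ Even (2 * k + 1) := by simp
    have o2 : ¬ Even (2 * (M i j + k) + 1) := by simp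
    have d1 : (2 * k + 1) / 2 = k := by omega
    have d2 : (2 * (M i j + k) + 1) / 2 = M i j + k := by omega
    rw [if_neg o1, if_neg o2, d1, d2, pow_add, cs.simple_mul_simple_pow', one_mul]

theorem map_alternatingWord_two_mul_prod {N : Type*} [Monoid N] (f : B → N) (i j : B) (m : ℕ) :
    ((CoxeterSystem.alternatingWord i j (2 * m)).map f).prod = (f i * f j) ^ m := by
  induction m with
  | zero => simp [CoxeterSystem.alternatingWord]
  | succ m ih =>
    have : 2 * (m + 1) = 2 * m + 1 + 1 := by ring
    rw [this, CoxeterSystem.alternatingWord_succ, CoxeterSystem.alternatingWord_succ]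
    simp [ih, pow_succ]

theorem invAct_isLiftable : M.IsLiftable (invAct cs) := by
  classical
  intro i j
  rw [← map_alternatingWord_two_mul_prod]
  funext ⟨t, e⟩
  rw [invAct_word]
  have hw : cs.wordProd (CoxeterSystem.alternatingWord i j (2 * M i j)) = 1 := by
    rw [CoxeterSystem.wordProd, map_alternatingWord_two_mul_prod, cs.simple_mul_simple_pow]
  -- Reversal exchanges right and left inversion sequences, so the repetition known for the left
  -- sequence can be used for the right one.
  have hrev : (CoxeterSystem.alternatingWord i j (2 * M i j)) =
      (CoxeterSystem.alternatingWord j i (2 * M j i)).reverse := by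
    apply List.ext_getElem
    · simp [M.symmetric i j]
    · intro k h1 h2
      simp at h1 h2
      rw [List.getElem_reverse, CoxeterSystem.getElem_alternatingWord _ _ _ _ h1,
        CoxeterSystem.getElem_alternatingWord _ _ _ _ (by simp; omega)]
      simp
      rcases Nat.even_or_odd k with hk | hk
      · have : ¬ Even (2 * M j i + (2 * M j i - 1 - k)) := by
          rw [Nat.not_even_iff_odd]; grind
        have h' : Even (2 * M i j + k) := by grind
        simp [this, h']
      · have : Even (2 * M j i + (2 * M j i - 1 - k)) := by grind
        have h' : ¬ Even (2 * M i j + k) := by grind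
        simp [this, h']
  have hc : ((List.count t (cs.rightInvSeq (CoxeterSystem.alternatingWord i j (2 * M i j))) : ℕ)
      : ZMod 2) = 0 := by
    rw [hrev, cs.rightInvSeq_reverse, List.count_reverse,
      ← List.take_append_drop (M j i) (cs.leftInvSeq _), ← leftInvSeq_alternatingWord_take,
      List.count_append]
    push_cast
    exact CharTwo.add_self_eq_zero _
  rw [hw, hc]
  simp
  rfl

open Classical in
theorem count_rightInvSeq_eq {ω ω' : List B} (h : cs.wordProd ω = cs.wordProd ω') (t : W) :
    ((List.count t (cs.rightInvSeq ω) : ℕ) : ZMod 2) =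
      (List.count t (cs.rightInvSeq ω') : ℕ) := by
  have key (ω : List B) : cs.lift ⟨invAct cs, invAct_isLiftable cs⟩ (cs.wordProd ω) =
      (ω.map (invAct cs)).prod := by
    rw [CoxeterSystem.wordProd, map_list_prod, List.map_map]
    congr 2
    funext i
    simp
  have := congrFun ((key ω).symm.trans ((congrArg _ h).trans (key ω'))) (t, 0)
  rw [invAct_word, invAct_word] at this
  simpa using congrArg Prod.snd this

open Classical in
theorem rightInvSeq_append (ω ω' : List B) :
    cs.rightInvSeq (ω ++ ω') =
      (cs.rightInvSeq ω).map (fun t => (cs.wordProd ω')⁻¹ * t * cs.wordProd ω')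
        ++ cs.rightInvSeq ω' := by
  induction ω with
  | nil => simp
  | cons i ω ih => simp [CoxeterSystem.rightInvSeq, ih, cs.wordProd_append, mul_assoc]

open Classical in
theorem count_rightInvSeq_append (ω ω' : List B) (t : W) :
    List.count t (cs.rightInvSeq (ω ++ ω')) =
      List.count (cs.wordProd ω' * t * (cs.wordProd ω')⁻¹) (cs.rightInvSeq ω) +
        List.count t (cs.rightInvSeq ω') := by
  rw [rightInvSeq_append, List.count_append]
  congr 1
  have hinj : Function.Injective (fun t => (cs.wordProd ω')⁻¹ * t * cs.wordProd ω') := by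
    intro a b h
    simpa using h
  rw [← List.count_map_of_injective _ _ hinj (cs.wordProd ω' * t * (cs.wordProd ω')⁻¹)]
  congr 1
  group

/-- Parity argument. In a palindromic word for t, the reflection t occurs an odd number of times. It
does not occur for a reduced word of wt, since otherwise w = (wt)t would be shorter than wt. By
invariance of parity it occurs an odd number of times in the sequence of any word for w. -/
theorem mem_rightInvSeq_of_isRightInversion {ω : List B} {t : W}
    (h : cs.IsRightInversion (cs.wordProd ω) t) : t ∈ cs.rightInvSeq ω := by
  classical
  obtain ⟨⟨u, i, rfl⟩, hlt⟩ := h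
  set t := u * cs.simple i * u⁻¹ with ht
  obtain ⟨υ, rfl⟩ := cs.wordProd_surjective u
  -- the parity of the inversion count of `t` in itself is odd
  have h1 : ((List.count t (cs.rightInvSeq (υ ++ ([i] ++ υ.reverse))) : ℕ) : ZMod 2) = 1 := by
    have h0 : ((List.count t (cs.rightInvSeq (υ ++ υ.reverse)) : ℕ) : ZMod 2) = 0 := by
      rw [count_rightInvSeq_eq cs (ω' := []) (by simp [cs.wordProd_append])]
      simp
    rw [count_rightInvSeq_append] at h0 ⊢
    rw [count_rightInvSeq_append]
    have a1 : cs.wordProd υ.reverse * t * (cs.wordProd υ.reverse)⁻¹ = cs.simple i := by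
      simp [ht]; group
    have a2 : cs.wordProd ([i] ++ υ.reverse) * t * (cs.wordProd ([i] ++ υ.reverse))⁻¹
        = cs.simple i := by
      simp [ht, cs.wordProd_cons]; group
      simp
    rw [a1] at h0 ⊢
    rw [a2]
    push_cast at h0 ⊢
    simp only [cs.rightInvSeq_singleton, List.count_singleton_self]
    push_cast
    linear_combination h0
  have htw : cs.wordProd (υ ++ ([i] ++ υ.reverse)) = t := by
    simp [cs.wordProd_append, ht, cs.wordProd_cons, mul_assoc]
  have htt : t * t * t⁻¹ = t := by group
  obtain ⟨ρ, hρ, hρw⟩ := cs.exists_isReduced (cs.wordProd ω * t)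
  have h2 := count_rightInvSeq_eq cs (ω := ρ) (ω' := ω ++ (υ ++ ([i] ++ υ.reverse)))
    (by rw [cs.wordProd_append, htw, hρw]) t
  rw [count_rightInvSeq_append cs ω, htw, htt] at h2
  push_cast at h2
  rw [h1] at h2
  have h3 : t ∉ cs.rightInvSeq ρ := by
    intro hmem
    have := (cs.isRightInversion_of_mem_rightInvSeq hρ hmem).2
    rw [← hρw, mul_assoc] at this
    have t2 : t * t = 1 := by simp [ht, mul_assoc]
    rw [t2, mul_one] at this
    omega
  rw [List.count_eq_zero_of_not_mem h3] at h2
  by_contra hmem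
  rw [List.count_eq_zero_of_not_mem hmem] at h2
  simp at h2

theorem exchange_right {ω : List B} {t : W} (h : cs.IsRightInversion (cs.wordProd ω) t) :
    ∃ j < ω.length, cs.wordProd ω * t = cs.wordProd (ω.eraseIdx j) := by
  obtain ⟨j, hj, rfl⟩ := List.mem_iff_getElem.1 (mem_rightInvSeq_of_isRightInversion cs h)
  refine ⟨j, by simpa using hj, ?_⟩
  rw [← cs.wordProd_mul_getD_rightInvSeq, List.getD_eq_getElem _ _ hj]

theorem exchange_left {ω : List B} {t : W} (h : cs.IsLeftInversion (cs.wordProd ω) t) :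
    ∃ j < ω.length, t * cs.wordProd ω = cs.wordProd (ω.eraseIdx j) := by
  have h' : cs.IsRightInversion (cs.wordProd ω.reverse) t := by
    rw [cs.wordProd_reverse]; exact cs.isRightInversion_inv_iff.2 h
  have hm := mem_rightInvSeq_of_isRightInversion cs h'
  rw [cs.rightInvSeq_reverse, List.mem_reverse] at hm
  obtain ⟨j, hj, rfl⟩ := List.mem_iff_getElem.1 hm
  refine ⟨j, by simpa using hj, ?_⟩
  rw [← cs.getD_leftInvSeq_mul_wordProd, List.getD_eq_getElem _ _ hj]

end Coxeter

section CoxeterWords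

variable {B W : Type*} [Group W] {M : CoxeterMatrix B} (cs : CoxeterSystem M W)

/-! ### Parabolic subgroups and reduced words -/

theorem exchange_left_simple {ω : List B} {i : B}
    (h : cs.length (cs.simple i * cs.wordProd ω) < cs.length (cs.wordProd ω)) :
    ∃ j < ω.length, cs.simple i * cs.wordProd ω = cs.wordProd (ω.eraseIdx j) :=
  exchange_left cs ⟨cs.isReflection_simple i, h⟩

theorem isReduced_cons_iff {ω : List B} (hω : cs.IsReduced ω) (i : B) :
    cs.IsReduced (i :: ω) ↔
      cs.length (cs.wordProd ω) < cs.length (cs.simple i * cs.wordProd ω) := by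
  have h := cs.length_simple_mul (cs.wordProd ω) i
  unfold CoxeterSystem.IsReduced at *
  rw [cs.wordProd_cons, List.length_cons]
  omega

theorem isReduced_of_cons {i : B} {ω : List B} (h : cs.IsReduced (i :: ω)) : cs.IsReduced ω := by
  simpa using h.drop 1

/-- The deletion property. -/
theorem exists_isReduced_sublist (ω : List B) :
    ∃ ω', ω'.Sublist ω ∧ cs.IsReduced ω' ∧ cs.wordProd ω' = cs.wordProd ω := by
  induction ω with
  | nil => exact ⟨[], List.Sublist.slnil, by simp [CoxeterSystem.IsReduced], rfl⟩
  | cons i ω ih =>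
    obtain ⟨ω', hs, hr, hp⟩ := ih
    rcases cs.length_simple_mul (cs.wordProd ω') i with h | h
    · refine ⟨i :: ω', hs.cons_cons i, ?_, by rw [cs.wordProd_cons, cs.wordProd_cons, hp]⟩
      rw [isReduced_cons_iff cs hr]; omega
    · obtain ⟨j, hj, he⟩ := exchange_left_simple cs (ω := ω') (i := i) (by omega)
      refine ⟨ω'.eraseIdx j, ((List.eraseIdx_sublist _ _).trans hs).cons i, ?_, ?_⟩
      · unfold CoxeterSystem.IsReduced at *
        rw [← he]
        have := List.length_eraseIdx_add_one hj
        omega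
      · rw [← he, cs.wordProd_cons, hp]

theorem simple_mem_parabolic {I : Finset B} {i : B} (hi : i ∈ I) :
    cs.simple i ∈ parabolic cs I :=
  Subgroup.subset_closure ⟨i, hi, rfl⟩

theorem wordProd_mem_parabolic {I : Finset B} {ω : List B} (h : ∀ i ∈ ω, i ∈ I) :
    cs.wordProd ω ∈ parabolic cs I := by
  induction ω with
  | nil => rw [cs.wordProd_nil]; exact one_mem _
  | cons i ω ih =>
    rw [cs.wordProd_cons]
    exact mul_mem (simple_mem_parabolic cs (h i (by simp))) (ih fun j hj => h j (by simp [hj]))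

theorem parabolic_mono {I J : Finset B} (h : I ⊆ J) : parabolic cs I ≤ parabolic cs J :=
  Subgroup.closure_mono (Set.image_mono h)

theorem exists_word_of_mem_parabolic {I : Finset B} {w : W} (hw : w ∈ parabolic cs I) :
    ∃ ω : List B, (∀ i ∈ ω, i ∈ I) ∧ cs.IsReduced ω ∧ cs.wordProd ω = w := by
  suffices h : ∃ ω : List B, (∀ i ∈ ω, i ∈ I) ∧ cs.wordProd ω = w by
    obtain ⟨ω, hI, rfl⟩ := h
    obtain ⟨ω', hs, hr, hp⟩ := exists_isReduced_sublist cs ω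
    exact ⟨ω', fun i hi => hI i (hs.subset hi), hr, hp⟩
  induction hw using Subgroup.closure_induction with
  | mem x hx =>
    obtain ⟨i, hi, rfl⟩ := hx
    exact ⟨[i], by simpa using hi, by simp⟩
  | one => exact ⟨[], by simp, by simp⟩
  | mul x y _ _ hx hy =>
    obtain ⟨ω, h, rfl⟩ := hx
    obtain ⟨ω', h', rfl⟩ := hy
    refine ⟨ω ++ ω', ?_, cs.wordProd_append _ _⟩
    intro i hi
    rcases List.mem_append.1 hi with hi | hi
    exacts [h i hi, h' i hi]
  | inv x _ hx =>
    obtain ⟨ω, h, rfl⟩ := hx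
    exact ⟨ω.reverse, by simpa using h, cs.wordProd_reverse _⟩

/-! ### Minimal coset representatives -/

/-- Build v up from the left. If prefixing a letter shortened the product, exchange would delete a
letter either from v, against reducedness of the longer word of v, or from d, giving a shorter
element of the coset W_I d. -/
theorem length_mul_of_mem_minReps {I : Finset B} {v d : W} (hv : v ∈ parabolic cs I)
    (hd : d ∈ minReps cs I) : cs.length (v * d) = cs.length v + cs.length d := by
  obtain ⟨δ, hδ, rfl⟩ := cs.exists_isReduced d
  obtain ⟨ω, hI, hω, rfl⟩ := exists_word_of_mem_parabolic cs hv
  clear hv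
  induction ω with
  | nil => simp
  | cons i ω ih =>
    have hω' := isReduced_of_cons cs hω
    have hI' : ∀ j ∈ ω, j ∈ I := fun j hj => hI j (by simp [hj])
    have ih := ih hI' hω'
    have hlt := (isReduced_cons_iff cs hω' i).1 hω
    have hup := cs.length_simple_mul (cs.wordProd ω) i
    rw [cs.wordProd_cons, mul_assoc]
    rcases cs.length_simple_mul (cs.wordProd ω * cs.wordProd δ) i with h | h
    · omega
    exfalso
    rw [← cs.wordProd_append] at h
    obtain ⟨j, hj, he⟩ := exchange_left_simple cs (ω := ω ++ δ) (i := i) (by omega)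
    rw [List.eraseIdx_append] at he
    split_ifs at he with hjω
    · rw [cs.wordProd_append, cs.wordProd_append, ← mul_assoc, mul_left_inj] at he
      rw [he] at hlt
      have h1 := cs.length_wordProd_le (ω.eraseIdx j)
      have h2 := List.length_eraseIdx_add_one hjω
      have h3 : cs.length (cs.wordProd ω) = ω.length := hω'
      omega
    · have hj' : j - ω.length < δ.length := by simp at hj; omega
      rw [cs.wordProd_append, cs.wordProd_append] at he
      have h1 := hd ((cs.wordProd ω)⁻¹ * cs.simple i * cs.wordProd ω)
        (mul_mem (mul_mem (inv_mem (wordProd_mem_parabolic cs hI'))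
          (simple_mem_parabolic cs (hI i (by simp)))) (wordProd_mem_parabolic cs hI'))
      rw [mul_assoc, mul_assoc, he, inv_mul_cancel_left] at h1
      have h2 := cs.length_wordProd_le (δ.eraseIdx (j - ω.length))
      have h3 := List.length_eraseIdx_add_one hj'
      have h4 : cs.length (cs.wordProd δ) = δ.length := hδ
      omega

theorem exists_mul_minReps (I : Finset B) (w : W) :
    ∃ v ∈ parabolic cs I, ∃ d ∈ minReps cs I, w = v * d := by
  obtain ⟨_, ⟨v, hv, rfl⟩, hmin⟩ := (measure cs.length).wf.has_min
    {x | ∃ v ∈ parabolic cs I, v * w = x} ⟨_, 1, one_mem _, rfl⟩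
  refine ⟨v⁻¹, inv_mem hv, v * w, fun u hu => ?_, by simp⟩
  exact not_lt.1 (hmin (u * (v * w)) ⟨u * v, mul_mem hu hv, mul_assoc _ _ _⟩)

theorem eq_of_mul_minReps {I : Finset B} {v v' d d' : W} (hv : v ∈ parabolic cs I)
    (hv' : v' ∈ parabolic cs I) (hd : d ∈ minReps cs I) (hd' : d' ∈ minReps cs I)
    (h : v * d = v' * d') : v = v' ∧ d = d' := by
  have h1 : d' = (v'⁻¹ * v) * d := by rw [mul_assoc, h, inv_mul_cancel_left]
  have h2 := length_mul_of_mem_minReps cs (mul_mem (inv_mem hv') hv) hd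
  have h3 := hd' _ (inv_mem (mul_mem (inv_mem hv') hv))
  rw [h1, inv_mul_cancel_left, h2] at h3
  have h4 : v'⁻¹ * v = 1 := cs.length_eq_zero_iff.1 (by omega)
  rw [h4, one_mul] at h1
  exact ⟨(inv_mul_eq_one.1 h4).symm, h1.symm⟩

/-! ### Dihedral words -/

/-- The word `s t s ⋯` of length `k`, starting with `s`. -/
def altHead (i j : B) : ℕ → List B
  | 0 => []
  | k + 1 => i :: altHead j i k

@[simp] theorem length_altHead (i j : B) (k : ℕ) : (altHead i j k).length = k := by
  induction k generalizing i j with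
  | zero => rfl
  | succ k ih => simp [altHead, ih]

theorem altHead_eq (i j : B) (k : ℕ) : altHead i j k =
    if Even k then CoxeterSystem.alternatingWord i j k
    else CoxeterSystem.alternatingWord j i k := by
  induction k generalizing i j with
  | zero => simp [altHead, CoxeterSystem.alternatingWord]
  | succ k ih =>
    rw [altHead, ih, CoxeterSystem.alternatingWord_succ', CoxeterSystem.alternatingWord_succ']
    by_cases hk : Even k
    · have : ¬ Even (k + 1) := by simp [hk, parity_simps]
      simp [hk, this]
    · have : Even (k + 1) := by simp [hk, parity_simps]
      simp [hk, this]

/-- A statement symmetric in two words can be tested on either kind of alternating word. -/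
theorem map_altHead_prod_eq_iff {N : Type*} [Monoid N] (f : B → N) (i j : B) (k : ℕ) :
    ((altHead i j k).map f).prod = ((altHead j i k).map f).prod ↔
      ((CoxeterSystem.alternatingWord i j k).map f).prod =
        ((CoxeterSystem.alternatingWord j i k).map f).prod := by
  rw [altHead_eq, altHead_eq]
  split_ifs
  · rfl
  · exact eq_comm

theorem mem_altHead {i j a : B} {k : ℕ} (h : a ∈ altHead i j k) : a = i ∨ a = j := by
  induction k generalizing i j with
  | zero => simp [altHead] at h
  | succ k ih =>
    rcases List.mem_cons.1 h with h | h
    · exact Or.inl h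
    · exact (ih h).symm

theorem not_isReduced_cons_cons (i : B) (ω : List B) : ¬ cs.IsReduced (i :: i :: ω) := by
  intro h
  have h1 := cs.length_wordProd_le ω
  unfold CoxeterSystem.IsReduced at h
  rw [cs.wordProd_cons, cs.wordProd_cons, cs.simple_mul_simple_cancel_left] at h
  simp at h
  omega

theorem eq_altHead_of_isReduced {i j : B} {ω : List B} (hω : cs.IsReduced ω)
    (h : ∀ a ∈ ω, a = i ∨ a = j) :
    ω = altHead i j ω.length ∨ ω = altHead j i ω.length := by
  induction ω with
  | nil => simp [altHead]
  | cons a ω ih =>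
    have ih := ih (isReduced_of_cons cs hω) fun b hb => h b (by simp [hb])
    cases ω with
    | nil => rcases h a (by simp) with rfl | rfl <;> simp [altHead]
    | cons b ω =>
      have hab : a ≠ b := by
        rintro rfl
        exact not_isReduced_cons_cons cs _ _ hω
      rcases ih with ih | ih
      · have hb : b = i := by
          rw [List.length_cons, altHead] at ih; exact (List.cons.inj ih).1
        have ha : a = j := (h a (by simp)).resolve_left (fun h => hab (h.trans hb.symm))
        right
        rw [List.length_cons, altHead, ← ih, ha]
      · have hb : b = j := by
          rw [List.length_cons, altHead] at ih; exact (List.cons.inj ih).1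
        have ha : a = i := (h a (by simp)).resolve_right (fun h => hab (h.trans hb.symm))
        left
        rw [List.length_cons, altHead, ← ih, ha]

/-- Coincidences between alternating words become powers of s_i s_j: the exponents add when the
words start with different letters, and subtract when they start with the same letter (the primed
variant). -/
theorem pow_eq_one_of_wordProd_altHead_eq {i j : B} {k l : ℕ} (hp : Even (k + l))
    (h : cs.wordProd (altHead i j k) = cs.wordProd (altHead j i l)) :
    (cs.simple i * cs.simple j) ^ ((k + l) / 2) = 1 := by
  have hinv : cs.simple j * cs.simple i = (cs.simple i * cs.simple j)⁻¹ := by simp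
  rw [altHead_eq, altHead_eq] at h
  by_cases hk : Even k
  · have hl : Even l := by grind
    rw [if_pos hk, if_pos hl, cs.prod_alternatingWord_eq_mul_pow,
      cs.prod_alternatingWord_eq_mul_pow, if_pos hk, if_pos hl, one_mul, one_mul, hinv,
      inv_pow, eq_inv_iff_mul_eq_one, ← pow_add] at h
    rwa [show (k + l) / 2 = k / 2 + l / 2 by grind]
  · have hl : ¬ Even l := by grind
    rw [if_neg hk, if_neg hl, cs.prod_alternatingWord_eq_mul_pow,
      cs.prod_alternatingWord_eq_mul_pow, if_neg hk, if_neg hl, hinv, inv_pow] at h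
    rw [mul_inv_eq_iff_eq_mul, mul_assoc, ← pow_add] at h
    rw [show (k + l) / 2 = (l / 2 + k / 2) + 1 by grind, pow_succ', mul_assoc, ← h,
      cs.simple_mul_simple_self]

theorem pow_eq_one_of_wordProd_altHead_eq' {i j : B} {k l : ℕ} (hp : Even (k + l)) (hlk : l ≤ k)
    (h : cs.wordProd (altHead i j k) = cs.wordProd (altHead i j l)) :
    (cs.simple i * cs.simple j) ^ ((k - l) / 2) = 1 := by
  have hinv : cs.simple j * cs.simple i = (cs.simple i * cs.simple j)⁻¹ := by simp
  rw [altHead_eq, altHead_eq] at h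
  by_cases hk : Even k
  · have hl : Even l := by grind
    rw [if_pos hk, if_pos hl, cs.prod_alternatingWord_eq_mul_pow,
      cs.prod_alternatingWord_eq_mul_pow, if_pos hk, if_pos hl, one_mul, one_mul,
      show k / 2 = (k - l) / 2 + l / 2 by grind, pow_add, mul_eq_right] at h
    exact h
  · have hl : ¬ Even l := by grind
    rw [if_neg hk, if_neg hl, cs.prod_alternatingWord_eq_mul_pow,
      cs.prod_alternatingWord_eq_mul_pow, if_neg hk, if_neg hl, mul_right_inj,
      show k / 2 = (k - l) / 2 + l / 2 by grind, pow_add, mul_eq_right, hinv, inv_pow,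
      inv_eq_one] at h
    exact h

/-- A strictly shorter reduced word would again be alternating and of the same parity, so (s_i
s_j)^n = 1 for some n with 0 < n < k. This contradicts the order m of s_i s_j, infinite if m = 0. -/
theorem isReduced_altHead (i j : B) {k : ℕ} (hk : M i j = 0 ∨ k ≤ M i j) :
    cs.IsReduced (altHead i j k) := by
  by_contra hnr
  obtain ⟨ω, hs, hr, hp⟩ := exists_isReduced_sublist cs (altHead i j k)
  have hlt : ω.length < k := by
    refine lt_of_le_of_ne (by simpa using hs.length_le) fun h => hnr ?_
    rwa [← hs.eq_of_length (by simpa using h)]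
  have hmem : ∀ a ∈ ω, a = i ∨ a = j := fun a ha => mem_altHead (hs.subset ha)
  have hpar : Even (k + ω.length) := by
    have h1 (ω : List B) : cs.length (cs.wordProd ω) % 2 = ω.length % 2 := by
      induction ω with
      | nil => simp
      | cons a ω ih =>
        rw [cs.wordProd_cons, cs.length_mul_mod_two, cs.length_simple, List.length_cons]; omega
    have h2 := h1 ω
    rw [hp, h1, length_altHead] at h2
    grind
  rcases eq_altHead_of_isReduced cs hr hmem with h | h
  · rw [h] at hp
    have h1 := dvd_of_simple_mul_simple_pow_eq_one cs i j _
      (pow_eq_one_of_wordProd_altHead_eq' cs hpar hlt.le hp.symm)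
    have h2 := Nat.le_of_dvd (by grind) h1
    rcases hk with hk | hk
    · rw [hk, zero_dvd_iff] at h1; grind
    · grind
  · rw [h] at hp
    have h1 := dvd_of_simple_mul_simple_pow_eq_one cs i j _
      (pow_eq_one_of_wordProd_altHead_eq cs hpar hp.symm)
    have h2 := Nat.le_of_dvd (by grind) h1
    rcases hk with hk | hk
    · rw [hk, zero_dvd_iff] at h1; grind
    · grind

theorem le_of_isReduced_altHead {i j : B} {k : ℕ} (h : cs.IsReduced (altHead i j k))
    (hM : M i j ≠ 0) : k ≤ M i j := by
  by_contra hk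
  rw [altHead_eq] at h
  split_ifs at h
  · exact cs.not_isReduced_alternatingWord i j hM (by omega) h
  · exact cs.not_isReduced_alternatingWord j i (by rwa [M.symmetric])
      (by rw [M.symmetric]; omega) h

/-- If `w` has left descents `i` and `j`, then it has reduced words starting with
either of the two sides of the braid relation of `i` and `j`. -/
theorem exists_braid_mul_of_descents {i j : B} {w : W}
    (hi : cs.length (cs.simple i * w) < cs.length w)
    (hj : cs.length (cs.simple j * w) < cs.length w) :
    M i j ≠ 0 ∧ ∃ δ, cs.IsReduced (altHead i j (M i j) ++ δ) ∧
      cs.wordProd (altHead i j (M i j) ++ δ) = w ∧ cs.IsReduced (altHead j i (M i j) ++ δ) ∧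
      cs.wordProd (altHead j i (M i j) ++ δ) = w := by
  classical
  -- Write w = v d with v in the dihedral subgroup. Lengths add, so i and j are already left
  -- descents of v, and v has an alternating reduced word starting with each of them.
  obtain ⟨v, hv, d, hd, rfl⟩ := exists_mul_minReps cs {i, j} w
  have hmi := simple_mem_parabolic cs (I := {i, j}) (i := i) (by simp)
  have hmj := simple_mem_parabolic cs (I := {i, j}) (i := j) (by simp)
  rw [← mul_assoc, length_mul_of_mem_minReps cs hv hd,
    length_mul_of_mem_minReps cs (mul_mem hmi hv) hd] at hi
  rw [← mul_assoc, length_mul_of_mem_minReps cs hv hd,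
    length_mul_of_mem_minReps cs (mul_mem hmj hv) hd] at hj
  replace hi : cs.length (cs.simple i * v) < cs.length v := by omega
  replace hj : cs.length (cs.simple j * v) < cs.length v := by omega
  -- a descent `a` gives a reduced word of `v` starting with `a`
  have key (a b : B) (hab : ({i, j} : Finset B) = {a, b})
      (ha : cs.length (cs.simple a * v) < cs.length v) :
      cs.IsReduced (altHead a b (cs.length v)) ∧ cs.wordProd (altHead a b (cs.length v)) = v := by
    have ham := simple_mem_parabolic cs (I := {i, j}) (i := a) (by simp [hab])
    obtain ⟨ω, hI, hω, hp⟩ := exists_word_of_mem_parabolic cs (mul_mem ham hv)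
    have hp' : cs.wordProd (a :: ω) = v := by
      rw [cs.wordProd_cons, hp, cs.simple_mul_simple_cancel_left]
    have hr : cs.IsReduced (a :: ω) := by
      rw [isReduced_cons_iff cs hω, hp, cs.simple_mul_simple_cancel_left]
      exact ha
    have hlen : (a :: ω).length = cs.length v := by
      rw [← hp']; exact hr.symm
    have hmem : ∀ c ∈ a :: ω, c = a ∨ c = b := by
      intro c hc
      rcases List.mem_cons.1 hc with rfl | hc
      · exact Or.inl rfl
      · have := hI c hc; rw [hab] at this; simpa using this
    rcases eq_altHead_of_isReduced cs hr hmem with h | h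
    · rw [hlen] at h; rw [← h]; exact ⟨hr, hp'⟩
    · have hba : a = b := by
        rw [List.length_cons, altHead] at h; exact (List.cons.inj h).1
      subst hba
      rw [hlen] at h; rw [← h]; exact ⟨hr, hp'⟩
  obtain ⟨r1, p1⟩ := key i j rfl hi
  obtain ⟨r2, p2⟩ := key j i (Finset.pair_comm _ _) hj
  -- The two alternating words of v give (s_i s_j)^ℓ(v) = 1, so m divides ℓ(v); as reduced
  -- alternating words have length at most m, this makes ℓ(v) = m.
  have hdvd := dvd_of_simple_mul_simple_pow_eq_one cs i j _
    (pow_eq_one_of_wordProd_altHead_eq cs (by simp) (p1.trans p2.symm))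
  rw [← two_mul, Nat.mul_div_cancel_left _ (by norm_num)] at hdvd
  have hpos : 0 < cs.length v := by omega
  have hM : M i j ≠ 0 := by
    intro h; rw [h, zero_dvd_iff] at hdvd; omega
  have hlen : cs.length v = M i j :=
    le_antisymm (le_of_isReduced_altHead cs r1 hM) (Nat.le_of_dvd hpos hdvd)
  obtain ⟨δ, hδ, hδd⟩ := cs.exists_isReduced d
  rw [hlen] at r1 p1 r2 p2
  have hl := length_mul_of_mem_minReps cs hv hd
  have hδ' : cs.length d = δ.length := by rw [hδd]; exact hδ
  refine ⟨hM, δ, ?_, ?_, ?_, ?_⟩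
  · unfold CoxeterSystem.IsReduced
    rw [cs.wordProd_append, p1, ← hδd, hl]; simp; omega
  · rw [cs.wordProd_append, p1, ← hδd]
  · unfold CoxeterSystem.IsReduced
    rw [cs.wordProd_append, p2, ← hδd, hl]; simp; omega
  · rw [cs.wordProd_append, p2, ← hδd]

/-- Matsumoto's theorem. -/
theorem matsumoto {N : Type*} [Monoid N] (f : B → N)
    (hf : ∀ i j, i ≠ j → ((CoxeterSystem.alternatingWord i j (M i j)).map f).prod =
      ((CoxeterSystem.alternatingWord j i (M i j)).map f).prod)
    {ω ω' : List B} (hω : cs.IsReduced ω) (hω' : cs.IsReduced ω')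
    (h : cs.wordProd ω = cs.wordProd ω') : (ω.map f).prod = (ω'.map f).prod := by
  induction hn : ω.length generalizing ω ω' with
  | zero =>
    have : ω'.length = 0 := by
      rw [← hω'.eq, ← h, hω.eq, hn]
    rw [List.length_eq_zero_iff.1 hn, List.length_eq_zero_iff.1 this]
  | succ n ih =>
    have hn' : ω'.length = n + 1 := by
      rw [← hω'.eq, ← h, hω.eq, hn]
    obtain ⟨i, ω, rfl⟩ := List.exists_cons_of_length_eq_add_one hn
    obtain ⟨j, ω', rfl⟩ := List.exists_cons_of_length_eq_add_one hn'
    have tail (a : B) (ρ ρ' : List B) (h1 : cs.IsReduced (a :: ρ)) (h2 : cs.IsReduced (a :: ρ'))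
        (h3 : cs.wordProd (a :: ρ) = cs.wordProd (a :: ρ')) (h4 : (a :: ρ).length = n + 1) :
        ((a :: ρ).map f).prod = ((a :: ρ').map f).prod := by
      rw [List.map_cons, List.map_cons, List.prod_cons, List.prod_cons,
        ih (isReduced_of_cons cs h1) (isReduced_of_cons cs h2)
          (by simpa [cs.wordProd_cons] using h3) (by simpa using h4)]
    by_cases hij : i = j
    · subst hij
      exact tail i ω ω' hω hω' h hn
    have hdi : cs.length (cs.simple i * cs.wordProd (i :: ω)) <
        cs.length (cs.wordProd (i :: ω)) := by
      have := (isReduced_cons_iff cs (isReduced_of_cons cs hω) i).1 hω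
      rwa [cs.wordProd_cons, cs.simple_mul_simple_cancel_left]
    have hdj : cs.length (cs.simple j * cs.wordProd (i :: ω)) <
        cs.length (cs.wordProd (i :: ω)) := by
      have := (isReduced_cons_iff cs (isReduced_of_cons cs hω') j).1 hω'
      rwa [h, cs.wordProd_cons, cs.simple_mul_simple_cancel_left]
    -- Pass through two intermediate words, one starting with i and one with j, that differ by a
    -- single braid move. Each shares its first letter with a given word, so induction applies to
    -- the tails.
    obtain ⟨hM, δ, r1, p1, r2, p2⟩ := exists_braid_mul_of_descents cs hdi hdj
    have hb := (map_altHead_prod_eq_iff f i j (M i j)).2 (hf i j hij)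
    obtain ⟨m, hm⟩ := Nat.exists_eq_succ_of_ne_zero hM
    rw [hm] at r1 p1 r2 p2 hb
    have e1 := tail i ω _ hω r1 p1.symm hn
    have e2 := tail j ω' _ hω' r2 (h.symm.trans p2.symm) hn'
    rw [e1, e2]
    have : (List.map f (altHead i j (m + 1) ++ δ)).prod =
        (List.map f (altHead j i (m + 1) ++ δ)).prod := by
      rw [List.map_append, List.map_append, List.prod_append, List.prod_append]
      rw [show ((altHead i j (m + 1)).map f).prod = ((altHead j i (m + 1)).map f).prod from hb]
    exact this

end CoxeterWords

section Longest

variable {B W : Type*} [Group W] {M : CoxeterMatrix B} {cs : CoxeterSystem M W}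

/-! ### Longest elements and adapted words -/

theorem exists_isLongest (I : Finitary cs) : ∃ w, IsLongest cs I.1 w := by
  obtain ⟨w, hw, hmax⟩ := Set.exists_max_image (parabolic cs I.1 : Set W) cs.length I.2
    ⟨1, one_mem _⟩
  exact ⟨w, hw, hmax⟩

theorem IsLongest.length_mul_simple_lt {I : Finset B} {w : W} (hw : IsLongest cs I w) {i : B}
    (hi : i ∈ I) : cs.length (w * cs.simple i) < cs.length w :=
  lt_of_le_of_ne (hw.2 _ (mul_mem hw.1 (simple_mem_parabolic cs hi))) (cs.length_mul_simple_ne w i)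

theorem IsLongest.length_simple_mul_lt {I : Finset B} {w : W} (hw : IsLongest cs I w) {i : B}
    (hi : i ∈ I) : cs.length (cs.simple i * w) < cs.length w :=
  lt_of_le_of_ne (hw.2 _ (mul_mem (simple_mem_parabolic cs hi) hw.1)) (cs.length_simple_mul_ne w i)

/-- Induct on a reduced word of u. With w = x u' and next letter i, the reflection u'⁻¹ s_i u' lies
in W_I, hence is a right inversion of the longest element. If x s_i were longer than x, strong
exchange would delete a letter from x, making x s_i shorter, or from u', making s_i u' shorter: both
are impossible. -/
theorem IsLongest.length_mul_inv {I : Finset B} {w u : W} (hw : IsLongest cs I w)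
    (hu : u ∈ parabolic cs I) : cs.length (w * u⁻¹) + cs.length u = cs.length w := by
  obtain ⟨ω, hI, hω, rfl⟩ := exists_word_of_mem_parabolic cs hu
  clear hu
  induction ω with
  | nil => simp
  | cons i ω ih =>
    have hω' := isReduced_of_cons cs hω
    have hI' : ∀ j ∈ ω, j ∈ I := fun j hj => hI j (by simp [hj])
    have ih := ih hI' hω'
    have hi : cs.simple i ∈ parabolic cs I := simple_mem_parabolic cs (hI i (by simp))
    have hu := wordProd_mem_parabolic cs hI'
    have hlt := (isReduced_cons_iff cs hω' i).1 hω
    rw [← cs.wordProd_cons] at hlt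
    rw [cs.wordProd_cons, mul_inv_rev, cs.inv_simple, ← mul_assoc, ← cs.wordProd_cons]
    have hl1 : cs.length (cs.wordProd (i :: ω)) = ω.length + 1 := hω
    have hl2 : cs.length (cs.wordProd ω) = ω.length := hω'
    set x := w * (cs.wordProd ω)⁻¹ with hx
    rcases cs.length_mul_simple x i with h | h
    swap
    · omega
    exfalso
    obtain ⟨ξ, hξ, hξx⟩ := cs.exists_isReduced x
    have hl3 : cs.length x = ξ.length := by rw [hξx]; exact hξ
    have hwx : cs.wordProd (ξ ++ ω) = w := by
      rw [cs.wordProd_append, ← hξx, hx, inv_mul_cancel_right]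
    have hr : cs.IsReflection ((cs.wordProd ω)⁻¹ * cs.simple i * cs.wordProd ω) :=
      ⟨(cs.wordProd ω)⁻¹, i, by simp⟩
    have hinv : cs.IsRightInversion (cs.wordProd (ξ ++ ω))
        ((cs.wordProd ω)⁻¹ * cs.simple i * cs.wordProd ω) := by
      refine ⟨hr, ?_⟩
      rw [hwx]
      exact lt_of_le_of_ne (hw.2 _ (mul_mem hw.1 (mul_mem (mul_mem (inv_mem hu) hi) hu)))
        (hr.length_mul_left_ne w)
    obtain ⟨j, hj, he⟩ := exchange_right cs hinv
    rw [List.eraseIdx_append, cs.wordProd_append] at he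
    split_ifs at he with hjξ
    · rw [cs.wordProd_append, mul_assoc, mul_assoc, mul_inv_cancel_left, ← mul_assoc,
        mul_left_inj, ← hξx] at he
      have h1 := cs.length_wordProd_le (ξ.eraseIdx j)
      have h2 := List.length_eraseIdx_add_one hjξ
      rw [← he] at h1
      omega
    · have hj' : j - ξ.length < ω.length := by simp at hj; omega
      rw [cs.wordProd_append, mul_assoc, mul_assoc, mul_inv_cancel_left, mul_right_inj,
        ← cs.wordProd_cons] at he
      have h1 := cs.length_wordProd_le (ω.eraseIdx (j - ξ.length))
      have h2 := List.length_eraseIdx_add_one hj'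
      rw [← he] at h1
      omega

theorem isLongest_empty : IsLongest cs ∅ (1 : W) :=
  ⟨one_mem _, fun v hv => by
    have : v = 1 := by simpa [parabolic] using hv
    rw [this]⟩

theorem Flag.Adapted.isReduced : ∀ {I : Finitary cs} {c : Flag cs I} {ω : List B},
    c.Adapted ω → cs.IsReduced ω
  | _, .nil, ω, h => by
    rw [Flag.Adapted] at h
    subst h
    simp [CoxeterSystem.IsReduced]
  | _, .snoc c _, ω, h => by
    rw [Flag.Adapted] at h
    exact h.1

theorem Flag.Adapted.isLongest : ∀ {I : Finitary cs} {c : Flag cs I} {ω : List B},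
    c.Adapted ω → IsLongest cs I.1 (cs.wordProd ω)
  | _, .nil, ω, h => by
    rw [Flag.Adapted] at h
    subst h
    simpa [emp] using isLongest_empty
  | _, .snoc c _, ω, h => by
    rw [Flag.Adapted] at h
    exact h.2.1

/-- Every element of W_J is a final factor of w_J with lengths adding. So an adapted word for w_I
extends on the left by a reduced word of w_J w_I⁻¹. -/
theorem Flag.exists_adapted {I : Finitary cs} (c : Flag cs I) : ∃ ω, c.Adapted ω := by
  induction c with
  | nil => exact ⟨[], by rw [Flag.Adapted]⟩
  | @snoc I J c h ih =>
    obtain ⟨υ, hυ⟩ := ih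
    obtain ⟨w, hw⟩ := exists_isLongest J
    have hu : cs.wordProd υ ∈ parabolic cs J.1 := parabolic_mono cs h.1.1 hυ.isLongest.1
    have hl := hw.length_mul_inv hu
    obtain ⟨ξ, hξ, hξx⟩ := cs.exists_isReduced (w * (cs.wordProd υ)⁻¹)
    have hp : cs.wordProd (ξ ++ υ) = w := by
      rw [cs.wordProd_append, ← hξx, inv_mul_cancel_right]
    have hl1 : cs.length (cs.wordProd ξ) = ξ.length := hξ
    have hl2 : cs.length (cs.wordProd υ) = υ.length := hυ.isReduced
    refine ⟨ξ ++ υ, ?_⟩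
    rw [Flag.Adapted]
    refine ⟨?_, by rwa [hp], υ, List.suffix_append _ _, hυ⟩
    unfold CoxeterSystem.IsReduced
    rw [hp, ← hl, List.length_append, hξx, hl1, hl2]

/-- A subset of a finitary set is finitary. -/
def Finitary.sub (J : Finitary cs) (I : Finset B) (h : I ⊆ J.1) : Finitary cs :=
  ⟨I, J.2.subset (parabolic_mono cs h)⟩

theorem Flag.nonempty (I : Finitary cs) : Nonempty (Flag cs I) := by
  classical
  induction hn : I.1.card generalizing I with
  | zero =>
    have : I = emp cs := Subtype.ext (Finset.card_eq_zero.1 hn)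
    rw [this]
    exact ⟨.nil⟩
  | succ n ih =>
    obtain ⟨a, ha⟩ := Finset.card_pos.1 (by omega : 0 < I.1.card)
    obtain ⟨c⟩ := ih (I.sub (I.1.erase a) (Finset.erase_subset _ _))
      (by simp [Finitary.sub, Finset.card_erase_of_mem ha, hn])
    exact ⟨.snoc c ⟨Finset.erase_ssubset ha, Finset.card_erase_add_one ha⟩⟩

/-! ### Rank two -/

theorem exists_altHead_of_mem_parabolic_pair [DecidableEq B] {i j : B} {w : W}
    (hw : w ∈ parabolic cs {i, j}) :
    ∃ k, cs.length w = k ∧ (cs.IsReduced (altHead i j k) ∧ w = cs.wordProd (altHead i j k) ∨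
      cs.IsReduced (altHead j i k) ∧ w = cs.wordProd (altHead j i k)) := by
  obtain ⟨ω, hI, hω, rfl⟩ := exists_word_of_mem_parabolic cs hw
  refine ⟨ω.length, hω, ?_⟩
  rcases eq_altHead_of_isReduced cs hω (i := i) (j := j) (fun a ha => by simpa using hI a ha)
    with h | h
  · left; rw [← h]; exact ⟨hω, rfl⟩
  · right; rw [← h]; exact ⟨hω, rfl⟩

theorem length_le_of_mem_parabolic_pair [DecidableEq B] {i j : B} (hM : M i j ≠ 0) {w : W}
    (hw : w ∈ parabolic cs {i, j}) : cs.length w ≤ M i j := by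
  obtain ⟨k, hk, h | h⟩ := exists_altHead_of_mem_parabolic_pair hw
  · rw [hk]; exact le_of_isReduced_altHead cs h.1 hM
  · rw [hk, M.symmetric]; exact le_of_isReduced_altHead cs h.1 (by rwa [M.symmetric])

/-- The finitary set `{i, j}`, for `m_{ij} < ∞`. -/
def pair [DecidableEq B] (cs : CoxeterSystem M W) {i j : B} (hM : M i j ≠ 0) : Finitary cs :=
  ⟨{i, j}, by
    have hf : (Set.Iic (M i j)).Finite := Set.finite_Iic _
    refine ((hf.image fun k => cs.wordProd (altHead i j k)).union
      (hf.image fun k => cs.wordProd (altHead j i k))).subset fun w hw => ?_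
    have hle := length_le_of_mem_parabolic_pair hM hw
    obtain ⟨k, hk, h | h⟩ := exists_altHead_of_mem_parabolic_pair hw
    · exact Or.inl ⟨k, hk ▸ hle, h.2.symm⟩
    · exact Or.inr ⟨k, hk ▸ hle, h.2.symm⟩⟩

theorem isLongest_pair [DecidableEq B] {i j : B} (hM : M i j ≠ 0) :
    IsLongest cs {i, j} (cs.wordProd (CoxeterSystem.alternatingWord i j (M i j))) ∧
      cs.IsReduced (CoxeterSystem.alternatingWord i j (M i j)) := by
  have hr : cs.IsReduced (CoxeterSystem.alternatingWord i j (M i j)) := by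
    by_cases hk : Even (M i j)
    · have := isReduced_altHead cs i j (k := M i j) (Or.inr le_rfl)
      rwa [altHead_eq, if_pos hk] at this
    · have := isReduced_altHead cs j i (k := M i j) (Or.inr (M.symmetric i j).le)
      rwa [altHead_eq, if_neg hk] at this
  refine ⟨⟨wordProd_mem_parabolic cs fun a ha => ?_, fun v hv => ?_⟩, hr⟩
  · by_cases hk : Even (M i j)
    · have h := altHead_eq i j (M i j)
      rw [if_pos hk] at h
      rw [← h] at ha
      simpa using mem_altHead ha
    · have h := altHead_eq j i (M i j)
      rw [if_neg hk] at h
      rw [← h] at ha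
      simpa [or_comm] using mem_altHead ha
  · rw [hr.eq, CoxeterSystem.length_alternatingWord]
    exact length_le_of_mem_parabolic_pair hM hv

theorem covers_sing_pair [DecidableEq B] {i j : B} (hij : i ≠ j) {J : Finitary cs}
    (hJ : J.1 = {i, j}) : Covers (sing cs j) J := by
  refine ⟨?_, by rw [hJ]; simp [sing, Finset.card_pair hij]⟩
  rw [hJ, Finset.ssubset_iff]
  exact ⟨i, by simpa [sing] using hij, by simp [sing]⟩

/-- The chain `∅ ⊏ {j}`. -/
def Flag.single (cs : CoxeterSystem M W) (j : B) : Flag cs (sing cs j) :=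
  .snoc .nil (covers_emp_sing cs j)

theorem Flag.single_adapted (j : B) : (Flag.single cs j).Adapted [j] := by
  rw [Flag.single, Flag.Adapted]
  have hr : cs.IsReduced [j] := by simp [CoxeterSystem.IsReduced]
  refine ⟨hr, ⟨wordProd_mem_parabolic cs (by simp [sing]), fun v hv => ?_⟩, [], List.nil_suffix, by
    rw [Flag.Adapted]⟩
  obtain ⟨ω, hI, hω, rfl⟩ := exists_word_of_mem_parabolic cs hv
  rw [hω.eq, hr.eq]
  rcases ω with _ | ⟨a, _ | ⟨b, ω⟩⟩
  · simp
  · simp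
  · have ha := hI a (by simp)
    have hb := hI b (by simp)
    simp only [sing, Finset.mem_singleton] at ha hb
    subst ha hb
    exact absurd hω (not_isReduced_cons_cons cs _ _)

/-- `alternatingWord i j` ends in j, so it suits the chain through {j}; the swapped word suits the
chain through {i}. Relation 3 for these two chains will yield the braid relation. -/
theorem Flag.pair_adapted [DecidableEq B] {i j : B} (hij : i ≠ j) (hM : M i j ≠ 0)
    {J : Finitary cs} (hJ : J.1 = {i, j}) :
    (Flag.snoc (Flag.single cs j) (covers_sing_pair hij hJ)).Adapted
      (CoxeterSystem.alternatingWord i j (M i j)) := by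
  rw [Flag.Adapted, hJ]
  refine ⟨(isLongest_pair hM).2, (isLongest_pair hM).1, [j], ?_, Flag.single_adapted j⟩
  obtain ⟨m, hm⟩ := Nat.exists_eq_succ_of_ne_zero hM
  rw [hm, Nat.succ_eq_add_one, CoxeterSystem.alternatingWord_succ, List.concat_eq_append]
  exact List.suffix_append _ _

end Longest

/-! ### The Hecke algebra as a free module with basis T_w. -/

noncomputable section

section HeckeBasis

variable {B W : Type*} [Group W] {M : CoxeterMatrix B} (cs : CoxeterSystem M W)

/-! ### The regular representation of the Hecke algebra -/

open Polynomial in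
/-- Left multiplication by `T_i` on the free module on `W`. -/
def opL (i : B) : Module.End ℤ[X] (W →₀ ℤ[X]) :=
  Finsupp.linearCombination ℤ[X] fun w =>
    if cs.length w < cs.length (cs.simple i * w) then Finsupp.single (cs.simple i * w) 1
    else (X : ℤ[X]) • Finsupp.single (cs.simple i * w) 1 + (X - 1 : ℤ[X]) • Finsupp.single w 1

open Polynomial in
/-- Right multiplication by `T_i` on the free module on `W`. -/
def opR (i : B) : Module.End ℤ[X] (W →₀ ℤ[X]) :=
  Finsupp.linearCombination ℤ[X] fun w =>
    if cs.length w < cs.length (w * cs.simple i) then Finsupp.single (w * cs.simple i) 1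
    else (X : ℤ[X]) • Finsupp.single (w * cs.simple i) 1 + (X - 1 : ℤ[X]) • Finsupp.single w 1

theorem opL_up {i : B} {w : W} (h : cs.length w < cs.length (cs.simple i * w)) :
    opL cs i (Finsupp.single w 1) = Finsupp.single (cs.simple i * w) 1 := by
  simp [opL, h]

open Polynomial in
theorem opL_down {i : B} {w : W} (h : cs.length (cs.simple i * w) < cs.length w) :
    opL cs i (Finsupp.single w 1) = (X : ℤ[X]) • Finsupp.single (cs.simple i * w) 1 +
      (X - 1 : ℤ[X]) • Finsupp.single w 1 := by
  simp only [opL, Finsupp.linearCombination_single, if_neg (not_lt.2 h.le), one_smul]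

theorem opR_up {i : B} {w : W} (h : cs.length w < cs.length (w * cs.simple i)) :
    opR cs i (Finsupp.single w 1) = Finsupp.single (w * cs.simple i) 1 := by
  simp [opR, h]

open Polynomial in
theorem opR_down {i : B} {w : W} (h : cs.length (w * cs.simple i) < cs.length w) :
    opR cs i (Finsupp.single w 1) = (X : ℤ[X]) • Finsupp.single (w * cs.simple i) 1 +
      (X - 1 : ℤ[X]) • Finsupp.single w 1 := by
  simp only [opR, Finsupp.linearCombination_single, if_neg (not_lt.2 h.le), one_smul]

/-- Exchange removes a letter from a word i, s_1, …, s_l. Removing one of the s_k would make w s_j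
shorter than w, so the removed letter is the initial i. -/
theorem simple_mul_eq_mul_simple {i j : B} {w : W}
    (hi : cs.length w < cs.length (cs.simple i * w))
    (hj : cs.length w < cs.length (w * cs.simple j))
    (hij : cs.length (cs.simple i * w * cs.simple j) < cs.length (cs.simple i * w)) :
    cs.simple i * w = w * cs.simple j := by
  obtain ⟨ω, hω, rfl⟩ := cs.exists_isReduced w
  rw [← cs.wordProd_cons] at hij
  obtain ⟨k, hk, he⟩ := exchange_right cs ⟨cs.isReflection_simple j, hij⟩
  cases k with
  | zero =>
    rw [List.eraseIdx_zero, List.tail_cons, cs.wordProd_cons] at he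
    nth_rw 2 [← he]
    rw [cs.simple_mul_simple_cancel_right]
  | succ k =>
    exfalso
    rw [List.eraseIdx_cons_succ, cs.wordProd_cons, cs.wordProd_cons, mul_assoc,
      mul_right_inj] at he
    have h1 := cs.length_wordProd_le (ω.eraseIdx k)
    have h2 := List.length_eraseIdx_add_one (l := ω) (i := k) (by simpa using hk)
    have h3 : cs.length (cs.wordProd ω) = ω.length := hω
    rw [← he] at h1
    omega

/-- A check on basis vectors according to how left and right multiplication change the length. Only
the configurations with s_i w = w s_j are not formal; `simple_mul_eq_mul_simple` identifies them. -/
theorem opL_commute_opR (i j : B) : Commute (opL cs i) (opR cs j) := by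
  have hA := mul_assoc (cs.simple i)
  refine Finsupp.lhom_ext' fun w => LinearMap.ext_ring ?_
  simp only [Module.End.mul_eq_comp, LinearMap.comp_apply, Finsupp.lsingle_apply]
  have h1 := cs.length_simple_mul w i
  have h2 := cs.length_mul_simple w j
  have h3 := cs.length_mul_simple (cs.simple i * w) j
  have h4 := cs.length_simple_mul (w * cs.simple j) i
  rw [← mul_assoc] at h4
  rcases h1 with h1 | h1 <;> rcases h2 with h2 | h2
  · rw [opL_up cs (by omega), opR_up cs (by omega)]
    rcases h3 with h3 | h3
    · rw [opL_up cs (by rw [← mul_assoc]; omega), opR_up cs (by omega), mul_assoc]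
    · have he := simple_mul_eq_mul_simple cs (i := i) (j := j) (w := w) (by omega) (by omega)
        (by omega)
      rw [opL_down cs (by rw [← mul_assoc]; omega), opR_down cs (by omega), mul_assoc, he]
  · rw [opL_up cs (by omega), opR_down cs (by omega), opR_down cs (by omega), map_add, map_smul,
      map_smul, opL_up cs (by rw [← mul_assoc]; omega), opL_up cs (by omega), mul_assoc]
  · rw [opL_down cs (by omega), opR_up cs (by omega), map_add, map_smul,
      map_smul, opL_down cs (by rw [← mul_assoc]; omega), opR_up cs (by omega),
      opR_up cs (by omega), mul_assoc]
  · rw [opL_down cs (by omega), opR_down cs (by omega), map_add, map_smul,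
      map_smul, map_add, map_smul, map_smul, opL_down cs (i := i) (w := w) (by omega),
      opR_down cs (i := j) (w := w) (by omega)]
    rcases h3 with h3 | h3
    -- Here the lower element s_i w, not w itself, satisfies the hypotheses of the exchange lemma.
    · have he := simple_mul_eq_mul_simple cs (i := i) (j := j) (w := cs.simple i * w)
        (by rw [cs.simple_mul_simple_cancel_left]; omega) (by omega)
        (by rw [cs.simple_mul_simple_cancel_left]; omega)
      rw [cs.simple_mul_simple_cancel_left] at he
      have he' : cs.simple i * w = w * cs.simple j := by
        rw [← cs.simple_mul_simple_cancel_right (w := cs.simple i * w) j, ← he]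
      rw [opL_up cs (by rw [← mul_assoc]; omega), opR_up cs (by omega), mul_assoc, he']
    · rw [opL_down cs (by rw [← mul_assoc]; omega), opR_down cs (by omega), mul_assoc]
      module

open Polynomial in
theorem opL_mul_self (i : B) :
    opL cs i * opL cs i = (X - 1 : ℤ[X]) • opL cs i + (X : ℤ[X]) • 1 := by
  refine Finsupp.lhom_ext' fun w => LinearMap.ext_ring ?_
  simp only [Module.End.mul_eq_comp, LinearMap.comp_apply, Finsupp.lsingle_apply,
    LinearMap.add_apply, LinearMap.smul_apply, Module.End.one_apply]
  rcases cs.length_simple_mul w i with h | h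
  · rw [opL_up cs (by omega), opL_down cs (by rw [cs.simple_mul_simple_cancel_left]; omega),
      cs.simple_mul_simple_cancel_left, add_comm]
  · rw [opL_down cs (by omega), map_add, map_smul, map_smul,
      opL_up cs (by rw [cs.simple_mul_simple_cancel_left]; omega), opL_down cs (by omega),
      cs.simple_mul_simple_cancel_left]
    module

theorem opL_word {ω : List B} (hω : cs.IsReduced ω) :
    (ω.map (opL cs)).prod (Finsupp.single 1 1) = Finsupp.single (cs.wordProd ω) 1 := by
  induction ω with
  | nil => simp
  | cons i ω ih =>
    have hω' := isReduced_of_cons cs hω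
    rw [List.map_cons, List.prod_cons, Module.End.mul_apply, ih hω',
      opL_up cs ((isReduced_cons_iff cs hω' i).1 hω), cs.wordProd_cons]

/-- Every basis vector arises from that of 1 by an operator commuting with all `opL`. An identity
between products of the `opL` may therefore be tested on the vector of 1 alone, which is how the
braid relations are proved. -/
theorem exists_opR_word (w : W) : ∃ Q : Module.End ℤ[X] (W →₀ ℤ[X]),
    (∀ i, Commute (opL cs i) Q) ∧ Q (Finsupp.single 1 1) = Finsupp.single w 1 := by
  induction hn : cs.length w generalizing w with
  | zero =>
    rw [cs.length_eq_zero_iff.1 hn]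
    exact ⟨1, fun i => Commute.one_right _, rfl⟩
  | succ n ih =>
    have hw : w ≠ 1 := by
      rintro rfl
      simp at hn
    obtain ⟨j, hj⟩ := cs.exists_rightDescent_of_ne_one hw
    have hj' := cs.isRightDescent_iff.1 hj
    obtain ⟨Q, hQ, hQ1⟩ := ih (w * cs.simple j) (by omega)
    refine ⟨opR cs j * Q, fun i => (opL_commute_opR cs i j).mul_right (hQ i), ?_⟩
    rw [Module.End.mul_apply, hQ1, opR_up cs (by rw [cs.simple_mul_simple_cancel_right]; omega),
      cs.simple_mul_simple_cancel_right]

theorem opL_braid (i j : B) :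
    ((CoxeterSystem.alternatingWord i j (M i j)).map (opL cs)).prod =
      ((CoxeterSystem.alternatingWord j i (M i j)).map (opL cs)).prod := by
  classical
  by_cases hM : M i j = 0
  · simp [hM, CoxeterSystem.alternatingWord]
  refine Finsupp.lhom_ext' fun w => LinearMap.ext_ring ?_
  simp only [LinearMap.comp_apply, Finsupp.lsingle_apply]
  obtain ⟨Q, hQ, hQ1⟩ := exists_opR_word cs w
  have hc (ω : List B) : Commute (ω.map (opL cs)).prod Q :=
    Commute.list_prod_left _ _ (by simpa using fun i _ => hQ i)
  have hb := cs.wordProd_braidWord_eq i j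
  unfold CoxeterSystem.braidWord at hb
  rw [← hQ1, ← Module.End.mul_apply, ← Module.End.mul_apply, (hc _).eq, (hc _).eq,
    Module.End.mul_apply, Module.End.mul_apply, opL_word cs (isLongest_pair hM).2, hb,
    M.symmetric i j, opL_word cs (isLongest_pair (by rwa [M.symmetric])).2]

/-- The regular representation of the Hecke algebra on the free module on `W`. -/
def heckeRep : HeckeAlg M →ₐ[ℤ[X]] Module.End ℤ[X] (W →₀ ℤ[X]) :=
  RingQuot.liftAlgHom ℤ[X] ⟨FreeAlgebra.lift ℤ[X] (opL cs), by
    intro a b h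
    induction h with
    | quad s =>
      simp only [map_mul, map_add, map_smul, FreeAlgebra.lift_ι_apply, AlgHom.commutes]
      rw [opL_mul_self, Algebra.algebraMap_eq_smul_one]
    | braid s t hst =>
      simp only [map_list_prod, List.map_map]
      have : (FreeAlgebra.lift ℤ[X] (opL cs)) ∘ FreeAlgebra.ι ℤ[X] = opL cs := by
        ext1 i; simp
      rw [this, opL_braid]⟩

theorem heckeRep_heckeT (i : B) : heckeRep cs (heckeT M i) = opL cs i := by
  simp [heckeRep, heckeT]

variable (M) in
open Polynomial in
theorem heckeT_mul_self (i : B) :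
    heckeT M i * heckeT M i = (X - 1 : ℤ[X]) • heckeT M i + (X : ℤ[X]) • 1 := by
  have := RingQuot.mkAlgHom_rel ℤ[X] (HeckeRel.quad (M := M) i)
  simpa [heckeT, Algebra.algebraMap_eq_smul_one] using this

variable (M) in
theorem heckeT_braid (i j : B) (hij : i ≠ j) :
    ((CoxeterSystem.alternatingWord i j (M i j)).map (heckeT M)).prod =
      ((CoxeterSystem.alternatingWord j i (M i j)).map (heckeT M)).prod := by
  have := RingQuot.mkAlgHom_rel ℤ[X] (HeckeRel.braid (M := M) i j hij)
  rw [map_list_prod, map_list_prod, List.map_map, List.map_map] at this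
  exact this

/-- To prove something about all elements of the Hecke algebra, it suffices to consider
generators. -/
theorem heckeAlg_induction {p : HeckeAlg M → Prop} (h : HeckeAlg M)
    (algMap : ∀ r : ℤ[X], p (algebraMap _ _ r)) (gen : ∀ i, p (heckeT M i))
    (add : ∀ a b, p a → p b → p (a + b)) (mul : ∀ a b, p a → p b → p (a * b)) : p h := by
  obtain ⟨x, rfl⟩ := RingQuot.mkAlgHom_surjective ℤ[X] (HeckeRel M) h
  induction x with
  | grade0 r => rw [AlgHom.commutes]; exact algMap r
  | grade1 i => exact gen i
  | mul a b ha hb => rw [map_mul]; exact mul _ _ ha hb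
  | add a b ha hb => rw [map_add]; exact add _ _ ha hb

/-! ### The standard basis -/

theorem basisT_wordProd {ω : List B} (hω : cs.IsReduced ω) :
    basisT cs (cs.wordProd ω) = (ω.map (heckeT M)).prod := by
  have h := Classical.choose_spec (cs.exists_isReduced (cs.wordProd ω))
  exact matsumoto cs (heckeT M) (fun i j hij => by
    rw [heckeT_braid M i j hij]) h.1 hω h.2.symm

theorem basisT_one : basisT cs (1 : W) = 1 := by
  have := basisT_wordProd cs (ω := []) (by simp [CoxeterSystem.IsReduced])
  simpa using this

theorem basisT_simple (i : B) : basisT cs (cs.simple i) = heckeT M i := by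
  have := basisT_wordProd cs (ω := [i]) (by simp [CoxeterSystem.IsReduced])
  simpa using this

theorem basisT_mul {v w : W} (h : cs.length (v * w) = cs.length v + cs.length w) :
    basisT cs (v * w) = basisT cs v * basisT cs w := by
  obtain ⟨ω, hω, rfl⟩ := cs.exists_isReduced v
  obtain ⟨ω', hω', rfl⟩ := cs.exists_isReduced w
  have hr : cs.IsReduced (ω ++ ω') := by
    unfold CoxeterSystem.IsReduced at *
    rw [cs.wordProd_append, h, hω, hω', List.length_append]
  rw [← cs.wordProd_append, basisT_wordProd cs hr, basisT_wordProd cs hω, basisT_wordProd cs hω',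
    List.map_append, List.prod_append]

theorem heckeT_mul_basisT_up {i : B} {w : W} (h : cs.length w < cs.length (cs.simple i * w)) :
    heckeT M i * basisT cs w = basisT cs (cs.simple i * w) := by
  have := cs.length_simple_mul w i
  rw [basisT_mul cs (by rw [cs.length_simple]; omega), basisT_simple]

open Polynomial in
theorem heckeT_mul_basisT_down {i : B} {w : W} (h : cs.length (cs.simple i * w) < cs.length w) :
    heckeT M i * basisT cs w = (X : ℤ[X]) • basisT cs (cs.simple i * w) +
      (X - 1 : ℤ[X]) • basisT cs w := by
  have h1 : basisT cs w = heckeT M i * basisT cs (cs.simple i * w) := by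
    rw [heckeT_mul_basisT_up cs (by rwa [cs.simple_mul_simple_cancel_left]),
      cs.simple_mul_simple_cancel_left]
  conv_lhs => rw [h1, ← mul_assoc, heckeT_mul_self, add_mul, smul_mul_assoc, ← h1,
    smul_mul_assoc, one_mul]
  rw [add_comm]

/-- The coordinates of an element of the Hecke algebra in the standard basis. -/
def heckeCoord : HeckeAlg M →ₗ[ℤ[X]] (W →₀ ℤ[X]) :=
  LinearMap.applyₗ (Finsupp.single 1 1) ∘ₗ (heckeRep cs).toLinearMap

theorem heckeCoord_apply (h : HeckeAlg M) :
    heckeCoord cs h = heckeRep cs h (Finsupp.single 1 1) := rfl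

theorem heckeCoord_mul (a b : HeckeAlg M) :
    heckeCoord cs (a * b) = heckeRep cs a (heckeCoord cs b) := by
  rw [heckeCoord_apply, map_mul]; rfl

theorem heckeCoord_basisT (w : W) : heckeCoord cs (basisT cs w) = Finsupp.single w 1 := by
  obtain ⟨ω, hω, rfl⟩ := cs.exists_isReduced w
  rw [basisT_wordProd cs hω, heckeCoord_apply, map_list_prod, List.map_map, ← opL_word cs hω]
  congr 3
  funext i
  exact heckeRep_heckeT cs i

/-- The map e_w ↦ T_w intertwines the regular representation with left multiplication. Evaluated at
e_1 this shows that `heckeCoord` recovers an element from its coordinates, so the T_w form a basis.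
-/
theorem linearCombination_heckeRep (h : HeckeAlg M) (x : W →₀ ℤ[X]) :
    Finsupp.linearCombination ℤ[X] (basisT cs) (heckeRep cs h x) =
      h * Finsupp.linearCombination ℤ[X] (basisT cs) x := by
  induction h using heckeAlg_induction generalizing x with
  | algMap r => rw [AlgHom.commutes, Algebra.algebraMap_eq_smul_one,
      Algebra.algebraMap_eq_smul_one, LinearMap.smul_apply, map_smul, smul_mul_assoc, one_mul]; rfl
  | gen i =>
    rw [heckeRep_heckeT]
    suffices h : Finsupp.linearCombination ℤ[X] (basisT cs) ∘ₗ opL cs i =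
        LinearMap.mulLeft ℤ[X] (heckeT M i) ∘ₗ Finsupp.linearCombination ℤ[X] (basisT cs) from
      LinearMap.congr_fun h x
    refine Finsupp.lhom_ext' fun w => LinearMap.ext_ring ?_
    simp only [LinearMap.comp_apply, Finsupp.lsingle_apply, LinearMap.mulLeft_apply,
      Finsupp.linearCombination_single, one_smul]
    rcases lt_or_gt_of_ne (cs.length_simple_mul_ne w i) with h | h
    · rw [opL_down cs h, heckeT_mul_basisT_down cs h]
      simp only [map_add, map_smul, Finsupp.linearCombination_single, one_smul]
    · rw [opL_up cs h, heckeT_mul_basisT_up cs h]; simp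
  | add a b ha hb => rw [map_add, LinearMap.add_apply, map_add, ha, hb, add_mul]
  | mul a b ha hb => rw [map_mul, Module.End.mul_apply, ha, hb, mul_assoc]

theorem linearCombination_heckeCoord (h : HeckeAlg M) :
    Finsupp.linearCombination ℤ[X] (basisT cs) (heckeCoord cs h) = h := by
  rw [heckeCoord_apply, linearCombination_heckeRep, Finsupp.linearCombination_single, one_smul,
    basisT_one, mul_one]

theorem heckeCoord_injective : Function.Injective (heckeCoord cs) :=
  Function.LeftInverse.injective (linearCombination_heckeCoord cs)

/-- H_q is free over ℤ[q], so multiplication by q is injective; this is what later permits dividing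
endomorphisms by q. -/
theorem heckeAlg_X_smul_cancel (cs : CoxeterSystem M W) {a b : HeckeAlg M}
    (h : (Polynomial.X : ℤ[X]) • a = (Polynomial.X : ℤ[X]) • b) : a = b := by
  apply heckeCoord_injective cs
  have := congrArg (heckeCoord cs) h
  rw [map_smul, map_smul] at this
  ext1 w
  have := DFunLike.congr_fun this w
  simpa [Polynomial.X_ne_zero] using this

theorem heckeRep_commute_of_opL_commute {Q : Module.End ℤ[X] (W →₀ ℤ[X])}
    (hQ : ∀ i, Commute (opL cs i) Q) (h : HeckeAlg M) : Commute (heckeRep cs h) Q := by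
  induction h using heckeAlg_induction with
  | algMap r => rw [AlgHom.commutes]; exact Algebra.commutes _ _
  | gen i => rw [heckeRep_heckeT]; exact hQ i
  | add a b ha hb => rw [map_add]; exact ha.add_left hb
  | mul a b ha hb => rw [map_mul]; exact ha.mul_left hb

/-- Since `opR` commutes with the regular representation and sends e_1 to e_{s_i}, it computes right
multiplication by T_i. -/
theorem heckeCoord_mul_heckeT (h : HeckeAlg M) (i : B) :
    heckeCoord cs (h * heckeT M i) = opR cs i (heckeCoord cs h) := by
  rw [heckeCoord_mul, ← basisT_simple cs i, heckeCoord_basisT, heckeCoord_apply,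
    ← Module.End.mul_apply,
    ← (heckeRep_commute_of_opL_commute cs (fun j => opL_commute_opR cs j i) h).eq,
    Module.End.mul_apply, opR_up cs (by simp), one_mul]

theorem heckeCoord_heckeT_mul (h : HeckeAlg M) (i : B) :
    heckeCoord cs (heckeT M i * h) = opL cs i (heckeCoord cs h) := by
  rw [heckeCoord_mul, heckeRep_heckeT]

-- When s_i w is longer than w, only the term at s_i w contributes to the coefficient at w: the term
-- at w itself is moved up to s_i w. When s_i w is shorter, both terms contribute.
open Polynomial in
theorem opL_apply_of_lt (i : B) (c : W →₀ ℤ[X]) {w : W}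
    (h : cs.length w < cs.length (cs.simple i * w)) :
    opL cs i c w = X * c (cs.simple i * w) := by
  suffices h : Finsupp.lapply w ∘ₗ opL cs i =
      ((X : ℤ[X]) • Finsupp.lapply (cs.simple i * w) : (W →₀ ℤ[X]) →ₗ[ℤ[X]] ℤ[X]) from
    LinearMap.congr_fun h c
  classical
  refine Finsupp.lhom_ext' fun u => LinearMap.ext_ring ?_
  simp only [LinearMap.comp_apply, Finsupp.lsingle_apply]
  have e1 : cs.simple i * u = w ↔ u = cs.simple i * w := by
    constructor <;> rintro rfl <;> rw [cs.simple_mul_simple_cancel_left]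
  have e2 : cs.simple i * u = w → ¬ u = w := by
    rintro rfl h'; exact cs.length_simple_mul_ne u i (congrArg cs.length h'.symm)
  rcases lt_or_gt_of_ne (cs.length_simple_mul_ne u i) with hu | hu
  · rw [opL_down cs hu]
    simp [Finsupp.single_apply, e1] at e2 ⊢
    grind
  · rw [opL_up cs hu]
    simp [Finsupp.single_apply, e1] at e2 ⊢
    grind

open Polynomial in
theorem opL_apply_of_gt (i : B) (c : W →₀ ℤ[X]) {w : W}
    (h : cs.length (cs.simple i * w) < cs.length w) :
    opL cs i c w = c (cs.simple i * w) + (X - 1) * c w := by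
  suffices h : Finsupp.lapply w ∘ₗ opL cs i =
      (Finsupp.lapply (cs.simple i * w) + (X - 1 : ℤ[X]) • Finsupp.lapply w : (W →₀ ℤ[X]) →ₗ[ℤ[X]] ℤ[X]) from
    LinearMap.congr_fun h c
  classical
  refine Finsupp.lhom_ext' fun u => LinearMap.ext_ring ?_
  simp only [LinearMap.comp_apply, Finsupp.lsingle_apply]
  have e1 : cs.simple i * u = w ↔ u = cs.simple i * w := by
    constructor <;> rintro rfl <;> rw [cs.simple_mul_simple_cancel_left]
  have e2 : cs.simple i * u = w → ¬ u = w := by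
    rintro rfl h'; exact cs.length_simple_mul_ne u i (congrArg cs.length h'.symm)
  rcases lt_or_gt_of_ne (cs.length_simple_mul_ne u i) with hu | hu
  · rw [opL_down cs hu]
    simp [Finsupp.single_apply, e1] at e2 ⊢
    grind
  · rw [opL_up cs hu]
    simp [Finsupp.single_apply, e1] at e2 ⊢
    grind

open Polynomial in
theorem opR_apply_of_lt (i : B) (c : W →₀ ℤ[X]) {w : W}
    (h : cs.length w < cs.length (w * cs.simple i)) :
    opR cs i c w = X * c (w * cs.simple i) := by
  suffices h : Finsupp.lapply w ∘ₗ opR cs i =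
      ((X : ℤ[X]) • Finsupp.lapply (w * cs.simple i) : (W →₀ ℤ[X]) →ₗ[ℤ[X]] ℤ[X]) from
    LinearMap.congr_fun h c
  classical
  refine Finsupp.lhom_ext' fun u => LinearMap.ext_ring ?_
  simp only [LinearMap.comp_apply, Finsupp.lsingle_apply]
  have e1 : u * cs.simple i = w ↔ u = w * cs.simple i := by
    constructor <;> rintro rfl <;> rw [cs.simple_mul_simple_cancel_right]
  have e2 : u * cs.simple i = w → ¬ u = w := by
    rintro rfl h'; exact cs.length_mul_simple_ne u i (congrArg cs.length h'.symm)
  rcases lt_or_gt_of_ne (cs.length_mul_simple_ne u i) with hu | hu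
  · rw [opR_down cs hu]
    simp [Finsupp.single_apply, e1] at e2 ⊢
    grind
  · rw [opR_up cs hu]
    simp [Finsupp.single_apply, e1] at e2 ⊢
    grind

open Polynomial in
theorem opR_apply_of_gt (i : B) (c : W →₀ ℤ[X]) {w : W}
    (h : cs.length (w * cs.simple i) < cs.length w) :
    opR cs i c w = c (w * cs.simple i) + (X - 1) * c w := by
  suffices h : Finsupp.lapply w ∘ₗ opR cs i =
      (Finsupp.lapply (w * cs.simple i) + (X - 1 : ℤ[X]) • Finsupp.lapply w : (W →₀ ℤ[X]) →ₗ[ℤ[X]] ℤ[X]) from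
    LinearMap.congr_fun h c
  classical
  refine Finsupp.lhom_ext' fun u => LinearMap.ext_ring ?_
  simp only [LinearMap.comp_apply, Finsupp.lsingle_apply]
  have e1 : u * cs.simple i = w ↔ u = w * cs.simple i := by
    constructor <;> rintro rfl <;> rw [cs.simple_mul_simple_cancel_right]
  have e2 : u * cs.simple i = w → ¬ u = w := by
    rintro rfl h'; exact cs.length_mul_simple_ne u i (congrArg cs.length h'.symm)
  rcases lt_or_gt_of_ne (cs.length_mul_simple_ne u i) with hu | hu
  · rw [opR_down cs hu]
    simp [Finsupp.single_apply, e1] at e2 ⊢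
    grind
  · rw [opR_up cs hu]
    simp [Finsupp.single_apply, e1] at e2 ⊢
    grind

end HeckeBasis
end

noncomputable section

section Parabolic

variable {B W : Type*} [Group W] {M : CoxeterMatrix B} (cs : CoxeterSystem M W)

/-! ### The elements `x_I` -/

/-- Comparing coefficients at w gives q c(s_i w) = q c(w) or c(s_i w) + (q-1) c(w) = q c(w),
according to which of w and s_i w is longer; both amount to c(s_i w) = c(w). -/
theorem heckeT_mul_eq_iff (i : B) (h : HeckeAlg M) :
    heckeT M i * h = (Polynomial.X : ℤ[X]) • h ↔
      ∀ w, heckeCoord cs h (cs.simple i * w) = heckeCoord cs h w := by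
  have hX : (Polynomial.X : ℤ[X]) ≠ 0 := Polynomial.X_ne_zero
  rw [← (heckeCoord_injective cs).eq_iff, heckeCoord_heckeT_mul, map_smul, DFunLike.ext_iff]
  refine forall_congr' fun w => ?_
  rw [Finsupp.smul_apply, smul_eq_mul]
  rcases lt_or_gt_of_ne (cs.length_simple_mul_ne w i) with hl | hl
  · rw [opL_apply_of_gt cs i _ hl]
    constructor <;> intro h <;> linear_combination h
  · rw [opL_apply_of_lt cs i _ hl, mul_right_inj' hX]

theorem mul_heckeT_eq_iff (i : B) (h : HeckeAlg M) :
    h * heckeT M i = (Polynomial.X : ℤ[X]) • h ↔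
      ∀ w, heckeCoord cs h (w * cs.simple i) = heckeCoord cs h w := by
  have hX : (Polynomial.X : ℤ[X]) ≠ 0 := Polynomial.X_ne_zero
  rw [← (heckeCoord_injective cs).eq_iff, heckeCoord_mul_heckeT, map_smul, DFunLike.ext_iff]
  refine forall_congr' fun w => ?_
  rw [Finsupp.smul_apply, smul_eq_mul]
  rcases lt_or_gt_of_ne (cs.length_mul_simple_ne w i) with hl | hl
  · rw [opR_apply_of_gt cs i _ hl]
    constructor <;> intro h <;> linear_combination h
  · rw [opR_apply_of_lt cs i _ hl, mul_right_inj' hX]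

variable {cs}

open Classical in
theorem heckeCoord_xElt (I : Finitary cs) (w : W) :
    heckeCoord cs (xElt cs I) w = if w ∈ parabolic cs I.1 then 1 else 0 := by
  rw [xElt, map_sum, Finsupp.finsetSum_apply]
  simp only [heckeCoord_basisT, Finsupp.single_apply]
  rw [Finset.sum_ite_eq']
  simp

theorem heckeT_mul_xElt {I : Finitary cs} {i : B} (hi : i ∈ I.1) :
    heckeT M i * xElt cs I = (Polynomial.X : ℤ[X]) • xElt cs I := by
  rw [heckeT_mul_eq_iff cs]
  intro w
  have := Subgroup.mul_mem_cancel_left (parabolic cs I.1) (y := w) (simple_mem_parabolic cs hi)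
  simp only [heckeCoord_xElt]
  split_ifs <;> simp_all

theorem xElt_mul_heckeT {I : Finitary cs} {i : B} (hi : i ∈ I.1) :
    xElt cs I * heckeT M i = (Polynomial.X : ℤ[X]) • xElt cs I := by
  rw [mul_heckeT_eq_iff cs]
  intro w
  have := Subgroup.mul_mem_cancel_right (parabolic cs I.1) (y := w) (simple_mem_parabolic cs hi)
  simp only [heckeCoord_xElt]
  split_ifs <;> simp_all

theorem xElt_mul_basisT {I : Finitary cs} {v : W} (hv : v ∈ parabolic cs I.1) :
    xElt cs I * basisT cs v = (Polynomial.X ^ cs.length v : ℤ[X]) • xElt cs I := by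
  obtain ⟨ω, hI, hω, rfl⟩ := exists_word_of_mem_parabolic cs hv
  rw [basisT_wordProd cs hω, hω.eq]
  clear hω hv
  induction ω with
  | nil => simp
  | cons i ω ih =>
    rw [List.map_cons, List.prod_cons, ← mul_assoc, xElt_mul_heckeT (hI i (by simp)),
      smul_mul_assoc, ih fun j hj => hI j (by simp [hj]), smul_smul, List.length_cons, pow_succ']

/-- The Poincaré polynomial of `W_I`. -/
def poincare (I : Finitary cs) : ℤ[X] := ∑ w ∈ I.2.toFinset, Polynomial.X ^ cs.length w

theorem xElt_mul_self (I : Finitary cs) : xElt cs I * xElt cs I = poincare I • xElt cs I := by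
  conv_lhs => rw [xElt.eq_def (I := I)]
  rw [← xElt.eq_def]
  nth_rw 2 [xElt]
  rw [Finset.mul_sum, poincare, Finset.sum_smul]
  exact Finset.sum_congr rfl fun w hw => xElt_mul_basisT (by simpa using hw)

/-- Only the identity has length 0. Together with `xElt_mul_self` this makes x_I idempotent modulo
q. -/
theorem poincare_coeff_zero (I : Finitary cs) : (poincare I).coeff 0 = 1 := by
  classical
  rw [poincare, Polynomial.finsetSum_coeff, Finset.sum_eq_single 1]
  · simp
  · intro w _ hw
    rw [Polynomial.coeff_X_pow, if_neg]
    exact fun h => hw (cs.length_eq_zero_iff.1 h.symm)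
  · intro h
    exact absurd (by simp : (1 : W) ∈ I.2.toFinset) h

theorem heckeCoord_basisT_mul {I : Finset B} {v : W} (hv : v ∈ parabolic cs I)
    {c : W →₀ ℤ[X]} (hc : ∀ w, c w ≠ 0 → w ∈ minReps cs I) (w : W) :
    heckeCoord cs (basisT cs v * Finsupp.linearCombination ℤ[X] (basisT cs) c) w =
      c (v⁻¹ * w) := by
  classical
  rw [Finsupp.linearCombination_apply, Finsupp.sum, Finset.mul_sum, map_sum,
    Finsupp.finsetSum_apply]
  have : ∀ d ∈ c.support, heckeCoord cs (basisT cs v * c d • basisT cs d) w =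
      if d = v⁻¹ * w then c d else 0 := by
    intro d hd
    rw [mul_smul_comm, map_smul, ← basisT_mul cs (length_mul_of_mem_minReps cs hv
      (hc d (by simpa using hd))), heckeCoord_basisT, Finsupp.smul_apply, Finsupp.single_apply]
    simp only [eq_inv_mul_iff_mul_eq, smul_eq_mul, mul_ite, mul_one, mul_zero]
  rw [Finset.sum_congr rfl this, Finset.sum_ite_eq']
  simp only [Finsupp.mem_support_iff, ne_eq, ite_not, ite_eq_right_iff]
  exact fun h => h.symm

/-- The equations make the coordinates of y constant on each coset W_I d, so y = x_I z, where z
keeps only the terms of y at the minimal representatives d. Hence x_I H_q is cut out by linear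
equations. -/
theorem eq_xElt_mul_of_heckeT_mul_eq {I : Finitary cs} {y : HeckeAlg M}
    (hy : ∀ i ∈ I.1, heckeT M i * y = (Polynomial.X : ℤ[X]) • y) : ∃ z, y = xElt cs I * z := by
  classical
  set c := heckeCoord cs y with hcdef
  have hinv : ∀ v ∈ parabolic cs I.1, ∀ w, c (v * w) = c w := by
    intro v hv
    obtain ⟨ω, hI, -, rfl⟩ := exists_word_of_mem_parabolic cs hv
    clear hv
    induction ω with
    | nil => simp
    | cons i ω ih =>
      intro w
      rw [cs.wordProd_cons, mul_assoc, (heckeT_mul_eq_iff cs i y).1 (hy i (hI i (by simp))),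
        ih fun j hj => hI j (by simp [hj])]
  refine ⟨Finsupp.linearCombination ℤ[X] (basisT cs) (c.filter (· ∈ minReps cs I.1)), ?_⟩
  apply heckeCoord_injective cs
  ext1 w
  obtain ⟨v, hv, d, hd, rfl⟩ := exists_mul_minReps cs I.1 w
  rw [xElt, Finset.sum_mul, map_sum, Finsupp.finsetSum_apply, Finset.sum_eq_single v]
  · rw [heckeCoord_basisT_mul hv, inv_mul_cancel_left, Finsupp.filter_apply_pos _ _ hd, ← hcdef,
      hinv v hv]
    intro w hw
    by_contra h
    exact hw (Finsupp.filter_apply_neg _ _ h)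
  · intro u hu huv
    have hu : u ∈ parabolic cs I.1 := by simpa using hu
    rw [heckeCoord_basisT_mul hu, Finsupp.filter_apply_neg]
    · intro hmem
      refine huv (eq_of_mul_minReps cs hv hu hd hmem ?_).1.symm
      rw [mul_inv_cancel_left]
    · intro w hw
      by_contra h
      exact hw (Finsupp.filter_apply_neg _ _ h)
  · intro h
    exact absurd (by simpa using hv) h

theorem xElt_eq_xElt_mul {I J : Finitary cs} (h : I.1 ⊆ J.1) : ∃ z, xElt cs J = xElt cs I * z :=
  eq_xElt_mul_of_heckeT_mul_eq fun _ hi => heckeT_mul_xElt (h hi)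

/-- Each element of W_J is uniquely a v with v in W_I and a shortest in a W_I, and lengths add, so
T_a T_v = T_{av}. The decomposition is applied to inverses because `minReps` concerns cosets W_I d.
-/
theorem hElt_mul_xElt {I J : Finitary cs} (h : I.1 ⊆ J.1) :
    hElt cs J I * xElt cs I = xElt cs J := by
  classical
  rw [hElt, xElt, xElt, Finset.sum_mul_sum, ← Finset.sum_product']
  refine Finset.sum_bij (fun p _ => p.1 * p.2) ?_ ?_ ?_ ?_
  · rintro ⟨a, v⟩ hp
    simp only [Finset.mem_product, Finset.mem_filter, Set.Finite.mem_toFinset, SetLike.mem_coe]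
      at hp ⊢
    exact mul_mem hp.1.1 (parabolic_mono cs h hp.2)
  · rintro ⟨a, v⟩ hp ⟨a', v'⟩ hp' he
    simp only [Finset.mem_product, Finset.mem_filter, Set.Finite.mem_toFinset, SetLike.mem_coe]
      at hp hp' he
    have := eq_of_mul_minReps cs (inv_mem hp.2) (inv_mem hp'.2) hp.1.2 hp'.1.2
      (by rw [← mul_inv_rev, he, mul_inv_rev])
    exact Prod.ext (inv_injective this.2) (inv_injective this.1)
  · intro w hw
    simp only [Set.Finite.mem_toFinset, SetLike.mem_coe] at hw
    obtain ⟨v, hv, d, hd, he⟩ := exists_mul_minReps cs I.1 w⁻¹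
    have hw' : w = d⁻¹ * v⁻¹ := by rw [← mul_inv_rev, ← he, inv_inv]
    refine ⟨(d⁻¹, v⁻¹), ?_, hw'.symm⟩
    simp only [Finset.mem_product, Finset.mem_filter, Set.Finite.mem_toFinset, SetLike.mem_coe,
      inv_inv]
    refine ⟨⟨?_, hd⟩, inv_mem hv⟩
    have : d⁻¹ = w * v := by rw [hw', inv_mul_cancel_right]
    rw [this]
    exact mul_mem hw (parabolic_mono cs h hv)
  · rintro ⟨a, v⟩ hp
    simp only [Finset.mem_product, Finset.mem_filter, Set.Finite.mem_toFinset, SetLike.mem_coe]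
      at hp
    refine (basisT_mul cs ?_).symm
    have := length_mul_of_mem_minReps cs (inv_mem hp.2) hp.1.2
    rw [← mul_inv_rev, cs.length_inv, cs.length_inv, cs.length_inv] at this
    rw [this, add_comm]

end Parabolic

/-! ### Alternating products of idempotents -/

section Idempotents

variable {B R : Type*} [Ring R] {f : B → R}

/-- Expand the first factor f_i - 1: after it the product starts with f_j - 1, which f_j annihilates
from the left, so only the term with f_i survives and the recursion continues. -/
theorem mul_map_altHead_sub_one_prod (hf : ∀ i, f i * f i = f i) (i j : B) (k : ℕ) :
    f j * ((altHead i j (k + 1)).map fun a => f a - 1).prod =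
      ((altHead j i (k + 2)).map f).prod - ((altHead j i (k + 1)).map f).prod := by
  induction k generalizing i j with
  | zero => simp [altHead, mul_sub]
  | succ k ih =>
    have h1 := ih j i
    have h2 : f j * ((altHead j i (k + 1)).map fun a => f a - 1).prod = 0 := by
      rw [altHead, List.map_cons, List.prod_cons, ← mul_assoc, mul_sub, hf, mul_one, sub_self,
        zero_mul]
    rw [altHead, List.map_cons, List.prod_cons, sub_mul, one_mul, h1, mul_sub, h2, sub_zero,
      mul_sub]
    rfl

/-- The difference of the two alternating products is symmetric in i and j. Therefore one family of
products satisfies the braid relation exactly when the other does. -/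
theorem map_altHead_sub_one_prod_sub (hf : ∀ i, f i * f i = f i) (i j : B) (k : ℕ) :
    ((altHead i j k).map fun a => f a - 1).prod - ((altHead i j k).map f).prod =
      ((altHead j i k).map fun a => f a - 1).prod - ((altHead j i k).map f).prod := by
  induction k with
  | zero => simp [altHead]
  | succ k ih =>
    cases k with
    | zero => simp [altHead]
    | succ k =>
      have e (i j : B) : ((altHead i j (k + 2)).map fun a => f a - 1).prod =
          ((altHead i j (k + 2)).map f).prod - ((altHead i j (k + 1)).map f).prod -
            ((altHead j i (k + 1)).map fun a => f a - 1).prod := by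
        rw [← mul_map_altHead_sub_one_prod hf j i k]
        conv_lhs => rw [altHead, List.map_cons, List.prod_cons, sub_mul, one_mul]
      rw [e i j, e j i]
      rw [sub_eq_iff_eq_add] at ih
      rw [ih]
      abel

/-- Idempotents `f i`, `f j` satisfy a braid relation iff the `f i - 1`, `f j - 1` do. -/
theorem braid_sub_one_iff (hf : ∀ i, f i * f i = f i) (i j : B) (k : ℕ) :
    ((CoxeterSystem.alternatingWord i j k).map fun a => f a - 1).prod =
        ((CoxeterSystem.alternatingWord j i k).map fun a => f a - 1).prod ↔
      ((CoxeterSystem.alternatingWord i j k).map f).prod =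
        ((CoxeterSystem.alternatingWord j i k).map f).prod := by
  rw [← map_altHead_prod_eq_iff, ← map_altHead_prod_eq_iff]
  have h := map_altHead_sub_one_prod_sub hf i j k
  constructor
  · intro h'
    rw [h'] at h
    exact sub_right_injective h
  · intro h'
    rw [h'] at h
    exact sub_left_injective h

end Idempotents

/-! ### The `0`-Hecke algebra -/

section ZeroHecke

variable {B : Type*} (M : CoxeterMatrix B)

/-- The ring structure of the Hecke algebra, extending its semiring structure. -/
abbrev heckeRing : Ring (HeckeAlg M) := Algebra.semiringToRing ℤ[X]

attribute [local instance] heckeRing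

/-- The ideal of the Hecke algebra generated by `q`. -/
def qIdeal : Ideal (HeckeAlg M) := Ideal.span {algebraMap ℤ[X] _ Polynomial.X}

variable {M} in
theorem mem_qIdeal {a : HeckeAlg M} : a ∈ qIdeal M ↔ ∃ b, a = (Polynomial.X : ℤ[X]) • b := by
  rw [qIdeal, Ideal.mem_span_singleton']
  refine exists_congr fun b => ?_
  rw [Algebra.smul_def, Algebra.commutes, eq_comm]

instance : (qIdeal M).IsTwoSided :=
  ⟨fun b ha => by
    rw [mem_qIdeal] at ha ⊢
    obtain ⟨c, rfl⟩ := ha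
    exact ⟨c * b, smul_mul_assoc _ _ _⟩⟩

/-- The `0`-Hecke algebra. -/
abbrev H0 : Type _ := HeckeAlg M ⧸ qIdeal M

/-- Reduction modulo `q`. -/
def toH0 : HeckeAlg M →+* H0 M := Ideal.Quotient.mk (qIdeal M)

variable {M}

theorem toH0_surjective : Function.Surjective (toH0 M) := Ideal.Quotient.mk_surjective

theorem toH0_eq_zero_iff {a : HeckeAlg M} :
    toH0 M a = 0 ↔ ∃ b, a = (Polynomial.X : ℤ[X]) • b := by
  rw [← mem_qIdeal]
  exact Ideal.Quotient.eq_zero_iff_mem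

theorem toH0_X_smul (a : HeckeAlg M) : toH0 M ((Polynomial.X : ℤ[X]) • a) = 0 :=
  toH0_eq_zero_iff.2 ⟨a, rfl⟩

theorem toH0_smul (r : ℤ[X]) (a : HeckeAlg M) : toH0 M (r • a) = r.coeff 0 • toH0 M a := by
  conv_lhs => rw [← Polynomial.X_mul_divX_add r, add_smul, mul_smul, map_add, toH0_X_smul,
    zero_add, Algebra.smul_def, eq_intCast Polynomial.C, map_intCast, ← zsmul_eq_mul, map_zsmul]

/-- The idempotent `π_i = T_i + 1` of the `0`-Hecke algebra. -/
def piGen (i : B) : H0 M := toH0 M (heckeT M i) + 1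

theorem toH0_heckeT_mul_self (i : B) :
    toH0 M (heckeT M i) * toH0 M (heckeT M i) = - toH0 M (heckeT M i) := by
  rw [← map_mul, heckeT_mul_self, map_add, toH0_X_smul, sub_smul, map_sub, toH0_X_smul, one_smul]
  simp

theorem piGen_mul_self (i : B) : (piGen i : H0 M) * piGen i = piGen i := by
  have := toH0_heckeT_mul_self (M := M) i
  simp only [piGen, mul_add, add_mul, this, mul_one, one_mul]
  abel

theorem piGen_braid (i j : B) (hij : i ≠ j) :
    ((CoxeterSystem.alternatingWord i j (M i j)).map (piGen (M := M))).prod =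
      ((CoxeterSystem.alternatingWord j i (M i j)).map (piGen (M := M))).prod := by
  rw [← braid_sub_one_iff piGen_mul_self]
  have : (fun a => (piGen a : H0 M) - 1) = toH0 M ∘ heckeT M := by
    funext a; simp [piGen]
  rw [this, ← List.map_map, ← List.map_map, ← map_list_prod, ← map_list_prod,
    heckeT_braid M i j hij]

variable {W : Type*} [Group W] {cs : CoxeterSystem M W}

/-- Let h be the product of the π_i. By Matsumoto's theorem h can be written with any π_i, i in I,
as last factor, so h T_i = 0 and h x_I = h. On the other side T_i x_I = q x_I gives π_i x_I = x_I
modulo q, so h x_I = x_I. -/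
theorem toH0_xElt_eq_prod {I : Finitary cs} {ω : List B} (hω : cs.IsReduced ω)
    (hl : IsLongest cs I.1 (cs.wordProd ω)) :
    toH0 M (xElt cs I) = (ω.map (piGen (M := M))).prod := by
  classical
  have hind {ω' : List B} (hω' : cs.IsReduced ω') (h : cs.wordProd ω = cs.wordProd ω') :=
    matsumoto cs (piGen (M := M)) piGen_braid hω hω' h
  set h := (ω.map (piGen (M := M))).prod
  have h1 (i : B) (hi : i ∈ I.1) : h * toH0 M (heckeT M i) = 0 := by
    obtain ⟨υ, hυ, hυw⟩ := cs.exists_isReduced (cs.wordProd ω * cs.simple i)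
    have hp : cs.wordProd ω = cs.wordProd (υ ++ [i]) := by
      rw [cs.wordProd_append, ← hυw]; simp
    have hlt := hl.length_mul_simple_lt hi
    have := cs.length_mul_simple (cs.wordProd ω) i
    have hl1 : cs.length (cs.wordProd υ) = υ.length := hυ
    have hr : cs.IsReduced (υ ++ [i]) := by
      unfold CoxeterSystem.IsReduced
      rw [← hp, List.length_append, List.length_singleton]
      rw [← hυw] at hl1
      omega
    rw [hind hr hp, List.map_append, List.prod_append, mul_assoc]
    have : (piGen i : H0 M) * toH0 M (heckeT M i) = 0 := by
      rw [piGen, add_mul, toH0_heckeT_mul_self, one_mul, neg_add_cancel]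
    simp [this]
  have h2 : h * toH0 M (xElt cs I) = h := by
    rw [xElt, map_sum, Finset.mul_sum, Finset.sum_eq_single 1]
    · rw [basisT_one, map_one, mul_one]
    · intro w hw hw1
      obtain ⟨υ, hI, hυ, rfl⟩ := exists_word_of_mem_parabolic cs (I := I.1) (w := w)
        (by simpa using hw)
      rw [basisT_wordProd cs hυ]
      cases υ with
      | nil => simp at hw1
      | cons i υ =>
        rw [List.map_cons, List.prod_cons, map_mul, ← mul_assoc, h1 i (hI i (by simp)), zero_mul]
    · intro h
      exact absurd (by simp) h
  -- The letters of the given word are not assumed to lie in I, so it is first replaced by a reduced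
  -- word whose letters do.
  have h3 : h * toH0 M (xElt cs I) = toH0 M (xElt cs I) := by
    obtain ⟨υ, hI, hυ, hυw⟩ := exists_word_of_mem_parabolic cs hl.1
    rw [hind hυ hυw.symm]
    clear hυ hυw
    induction υ with
    | nil => simp
    | cons i υ ih =>
      rw [List.map_cons, List.prod_cons, mul_assoc, ih fun j hj => hI j (by simp [hj]), piGen,
        add_mul, ← map_mul, heckeT_mul_xElt (hI i (by simp)), toH0_X_smul, zero_add, one_mul]
  rw [← h3, h2]

end ZeroHecke
end

/-! ### The endomorphism algebra modulo q as matrices over the 0-Hecke algebra. -/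

noncomputable section

section EndoAlgebra

attribute [local instance] heckeRing

variable {B W : Type*} [Group W] {M : CoxeterMatrix B} {cs : CoxeterSystem M W}

/-! ### Entries of endomorphisms -/

theorem mem_rightIdeal {I : Finitary cs} {y : HeckeAlg M} :
    y ∈ rightIdeal cs I ↔ ∃ z, y = xElt cs I * z := by
  rw [rightIdeal, Submodule.mem_span_singleton]
  constructor
  · rintro ⟨a, rfl⟩
    exact ⟨a.unop, rfl⟩
  · rintro ⟨z, rfl⟩
    exact ⟨MulOpposite.op z, rfl⟩

theorem mem_rightIdeal_iff_heckeT_mul {I : Finitary cs} {y : HeckeAlg M} :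
    y ∈ rightIdeal cs I ↔ ∀ i ∈ I.1, heckeT M i * y = (Polynomial.X : ℤ[X]) • y := by
  rw [mem_rightIdeal]
  constructor
  · rintro ⟨z, rfl⟩ i hi
    rw [← mul_assoc, heckeT_mul_xElt hi, smul_mul_assoc]
  · exact eq_xElt_mul_of_heckeT_mul_eq

theorem xElt_mem_rightIdeal (I : Finitary cs) : xElt cs I ∈ rightIdeal cs I :=
  mem_rightIdeal.2 ⟨1, (mul_one _).symm⟩

theorem xElt_mul_of_mem {I : Finitary cs} {y : HeckeAlg M} (hy : y ∈ rightIdeal cs I) :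
    xElt cs I * y = poincare I • y := by
  obtain ⟨z, rfl⟩ := mem_rightIdeal.1 hy
  rw [← mul_assoc, xElt_mul_self, smul_mul_assoc]

/-- The generator `x_I` of the summand `x_I H_q`. -/
def xGen (I : Finitary cs) : rightIdeal cs I := ⟨xElt cs I, xElt_mem_rightIdeal I⟩

open Classical in
/-- The inclusion of the summand `x_I H_q`. -/
def incl (I : Finitary cs) : rightIdeal cs I →ₗ[(HeckeAlg M)ᵐᵒᵖ] PermModule cs :=
  DirectSum.lof (HeckeAlg M)ᵐᵒᵖ (Finitary cs) (fun I => rightIdeal cs I) I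

theorem incl_apply_self (I : Finitary cs) (y : rightIdeal cs I) : incl I y I = y := by
  classical
  exact DirectSum.of_eq_same (β := fun I => rightIdeal cs I) I y

theorem incl_apply_of_ne {I J : Finitary cs} (h : J ≠ I) (y : rightIdeal cs I) :
    incl I y J = 0 := by
  classical
  exact DirectSum.of_eq_of_ne (β := fun I => rightIdeal cs I) I J y h

/-- The `(J, I)`-entry `f(x_I)_J` of an endomorphism `f`. -/
def entry (f : Endq cs) (J I : Finitary cs) : HeckeAlg M := (f (incl I (xGen I)) J : rightIdeal cs J)

theorem entry_mem (f : Endq cs) (J I : Finitary cs) : entry f J I ∈ rightIdeal cs J :=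
  (f (incl I (xGen I)) J).2

theorem apply_incl {I : Finitary cs} (f : Endq cs) (y : rightIdeal cs I) {k : HeckeAlg M}
    (hy : (y : HeckeAlg M) = xElt cs I * k) (J : Finitary cs) :
    ((f (incl I y) J : rightIdeal cs J) : HeckeAlg M) = entry f J I * k := by
  have h : y = MulOpposite.op k • xGen I := Subtype.ext hy
  rw [h, map_smul, map_smul]
  rfl

theorem xElt_mul_entry (f : Endq cs) (J I : Finitary cs) :
    xElt cs J * entry f J I = poincare J • entry f J I :=
  xElt_mul_of_mem (entry_mem f J I)

/-- Right linearity: f(x_I) x_I = f(x_I x_I) = f(P_I(q) x_I), taken in the J-component. -/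
theorem entry_mul_xElt (f : Endq cs) (J I : Finitary cs) :
    entry f J I * xElt cs I = poincare I • entry f J I := by
  have h : xElt cs I * xElt cs I ∈ rightIdeal cs I := mem_rightIdeal.2 ⟨_, rfl⟩
  have h1 := apply_incl f ⟨_, h⟩ rfl J
  have h2 := apply_incl f ⟨_, h⟩ (k := algebraMap ℤ[X] (HeckeAlg M) (poincare I))
    (by rw [← Algebra.commutes, ← Algebra.smul_def]; exact xElt_mul_self I) J
  rw [← h1, h2, ← Algebra.commutes, ← Algebra.smul_def]

theorem sum_incl [Finite B] (y : PermModule cs) : ∑ I : Finitary cs, incl I (y I) = y := by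
  classical
  exact (Finset.sum_congr rfl fun I _ => rfl).trans
    (DirectSum.sum_univ_of y)

theorem apply_eq_sum [Finite B] (f : Endq cs) (y : PermModule cs) (J : Finitary cs) :
    ((f y J : rightIdeal cs J) : HeckeAlg M) =
      ∑ I : Finitary cs, ((f (incl I (y I)) J : rightIdeal cs J) : HeckeAlg M) := by
  conv_lhs => rw [← sum_incl y, map_sum]
  rw [DirectSum.sum_apply, Submodule.coe_sum]

theorem entry_one_self (I : Finitary cs) : entry (1 : Endq cs) I I = xElt cs I := by
  rw [entry, Module.End.one_apply, incl_apply_self]; rfl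

theorem entry_one_of_ne {I J : Finitary cs} (h : J ≠ I) : entry (1 : Endq cs) J I = 0 := by
  rw [entry, Module.End.one_apply, incl_apply_of_ne h]; rfl

theorem entry_smul (r : ℤ[X]) (f : Endq cs) (J I : Finitary cs) :
    entry (r • f) J I = r • entry f J I := rfl

/-! ### Endomorphisms modulo `q` -/

/-- If g(x_I)_J = x_J k, then f contributes f(x_J)_K k. The product of the two entries is f(x_J)_K
x_J k = P_J(q) f(x_J)_K k, and P_J(0) = 1. -/
theorem toH0_entry_mul [Finite B] (f g : Endq cs) (K I : Finitary cs) :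
    toH0 M (entry (f * g) K I) =
      ∑ J : Finitary cs, toH0 M (entry f K J) * toH0 M (entry g J I) := by
  have h : entry (f * g) K I =
      ((f (g (incl I (xGen I))) K : rightIdeal cs K) : HeckeAlg M) := rfl
  rw [h, apply_eq_sum, map_sum]
  refine Finset.sum_congr rfl fun J _ => ?_
  obtain ⟨k, hk⟩ := mem_rightIdeal.1 (entry_mem g J I)
  rw [apply_incl f _ hk, ← map_mul, hk, ← mul_assoc, entry_mul_xElt, smul_mul_assoc, toH0_smul,
    poincare_coeff_zero, one_smul]

variable (cs) in
/-- The matrix of entries of an endomorphism modulo `q`. -/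
def matH0 : Endq cs →+ Matrix (Finitary cs) (Finitary cs) (H0 M) where
  toFun f := Matrix.of fun J I => toH0 M (entry f J I)
  map_zero' := by ext J I; exact map_zero (toH0 M)
  map_add' f g := by ext J I; exact map_add (toH0 M) (entry f J I) (entry g J I)

theorem matH0_apply (f : Endq cs) (J I : Finitary cs) :
    matH0 cs f J I = toH0 M (entry f J I) := rfl

theorem matH0_mul [Finite B] (f g : Endq cs) : matH0 cs (f * g) = matH0 cs f * matH0 cs g := by
  ext K I
  rw [matH0_apply, toH0_entry_mul, Matrix.mul_apply]
  rfl

theorem matH0_smul (r : ℤ[X]) (f : Endq cs) : matH0 cs (r • f) = r.coeff 0 • matH0 cs f := by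
  ext J I
  rw [matH0_apply, entry_smul, toH0_smul]
  rfl

theorem permModule_X_smul_cancel {y z : PermModule cs}
    (h : (Polynomial.X : ℤ[X]) • y = (Polynomial.X : ℤ[X]) • z) : y = z := by
  refine DFinsupp.ext fun J => Subtype.ext (heckeAlg_X_smul_cancel cs ?_)
  exact congrArg (fun u : PermModule cs => ((u J : rightIdeal cs J) : HeckeAlg M)) h

/-- All values of f are divisible by q in H_q. The quotients stay in x_J H_q because its defining
equations survive cancelling q, and the quotient map is linear for the same reason. -/
theorem exists_eq_X_smul_of_matH0_eq_zero [Finite B] {f : Endq cs} (hf : matH0 cs f = 0) :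
    ∃ g : Endq cs, f = (Polynomial.X : ℤ[X]) • g := by
  classical
  have h1 (J I : Finitary cs) : ∃ b, entry f J I = (Polynomial.X : ℤ[X]) • b :=
    toH0_eq_zero_iff.1 (congrFun (congrFun hf J) I)
  choose b hb using h1
  have h2 (y : PermModule cs) (J : Finitary cs) :
      ∃ z : rightIdeal cs J, f y J = (Polynomial.X : ℤ[X]) • z := by
    choose k hk using fun I : Finitary cs => mem_rightIdeal.1 (y I).2
    have he : ((f y J : rightIdeal cs J) : HeckeAlg M) =
        (Polynomial.X : ℤ[X]) • ∑ I : Finitary cs, b J I * k I := by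
      rw [apply_eq_sum, Finset.smul_sum]
      refine Finset.sum_congr rfl fun I _ => ?_
      rw [apply_incl f _ (hk I), hb, smul_mul_assoc]
    refine ⟨⟨∑ I : Finitary cs, b J I * k I, ?_⟩, Subtype.ext he⟩
    rw [mem_rightIdeal_iff_heckeT_mul]
    intro i hi
    apply heckeAlg_X_smul_cancel cs
    have := mem_rightIdeal_iff_heckeT_mul.1 (f y J).2 i hi
    rw [he, mul_smul_comm] at this
    exact this
  choose z hz using h2
  have h3 (y : PermModule cs) : ∃ u : PermModule cs, f y = (Polynomial.X : ℤ[X]) • u := by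
    refine ⟨∑ J : Finitary cs, incl J (z y J), ?_⟩
    refine DFinsupp.ext fun J => ?_
    refine (hz y J).trans ?_
    have : (∑ J : Finitary cs, incl J (z y J)) J = z y J := by
      rw [DirectSum.sum_apply, Finset.sum_eq_single J]
      · exact incl_apply_self _ _
      · intro K _ hK; exact incl_apply_of_ne hK.symm _
      · simp
    rw [← this]
    rfl
  choose u hu using h3
  refine ⟨{ toFun := u, map_add' := fun y y' => ?_, map_smul' := fun a y => ?_ }, ?_⟩
  · apply permModule_X_smul_cancel
    rw [smul_add, ← hu, ← hu, ← hu, map_add]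
  · apply permModule_X_smul_cancel
    rw [← hu, map_smul, hu, RingHom.id_apply, smul_comm]
  · exact LinearMap.ext hu

/-! ### Left multiplications -/

/-- The endomorphism that maps `x_I H_q` to `x_J H_q` by left multiplication by `a`. -/
def leftMul (a : HeckeAlg M) (I J : Finitary cs) (h : a * xElt cs I ∈ rightIdeal cs J) : Endq cs :=
  incl J ∘ₗ (LinearMap.mulLeft (HeckeAlg M)ᵐᵒᵖ a).restrict (p := rightIdeal cs I)
    (q := rightIdeal cs J) (fun y hy => by
      obtain ⟨z, rfl⟩ := mem_rightIdeal.1 hy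
      rw [LinearMap.mulLeft_apply, ← mul_assoc]
      exact (rightIdeal cs J).smul_mem (MulOpposite.op z) h) ∘ₗ
    DirectSum.component (HeckeAlg M)ᵐᵒᵖ (Finitary cs) (fun I => rightIdeal cs I) I

theorem leftMul_isLeftMul (a : HeckeAlg M) (I J : Finitary cs)
    (h : a * xElt cs I ∈ rightIdeal cs J) : IsLeftMul cs a I J (leftMul a I J h) := by
  intro y
  constructor
  · exact congrArg Subtype.val (incl_apply_self J _)
  · intro K hK
    exact incl_apply_of_ne hK _

open Classical in
theorem IsLeftMul.matH0 {a : HeckeAlg M} {I J : Finitary cs} {f : Endq cs}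
    (hf : IsLeftMul cs a I J f) :
    matH0 cs f = Matrix.single J I (toH0 M (a * xElt cs I)) := by
  ext J' I'
  rw [matH0_apply, entry, Matrix.single_apply]
  by_cases hJ : J' = J
  · subst hJ
    rw [(hf _).1]
    by_cases hI : I' = I
    · subst hI
      rw [incl_apply_self, if_pos ⟨rfl, rfl⟩]
      rfl
    · rw [incl_apply_of_ne (Ne.symm hI), if_neg fun h => hI h.2.symm]
      simp
  · rw [(hf _).2 _ hJ, if_neg fun h => hJ h.1.symm]
    exact map_zero (toH0 M)

/-! ### The specialised endomorphism algebra -/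

variable (cs) in
/-- The embedding of `E_0` into matrices over the `0`-Hecke algebra. -/
def e0Mat : E0 cs →+ Matrix (Finitary cs) (Finitary cs) (H0 M) :=
  TensorProduct.liftAddHom
    ((smulAddHom ℤ (Matrix (Finitary cs) (Finitary cs) (H0 M))).compl₂ (matH0 cs))
    (fun r (z : ℤ) f => by
      change (r.coeff 0 * z) • matH0 cs f = z • matH0 cs (r • f)
      rw [matH0_smul, smul_smul, mul_comm])

theorem e0Mat_one_tmul (f : Endq cs) : e0Mat cs (1 ⊗ₜ[ℤ[X]] f) = matH0 cs f :=
  one_smul ℤ (matH0 cs f)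

theorem exists_eq_one_tmul (t : E0 cs) : ∃ f : Endq cs, t = 1 ⊗ₜ[ℤ[X]] f := by
  induction t using TensorProduct.induction_on with
  | zero => exact ⟨0, (TensorProduct.tmul_zero _ _).symm⟩
  | tmul z f =>
    refine ⟨(Polynomial.C (z : ℤ) : ℤ[X]) • f, ?_⟩
    rw [← TensorProduct.smul_tmul]
    congr 1
    rw [Algebra.smul_def, mul_one]
    exact (Polynomial.coeff_C_zero (a := (z : ℤ))).symm
  | add x y hx hy =>
    obtain ⟨f, rfl⟩ := hx
    obtain ⟨g, rfl⟩ := hy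
    exact ⟨f + g, (TensorProduct.tmul_add _ _ _).symm⟩

/-- Every element of E_0 has the form 1 ⊗ f. If its matrix vanishes then f is divisible by q, and q
acts as 0 on the left tensor factor. -/
theorem e0Mat_injective [Finite B] : Function.Injective (e0Mat cs) := by
  rw [injective_iff_map_eq_zero]
  intro t ht
  obtain ⟨f, rfl⟩ := exists_eq_one_tmul t
  rw [e0Mat_one_tmul] at ht
  obtain ⟨g, rfl⟩ := exists_eq_X_smul_of_matH0_eq_zero ht
  have : (Polynomial.X : ℤ[X]) • (1 : SpecZ) = 0 := by
    rw [Algebra.smul_def, mul_one]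
    exact Polynomial.coeff_X_zero
  rw [← TensorProduct.smul_tmul, this, TensorProduct.zero_tmul]

theorem e0Mat_mul [Finite B] (s t : E0 cs) : e0Mat cs (s * t) = e0Mat cs s * e0Mat cs t := by
  obtain ⟨f, rfl⟩ := exists_eq_one_tmul s
  obtain ⟨g, rfl⟩ := exists_eq_one_tmul t
  rw [Algebra.TensorProduct.tmul_mul_tmul, mul_one, e0Mat_one_tmul, e0Mat_one_tmul,
    e0Mat_one_tmul, matH0_mul]

-- The unit goes to the diagonal of the idempotents x_I, not to the identity matrix; this is why
-- `e0Mat` is only additive, with multiplicativity proved separately.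
open Classical in
theorem e0Mat_one : e0Mat cs 1 = Matrix.diagonal fun I => toH0 M (xElt cs I) := by
  rw [Algebra.TensorProduct.one_def, e0Mat_one_tmul]
  ext J I
  rw [matH0_apply]
  by_cases h : J = I
  · subst h
    rw [entry_one_self, Matrix.diagonal_apply_eq]
  · rw [entry_one_of_ne h, Matrix.diagonal_apply_ne _ h, map_zero]

theorem toH0_xElt_mul_e0Mat (t : E0 cs) (J I : Finitary cs) :
    toH0 M (xElt cs J) * e0Mat cs t J I = e0Mat cs t J I := by
  obtain ⟨f, rfl⟩ := exists_eq_one_tmul t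
  rw [e0Mat_one_tmul, matH0_apply, ← map_mul, xElt_mul_entry, toH0_smul, poincare_coeff_zero,
    one_smul]

theorem e0Mat_mul_toH0_xElt (t : E0 cs) (J I : Finitary cs) :
    e0Mat cs t J I * toH0 M (xElt cs I) = e0Mat cs t J I := by
  obtain ⟨f, rfl⟩ := exists_eq_one_tmul t
  rw [e0Mat_one_tmul, matH0_apply, ← map_mul, entry_mul_xElt, toH0_smul, poincare_coeff_zero,
    one_smul]

/-- x_J lies in x_I H_q, and x_I is idempotent modulo q. -/
theorem toH0_xElt_mul_xElt {I J : Finitary cs} (h : I.1 ⊆ J.1) :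
    toH0 M (xElt cs I) * toH0 M (xElt cs J) = toH0 M (xElt cs J) := by
  obtain ⟨z, hz⟩ := xElt_eq_xElt_mul h
  rw [hz, ← map_mul, ← mul_assoc, xElt_mul_self, smul_mul_assoc, toH0_smul, poincare_coeff_zero,
    one_smul]

theorem toH0_xElt_mul_xElt' {I J : Finitary cs} (h : I.1 ⊆ J.1) :
    toH0 M (xElt cs J) * toH0 M (xElt cs I) = toH0 M (xElt cs J) := by
  have : toH0 M (xElt cs I) * toH0 M (xElt cs I) = toH0 M (xElt cs I) :=
    toH0_xElt_mul_xElt subset_rfl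
  rw [← hElt_mul_xElt h, map_mul, mul_assoc, this]

/-! ### The generators of `E_0` -/

/-- The inclusion `x_J H_q ⊆ x_I H_q`. -/
def uMap {I J : Finitary cs} (h : Covers I J) : Endq cs :=
  leftMul 1 J I (by
    rw [one_mul, mem_rightIdeal]
    exact xElt_eq_xElt_mul h.1.1)

/-- Left multiplication by `h_{J,I}` from `x_I H_q` to `x_J H_q`. -/
def dMap {I J : Finitary cs} (h : Covers I J) : Endq cs :=
  leftMul (hElt cs J I) I J (by
    rw [hElt_mul_xElt h.1.1]
    exact xElt_mem_rightIdeal J)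

/-- The projection to the summand `x_K H_q`. -/
def oneMap (K : Finitary cs) : Endq cs :=
  leftMul 1 K K (by
    rw [one_mul]
    exact xElt_mem_rightIdeal K)

theorem uMap_isLeftMul {I J : Finitary cs} (h : Covers I J) : IsLeftMul cs 1 J I (uMap h) :=
  leftMul_isLeftMul _ _ _ _

open Classical in
theorem e0Mat_uMap {I J : Finitary cs} (h : Covers I J) :
    e0Mat cs (1 ⊗ₜ[ℤ[X]] uMap h) = Matrix.single I J (toH0 M (xElt cs J)) := by
  rw [e0Mat_one_tmul, (uMap_isLeftMul h).matH0, one_mul]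

theorem dMap_isLeftMul {I J : Finitary cs} (h : Covers I J) :
    IsLeftMul cs (hElt cs J I) I J (dMap h) :=
  leftMul_isLeftMul _ _ _ _

-- Because h_{J,I} x_I = x_J, the matrix of d_{J,I} has the same entry x_J as that of u_{I,J}, at
-- the transposed place.
open Classical in
theorem e0Mat_dMap {I J : Finitary cs} (h : Covers I J) :
    e0Mat cs (1 ⊗ₜ[ℤ[X]] dMap h) = Matrix.single J I (toH0 M (xElt cs J)) := by
  rw [e0Mat_one_tmul, (dMap_isLeftMul h).matH0, hElt_mul_xElt h.1.1]

theorem oneMap_isLeftMul (K : Finitary cs) : IsLeftMul cs 1 K K (oneMap K) :=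
  leftMul_isLeftMul _ _ _ _

open Classical in
theorem e0Mat_oneMap (K : Finitary cs) :
    e0Mat cs (1 ⊗ₜ[ℤ[X]] oneMap K) = Matrix.single K K (toH0 M (xElt cs K)) := by
  rw [e0Mat_one_tmul, (oneMap_isLeftMul K).matH0, one_mul]

end EndoAlgebra
end

/-! ### The universal property of the 0-Hecke algebra and the structure of the presented algebra. -/

noncomputable section

section UniversalProperty

attribute [local instance] heckeRing

variable {B : Type*} {M : CoxeterMatrix B}

/-- The `0`-Hecke algebra is the universal ring generated by idempotents satisfying the braid
relations. -/
theorem exists_h0Hom {R : Type*} [Ring R] (p : B → R) (hp : ∀ i, p i * p i = p i)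
    (hb : ∀ i j, i ≠ j → ((CoxeterSystem.alternatingWord i j (M i j)).map p).prod =
      ((CoxeterSystem.alternatingWord j i (M i j)).map p).prod) :
    ∃ θ : H0 M →+* R, ∀ i, θ (piGen i) = p i := by
  -- Let q act on R as 0; then T_i ↦ p_i - 1 satisfies the quadratic relation and, by
  -- `braid_sub_one_iff`, the braid relations.
  let : Algebra ℤ[X] R :=
    ((Int.castRingHom R).comp (Polynomial.constantCoeff (R := ℤ))).toAlgebra' fun c x =>
      Int.cast_commute _ _
  have hX : algebraMap ℤ[X] R Polynomial.X = 0 := by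
    change ((Polynomial.constantCoeff (Polynomial.X : ℤ[X]) : ℤ) : R) = 0
    simp
  let θ₀ : HeckeAlg M →ₐ[ℤ[X]] R := RingQuot.liftAlgHom ℤ[X]
    ⟨FreeAlgebra.lift ℤ[X] fun i => p i - 1, by
      intro a b h
      induction h with
      | quad s =>
        rw [map_mul, map_add, map_smul, FreeAlgebra.lift_ι_apply, AlgHom.commutes, hX, sub_smul,
          one_smul, Algebra.smul_def, hX, mul_sub, sub_mul, hp]
        simp
      | braid s t hst =>
        simp only [map_list_prod, List.map_map]
        have : (FreeAlgebra.lift ℤ[X] fun i => p i - 1) ∘ FreeAlgebra.ι ℤ[X] =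
            fun i => p i - 1 := by
          ext1 i; simp
        rw [this, braid_sub_one_iff hp, hb s t hst]⟩
  have hθ₀ (i : B) : θ₀ (heckeT M i) = p i - 1 := by
    simp [θ₀, heckeT]
  refine ⟨Ideal.Quotient.lift (qIdeal M) (θ₀ : HeckeAlg M →+* R) ?_, fun i => ?_⟩
  · intro a ha
    obtain ⟨b, rfl⟩ := mem_qIdeal.1 ha
    rw [RingHom.coe_coe, map_smul, Algebra.smul_def, hX, zero_mul]
  · rw [piGen, map_add, map_one]
    have : Ideal.Quotient.lift (qIdeal M) (θ₀ : HeckeAlg M →+* R) (by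
        intro a ha
        obtain ⟨b, rfl⟩ := mem_qIdeal.1 ha
        rw [RingHom.coe_coe, map_smul, Algebra.smul_def, hX, zero_mul]) (toH0 M (heckeT M i)) =
        θ₀ (heckeT M i) := Ideal.Quotient.lift_mk _ _ _
    rw [this, hθ₀, sub_add_cancel]

end UniversalProperty

section PresentedAlgebra

attribute [local instance] heckeRing

variable {B W : Type*} [Finite B] [Group W] {M : CoxeterMatrix B} {cs : CoxeterSystem M W}

/-! ### Relations in the presented algebra -/

theorem mk_rel {x y : Free cs} (h : Rel cs x y) : mk cs x = mk cs y := RingQuot.mkAlgHom_rel ℤ h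

/-- The generator `u_{I,J}` of the presented algebra. -/
def uP {I J : Finitary cs} (h : Covers I J) : Presented cs := mk cs (uF h)

/-- The generator `d_{J,I}` of the presented algebra. -/
def dP {I J : Finitary cs} (h : Covers I J) : Presented cs := mk cs (dF h)

/-- The generator `1_K` of the presented algebra. -/
def eP (K : Finitary cs) : Presented cs := mk cs (oneF K)

variable (cs) in
/-- The idempotent `p_{i}` of the presented algebra. -/
def pP (i : B) : Presented cs := mk cs (pF cs i)

theorem pP_eq (i : B) : pP cs i = uP (covers_emp_sing cs i) * dP (covers_emp_sing cs i) :=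
  map_mul _ _ _

theorem dP_mul_uP {I J : Finitary cs} (h : Covers I J) : dP h * uP h = eP J := by
  have := mk_rel (Rel.idem h)
  rwa [map_mul] at this

theorem uP_mul_eP {I J : Finitary cs} (h : Covers I J) : uP h * eP J = uP h := by
  have := mk_rel (Rel.u_one h)
  rwa [map_mul] at this

theorem eP_mul_uP {I J : Finitary cs} (h : Covers I J) : eP I * uP h = uP h := by
  have := mk_rel (Rel.one_u h)
  rwa [map_mul] at this

theorem dP_mul_eP {I J : Finitary cs} (h : Covers I J) : dP h * eP I = dP h := by
  have := mk_rel (Rel.d_one h)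
  rwa [map_mul] at this

theorem eP_mul_dP {I J : Finitary cs} (h : Covers I J) : eP J * dP h = dP h := by
  have := mk_rel (Rel.one_d h)
  rwa [map_mul] at this

theorem eP_mul_self (I : Finitary cs) : eP I * eP I = eP I := by
  have := mk_rel (Rel.one_sq I)
  rwa [map_mul] at this

theorem eP_mul_of_ne {I J : Finitary cs} (h : I ≠ J) : eP I * eP J = 0 := by
  have := mk_rel (Rel.one_orth h)
  rwa [map_mul, map_zero] at this

theorem sum_eP : ∑ K : Finitary cs, eP K = 1 := by
  have := mk_rel (Rel.unit (cs := cs))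
  rw [map_one, map_sum] at this
  exact this.symm

theorem uP_mul_uP {I J J' K : Finitary cs} (hIJ : Covers I J) (hJK : Covers J K)
    (hIJ' : Covers I J') (hJK' : Covers J' K) : uP hIJ * uP hJK = uP hIJ' * uP hJK' := by
  have := mk_rel (Rel.sandwich_u hIJ hJK hIJ' hJK')
  rwa [map_mul, map_mul] at this

theorem dP_mul_dP {I J J' K : Finitary cs} (hIJ : Covers I J) (hJK : Covers J K)
    (hIJ' : Covers I J') (hJK' : Covers J' K) : dP hJK * dP hIJ = dP hJK' * dP hIJ' := by
  have := mk_rel (Rel.sandwich_d hIJ hJK hIJ' hJK')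
  rwa [map_mul, map_mul] at this

theorem pP_mul_self (i : B) : pP cs i * pP cs i = pP cs i := by
  rw [pP_eq, mul_assoc, ← mul_assoc (dP _), dP_mul_uP, eP_mul_dP]

theorem eP_mul_pP (i : B) : eP (emp cs) * pP cs i = pP cs i := by
  rw [pP_eq, ← mul_assoc, eP_mul_uP]

theorem pP_mul_eP (i : B) : pP cs i * eP (emp cs) = pP cs i := by
  rw [pP_eq, mul_assoc, dP_mul_eP]

/-! ### Products along chains -/

/-- The product of the `u`'s along a chain, as an element of `1_∅ P 1_I`. -/
def Flag.uC {I : Finitary cs} (c : Flag cs I) : Presented cs := eP (emp cs) * mk cs c.uProd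

/-- The product of the `d`'s along a chain, as an element of `1_I P 1_∅`. -/
def Flag.dC {I : Finitary cs} (c : Flag cs I) : Presented cs := mk cs c.dProd * eP (emp cs)

theorem Flag.uC_nil : (Flag.nil : Flag cs (emp cs)).uC = eP (emp cs) := by
  rw [Flag.uC, Flag.uProd, map_one, mul_one]

theorem Flag.dC_nil : (Flag.nil : Flag cs (emp cs)).dC = eP (emp cs) := by
  rw [Flag.dC, Flag.dProd, map_one, one_mul]

theorem Flag.uC_snoc {I J : Finitary cs} (c : Flag cs I) (h : Covers I J) :
    (Flag.snoc c h).uC = c.uC * uP h := by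
  rw [Flag.uC, Flag.uProd, map_mul, ← mul_assoc]; rfl

theorem Flag.dC_snoc {I J : Finitary cs} (c : Flag cs I) (h : Covers I J) :
    (Flag.snoc c h).dC = dP h * c.dC := by
  rw [Flag.dC, Flag.dProd, map_mul, mul_assoc]; rfl

theorem Flag.eq_or_exists {J : Finitary cs} (c : Flag cs J) :
    (J = emp cs ∧ c.uC = eP (emp cs) ∧ c.dC = eP (emp cs)) ∨
      ∃ (I : Finitary cs) (h : Covers I J) (c' : Flag cs I),
        c.uC = c'.uC * uP h ∧ c.dC = dP h * c'.dC := by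
  cases c with
  | nil => exact Or.inl ⟨rfl, Flag.uC_nil, Flag.dC_nil⟩
  | snoc c h => exact Or.inr ⟨_, h, c, Flag.uC_snoc c h, Flag.dC_snoc c h⟩

theorem exists_covers_of_covers {I I' J : Finitary cs} (h : Covers I J) (h' : Covers I' J)
    (hne : I ≠ I') : ∃ K, Covers K I ∧ Covers K I' := by
  classical
  have hne' : I.1 ≠ I'.1 := fun e => hne (Subtype.ext e)
  have hu : I.1 ⊂ I.1 ∪ I'.1 := by
    refine Finset.ssubset_iff_subset_ne.2 ⟨Finset.subset_union_left, fun e => hne' ?_⟩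
    have hs : I'.1 ⊆ I.1 := by rw [e]; exact Finset.subset_union_right
    refine (Finset.eq_of_subset_of_card_le hs ?_).symm
    have := h.2; have := h'.2; omega
  have h1 := Finset.card_lt_card hu
  have h2 := Finset.card_le_card (Finset.union_subset h.1.1 h'.1.1)
  have h3 := Finset.card_union_add_card_inter I.1 I'.1
  have h4 := h.2
  have h5 := h'.2
  refine ⟨I.sub (I.1 ∩ I'.1) Finset.inter_subset_left, ?_, ?_⟩
  · have hc : (I.1 ∩ I'.1).card + 1 = I.1.card := by omega
    exact ⟨Finset.ssubset_iff_subset_ne.2 ⟨Finset.inter_subset_left,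
      fun e => by have := congrArg Finset.card e; simp only [Finitary.sub] at this; omega⟩, hc⟩
  · have hc : (I.1 ∩ I'.1).card + 1 = I'.1.card := by omega
    exact ⟨Finset.ssubset_iff_subset_ne.2 ⟨Finset.inter_subset_right,
      fun e => by have := congrArg Finset.card e; simp only [Finitary.sub] at this; omega⟩, hc⟩

/-- If the last steps come from different I and I', both cover I ∩ I'. By induction each chain may
be rerouted through this intersection, and relation 2 identifies the two ways from it to J. -/
theorem Flag.uC_eq_and_dC_eq {J : Finitary cs} (c c' : Flag cs J) :
    c.uC = c'.uC ∧ c.dC = c'.dC := by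
  induction hn : J.1.card generalizing J with
  | zero =>
    have key (c : Flag cs J) : c.uC = eP (emp cs) ∧ c.dC = eP (emp cs) := by
      rcases c.eq_or_exists with h | ⟨I, h, -⟩
      · exact h.2
      · have := h.2; omega
    rw [(key c).1, (key c).2, (key c').1, (key c').2]
    exact ⟨rfl, rfl⟩
  | succ n ih =>
    have hJ : J ≠ emp cs := by
      rintro rfl
      simp [emp] at hn
    rcases c.eq_or_exists with h | ⟨I, h, c₁, hu, hd⟩
    · exact absurd h.1 hJ
    rcases c'.eq_or_exists with h | ⟨I', h', c₁', hu', hd'⟩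
    · exact absurd h.1 hJ
    have hI : I.1.card = n := by have := h.2; omega
    have hI' : I'.1.card = n := by have := h'.2; omega
    rw [hu, hd, hu', hd']
    by_cases hne : I = I'
    · subst hne
      rw [(ih c₁ c₁' hI).1, (ih c₁ c₁' hI).2]
      exact ⟨rfl, rfl⟩
    · obtain ⟨K, k, k'⟩ := exists_covers_of_covers h h' hne
      obtain ⟨b⟩ := Flag.nonempty K
      have e := ih c₁ (.snoc b k) hI
      have e' := ih c₁' (.snoc b k') hI'
      rw [e.1, e.2, e'.1, e'.2, Flag.uC_snoc, Flag.uC_snoc, Flag.dC_snoc, Flag.dC_snoc,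
        mul_assoc b.uC, mul_assoc b.uC, ← mul_assoc (dP h), ← mul_assoc (dP h'),
        uP_mul_uP k h k' h', dP_mul_dP k h k' h']
      exact ⟨rfl, rfl⟩

/-- The element `u_{∅,I₁} ⋯ u_{I_{m-1},J}`, for any chain from `∅` to `J`. -/
def uTop (J : Finitary cs) : Presented cs := (Classical.choice (Flag.nonempty J)).uC

/-- The element `d_{J,I_{m-1}} ⋯ d_{I₁,∅}`, for any chain from `∅` to `J`. -/
def dTop (J : Finitary cs) : Presented cs := (Classical.choice (Flag.nonempty J)).dC

theorem Flag.uC_eq {J : Finitary cs} (c : Flag cs J) : c.uC = uTop J := (uC_eq_and_dC_eq _ _).1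

theorem Flag.dC_eq {J : Finitary cs} (c : Flag cs J) : c.dC = dTop J := (uC_eq_and_dC_eq _ _).2

theorem uTop_emp : uTop (emp cs) = eP (emp cs) := by rw [← Flag.uC_eq .nil, Flag.uC_nil]

theorem dTop_emp : dTop (emp cs) = eP (emp cs) := by rw [← Flag.dC_eq .nil, Flag.dC_nil]

theorem uTop_mul_uP {I J : Finitary cs} (h : Covers I J) : uTop I * uP h = uTop J := by
  obtain ⟨c⟩ := Flag.nonempty I
  rw [← c.uC_eq, ← Flag.uC_snoc, Flag.uC_eq]

theorem dP_mul_dTop {I J : Finitary cs} (h : Covers I J) : dP h * dTop I = dTop J := by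
  obtain ⟨c⟩ := Flag.nonempty I
  rw [← c.dC_eq, ← Flag.dC_snoc, Flag.dC_eq]

theorem finitary_induction {p : Finitary cs → Prop} (J : Finitary cs) (emp : p (emp cs))
    (step : ∀ I J, Covers I J → p I → p J) : p J := by
  obtain ⟨c⟩ := Flag.nonempty J
  induction c with
  | nil => exact emp
  | snoc c h ih => exact step _ _ h ih

theorem eP_mul_uTop (J : Finitary cs) : eP (emp cs) * uTop J = uTop J := by
  rw [uTop, Flag.uC, ← mul_assoc, eP_mul_self]

theorem dTop_mul_eP (J : Finitary cs) : dTop J * eP (emp cs) = dTop J := by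
  rw [dTop, Flag.dC, mul_assoc, eP_mul_self]

theorem eP_mul_dTop (J : Finitary cs) : eP J * dTop J = dTop J := by
  induction J using finitary_induction with
  | emp => rw [dTop_emp, eP_mul_self]
  | step I J h ih => rw [← dP_mul_dTop h, ← mul_assoc, eP_mul_dP]

theorem uTop_mul_eP (J : Finitary cs) : uTop J * eP J = uTop J := by
  induction J using finitary_induction with
  | emp => rw [uTop_emp, eP_mul_self]
  | step I J h ih => rw [← uTop_mul_uP h, mul_assoc, uP_mul_eP]

theorem dTop_mul_uTop (J : Finitary cs) : dTop J * uTop J = eP J := by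
  induction J using finitary_induction with
  | emp => rw [dTop_emp, uTop_emp, eP_mul_self]
  | step I J h ih =>
    rw [← uTop_mul_uP h, ← dP_mul_dTop h, mul_assoc, ← mul_assoc (dTop I), ih, eP_mul_uP,
      dP_mul_uP]

/-- The factor 1_∅ built into `uC` and `dC` is absorbed by the first step of a non-empty chain. Only
the empty chain differs: its products in the free algebra are 1 instead of 1_∅. -/
theorem Flag.mk_prods {J : Finitary cs} (c : Flag cs J) :
    (J = emp cs ∧ mk cs c.uProd = 1 ∧ mk cs c.dProd = 1) ∨
      (mk cs c.uProd = c.uC ∧ mk cs c.dProd = c.dC) := by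
  induction c with
  | nil => exact Or.inl ⟨rfl, map_one _, map_one _⟩
  | @snoc I J c h ih =>
    right
    rw [Flag.uC_snoc, Flag.dC_snoc, Flag.uProd, Flag.dProd, map_mul, map_mul]
    rcases ih with ⟨rfl, hu, hd⟩ | ⟨hu, hd⟩
    · rw [Flag.uC, Flag.dC, hu, hd, mul_one, one_mul, one_mul, mul_one]
      exact ⟨(eP_mul_uP h).symm, (dP_mul_eP h).symm⟩
    · rw [hu, hd]
      exact ⟨rfl, rfl⟩

theorem uTop_mul_dTop_of_adapted {J : Finitary cs} (hJ : J ≠ emp cs) {c : Flag cs J} {ω : List B}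
    (h : c.Adapted ω) : uTop J * dTop J = (ω.map (pP cs)).prod := by
  have hr := mk_rel (Rel.braid hJ c ω h)
  rw [map_mul, map_list_prod, List.map_map] at hr
  rcases c.mk_prods with h' | ⟨hu, hd⟩
  · exact absurd h'.1 hJ
  · rw [hu, hd, c.uC_eq, c.dC_eq] at hr
    exact hr

/-- Both sides equal u_J d_J for J = {i, j}, by relation 3 for the chains through {j} and through
{i}. -/
theorem pP_braid (i j : B) (hij : i ≠ j) :
    ((CoxeterSystem.alternatingWord i j (M i j)).map (pP cs)).prod =
      ((CoxeterSystem.alternatingWord j i (M i j)).map (pP cs)).prod := by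
  classical
  by_cases hM : M i j = 0
  · simp [hM, CoxeterSystem.alternatingWord]
  have hne : pair cs hM ≠ emp cs := by
    intro h
    have := congrArg (fun J => i ∈ J.1) h
    simp [pair, emp] at this
  rw [← uTop_mul_dTop_of_adapted hne (Flag.pair_adapted hij hM (J := pair cs hM) rfl),
    M.symmetric i j, ← uTop_mul_dTop_of_adapted hne (Flag.pair_adapted hij.symm
      (by rwa [M.symmetric]) (J := pair cs hM) (Finset.pair_comm _ _))]

theorem exists_h0Hom_presented : ∃ θ : H0 M →+* Presented cs, ∀ i, θ (piGen i) = pP cs i := by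
  let : Ring (Presented cs) := Algebra.semiringToRing ℤ
  exact exists_h0Hom (pP cs) pP_mul_self pP_braid

variable (cs) in
/-- The homomorphism from the `0`-Hecke algebra to the presented algebra. -/
def h0P : H0 M →+* Presented cs := Classical.choose exists_h0Hom_presented

theorem h0P_piGen (i : B) : h0P cs (piGen i) = pP cs i :=
  Classical.choose_spec exists_h0Hom_presented i

/-- Induction on the `0`-Hecke algebra. -/
theorem h0_induction {p : H0 M → Prop} (h : H0 M) (int : ∀ n : ℤ, p (n : H0 M))
    (gen : ∀ i, p (piGen i)) (add : ∀ a b, p a → p b → p (a + b))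
    (mul : ∀ a b, p a → p b → p (a * b)) : p h := by
  obtain ⟨a, rfl⟩ := toH0_surjective h
  induction a using heckeAlg_induction with
  | algMap r =>
    rw [Algebra.algebraMap_eq_smul_one, toH0_smul, map_one, zsmul_one]
    exact int _
  | gen i =>
    have : toH0 M (heckeT M i) = piGen i + ((-1 : ℤ) : H0 M) := by simp [piGen]
    rw [this]
    exact add _ _ (gen i) (int _)
  | add a b ha hb => rw [map_add]; exact add _ _ ha hb
  | mul a b ha hb => rw [map_mul]; exact mul _ _ ha hb

theorem eP_commute_h0P (h : H0 M) : Commute (eP (emp cs)) (h0P cs h) := by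
  let : Ring (Presented cs) := Algebra.semiringToRing ℤ
  induction h using h0_induction with
  | int n => rw [map_intCast]; exact (Int.cast_commute n _).symm
  | gen i =>
    rw [h0P_piGen, Commute, SemiconjBy, eP_mul_pP, pP_mul_eP]
  | add a b ha hb => rw [map_add]; exact ha.add_right hb
  | mul a b ha hb => rw [map_mul]; exact ha.mul_right hb

/-- Relation 3, combined with the factorisation of x_J modulo q along a reduced word of w_J. The
factor 1_∅ is needed for J = ∅, where θ(x_∅) = 1 while u_∅ d_∅ = 1_∅. -/
theorem h0P_xElt_mul_eP (J : Finitary cs) :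
    h0P cs (toH0 M (xElt cs J)) * eP (emp cs) = uTop J * dTop J := by
  obtain ⟨c⟩ := Flag.nonempty J
  obtain ⟨ω, hω⟩ := c.exists_adapted
  have h : h0P cs (toH0 M (xElt cs J)) = (ω.map (pP cs)).prod := by
    rw [toH0_xElt_eq_prod hω.isReduced hω.isLongest, map_list_prod, List.map_map]
    congr 2
    funext i
    exact h0P_piGen i
  by_cases hJ : J = emp cs
  · subst hJ
    have hω1 : ω = [] := by
      have h1 := hω.isReduced.eq
      have h2 := hω.isLongest.1
      have h3 : cs.wordProd ω = 1 := by simpa [parabolic, emp] using h2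
      rw [h3, cs.length_one] at h1
      exact List.length_eq_zero_iff.1 h1.symm
    rw [h, hω1, uTop_emp, dTop_emp, eP_mul_self]
    simp
  · rw [h, ← uTop_mul_dTop_of_adapted hJ hω, mul_assoc, dTop_mul_eP]

/-- d_J θ(x_J) = d_J u_J d_J = 1_J d_J. -/
theorem dTop_mul_h0P_xElt (J : Finitary cs) : dTop J * h0P cs (toH0 M (xElt cs J)) = dTop J := by
  rw [← dTop_mul_eP, mul_assoc, (eP_commute_h0P _).eq, h0P_xElt_mul_eP, ← mul_assoc,
    dTop_mul_uTop, eP_mul_dTop, dTop_mul_eP]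

theorem h0P_xElt_mul_uTop (J : Finitary cs) : h0P cs (toH0 M (xElt cs J)) * uTop J = uTop J := by
  rw [← eP_mul_uTop, ← mul_assoc, h0P_xElt_mul_eP, mul_assoc, dTop_mul_uTop, uTop_mul_eP,
    eP_mul_uTop]

/-! ### Normal forms -/

/-- The element `d_J θ(h) u_I` of the presented algebra. -/
def normalForm (J I : Finitary cs) : H0 M →+ Presented cs where
  toFun h := dTop J * h0P cs h * uTop I
  map_zero' := by rw [map_zero, mul_zero, zero_mul]
  map_add' a b := by rw [map_add, mul_add, add_mul]

theorem normalForm_apply (J I : Finitary cs) (h : H0 M) :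
    normalForm J I h = dTop J * h0P cs h * uTop I := rfl

theorem normalForm_xElt_mul_mul (J I : Finitary cs) (h : H0 M) :
    normalForm J I (toH0 M (xElt cs J) * h * toH0 M (xElt cs I)) = normalForm J I h := by
  rw [normalForm_apply, map_mul, map_mul, ← mul_assoc, ← mul_assoc, dTop_mul_h0P_xElt, mul_assoc,
    h0P_xElt_mul_uTop, normalForm_apply]

theorem eP_mul_normalForm_of_ne {K J : Finitary cs} (hne : K ≠ J) (I : Finitary cs) (h : H0 M) :
    eP K * normalForm J I h = 0 := by
  rw [normalForm_apply, ← mul_assoc, ← mul_assoc, ← eP_mul_dTop J, ← mul_assoc,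
    eP_mul_of_ne hne, zero_mul, zero_mul, zero_mul]

theorem eP_mul_normalForm (J I : Finitary cs) (h : H0 M) :
    eP J * normalForm J I h = normalForm J I h := by
  rw [normalForm_apply, ← mul_assoc, ← mul_assoc, eP_mul_dTop]

theorem dP_mul_normalForm {J K : Finitary cs} (hJK : Covers J K) (I : Finitary cs) (h : H0 M) :
    dP hJK * normalForm J I h = normalForm K I h := by
  rw [normalForm_apply, ← mul_assoc, ← mul_assoc, dP_mul_dTop, normalForm_apply]

/-- Insert 1_K = d_K u_K on the left: u_{K,J} d_J = d_K u_K u_{K,J} d_J = d_K u_J d_J = d_K θ(x_J).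
This rule keeps normal forms stable under left multiplication by the u's. -/
theorem uP_mul_dTop {K J : Finitary cs} (hKJ : Covers K J) :
    uP hKJ * dTop J = dTop K * h0P cs (toH0 M (xElt cs J)) := by
  rw [← dTop_mul_eP K, mul_assoc, (eP_commute_h0P _).eq, h0P_xElt_mul_eP, ← mul_assoc,
    ← uTop_mul_uP hKJ, ← mul_assoc, dTop_mul_uTop, eP_mul_uP]

theorem uP_mul_normalForm {K J : Finitary cs} (hKJ : Covers K J) (I : Finitary cs) (h : H0 M) :
    uP hKJ * normalForm J I h = normalForm K I (toH0 M (xElt cs J) * h) := by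
  rw [normalForm_apply, ← mul_assoc, ← mul_assoc, uP_mul_dTop, normalForm_apply, map_mul,
    mul_assoc (dTop K)]

theorem normalForm_one (K : Finitary cs) : normalForm K K (1 : H0 M) = eP K := by
  rw [normalForm_apply, map_one, mul_one, dTop_mul_uTop]

variable (cs) in
/-- The span of the normal forms. -/
def normalSpan : AddSubmonoid (Presented cs) :=
  AddSubmonoid.closure {z | ∃ (J I : Finitary cs) (h : H0 M), z = normalForm J I h}

theorem normalForm_mem (J I : Finitary cs) (h : H0 M) : normalForm J I h ∈ normalSpan cs :=
  AddSubmonoid.subset_closure ⟨J, I, h, rfl⟩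

theorem mul_mem_normalSpan_of_normalForm {a : Presented cs}
    (ha : ∀ (J I : Finitary cs) (h : H0 M), a * normalForm J I h ∈ normalSpan cs)
    {z : Presented cs} (hz : z ∈ normalSpan cs) : a * z ∈ normalSpan cs := by
  induction hz using AddSubmonoid.closure_induction with
  | mem x hx =>
    obtain ⟨J, I, h, rfl⟩ := hx
    exact ha J I h
  | zero => rw [mul_zero]; exact zero_mem _
  | add x y _ _ hx hy => rw [mul_add]; exact add_mem hx hy

/-- It suffices to multiply a normal form by one generator: the result is 0 when the indices do not
match, and otherwise again a normal form. The span is then a left ideal, and it contains 1 = ∑ d_K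
u_K. -/
theorem mk_mul_mem_normalSpan (x : Free cs) (z : Presented cs) (hz : z ∈ normalSpan cs) :
    mk cs x * z ∈ normalSpan cs := by
  induction x using FreeAlgebra.induction generalizing z with
  | grade0 n =>
    refine mul_mem_normalSpan_of_normalForm (fun J I h => ?_) hz
    have hn : algebraMap ℤ (Presented cs) n = h0P cs (n : H0 M) :=
      congrArg (fun f : ℤ →+* Presented cs => f n)
        (RingHom.ext_int (algebraMap ℤ (Presented cs)) ((h0P cs).comp (Int.castRingHom (H0 M))))
    have : algebraMap ℤ (Presented cs) n * normalForm J I h = normalForm J I (n * h) := by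
      rw [normalForm_apply, normalForm_apply, map_mul, ← hn, ← mul_assoc, ← mul_assoc,
        ← mul_assoc, Algebra.commutes n (dTop J)]
    rw [AlgHom.commutes, this]
    exact normalForm_mem _ _ _
  | grade1 g =>
    refine mul_mem_normalSpan_of_normalForm (fun J I h => ?_) hz
    cases g with
    | u K L hKL =>
      change uP hKL * _ ∈ _
      by_cases hL : L = J
      · subst hL
        rw [uP_mul_normalForm]; exact normalForm_mem _ _ _
      · rw [← uP_mul_eP, mul_assoc, eP_mul_normalForm_of_ne hL, mul_zero]; exact zero_mem _
    | d L K hKL =>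
      change dP hKL * _ ∈ _
      by_cases hK : K = J
      · subst hK
        rw [dP_mul_normalForm]; exact normalForm_mem _ _ _
      · rw [← dP_mul_eP, mul_assoc, eP_mul_normalForm_of_ne hK, mul_zero]; exact zero_mem _
    | one K =>
      change eP K * _ ∈ _
      by_cases hK : K = J
      · subst hK
        rw [eP_mul_normalForm]; exact normalForm_mem _ _ _
      · rw [eP_mul_normalForm_of_ne hK]; exact zero_mem _
  | mul a b ha hb => rw [map_mul, mul_assoc]; exact ha _ (hb _ hz)
  | add a b ha hb => rw [map_add, add_mul]; exact add_mem (ha _ hz) (hb _ hz)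

theorem mem_normalSpan (z : Presented cs) : z ∈ normalSpan cs := by
  obtain ⟨x, rfl⟩ := RingQuot.mkAlgHom_surjective ℤ (Rel cs) z
  have h1 : (1 : Presented cs) ∈ normalSpan cs := by
    rw [← sum_eP]
    refine sum_mem fun K _ => ?_
    rw [← normalForm_one]
    exact normalForm_mem _ _ _
  have := mk_mul_mem_normalSpan x 1 h1
  rwa [mul_one] at this

end PresentedAlgebra
end

noncomputable section

section Isomorphism

attribute [local instance] heckeRing

variable {B W : Type*} [Finite B] [Group W] {M : CoxeterMatrix B} (cs : CoxeterSystem M W)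

/-! ### The homomorphism from the presented algebra -/

/-- The elements of `E_0` corresponding to the generators. -/
def genE0 : Gen cs → E0 cs
  | .u _ _ h => 1 ⊗ₜ[ℤ[X]] uMap h
  | .d _ _ h => 1 ⊗ₜ[ℤ[X]] dMap h
  | .one K => 1 ⊗ₜ[ℤ[X]] oneMap K

/-- The homomorphism from the free algebra to `E_0`. -/
def freeToE0 : Free cs →ₐ[ℤ] E0 cs := FreeAlgebra.lift ℤ (genE0 cs)

variable {cs}

theorem freeToE0_one : freeToE0 cs 1 = 1 := (freeToE0 cs).map_one'

theorem freeToE0_uF {I J : Finitary cs} (h : Covers I J) :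
    freeToE0 cs (uF h) = 1 ⊗ₜ[ℤ[X]] uMap h := FreeAlgebra.lift_ι_apply _ _

theorem freeToE0_dF {I J : Finitary cs} (h : Covers I J) :
    freeToE0 cs (dF h) = 1 ⊗ₜ[ℤ[X]] dMap h := FreeAlgebra.lift_ι_apply _ _

theorem freeToE0_oneF (K : Finitary cs) :
    freeToE0 cs (oneF K) = 1 ⊗ₜ[ℤ[X]] oneMap K := FreeAlgebra.lift_ι_apply _ _

open Classical in
theorem e0Mat_freeToE0_uF {I J : Finitary cs} (h : Covers I J) :
    e0Mat cs (freeToE0 cs (uF h)) = Matrix.single I J (toH0 M (xElt cs J)) := by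
  rw [freeToE0_uF, e0Mat_uMap]

open Classical in
theorem e0Mat_freeToE0_dF {I J : Finitary cs} (h : Covers I J) :
    e0Mat cs (freeToE0 cs (dF h)) = Matrix.single J I (toH0 M (xElt cs J)) := by
  rw [freeToE0_dF, e0Mat_dMap]

open Classical in
theorem e0Mat_freeToE0_oneF (K : Finitary cs) :
    e0Mat cs (freeToE0 cs (oneF K)) = Matrix.single K K (toH0 M (xElt cs K)) := by
  rw [freeToE0_oneF, e0Mat_oneMap]

theorem toH0_xElt_emp : toH0 M (xElt cs (emp cs)) = 1 := by
  have h : cs.IsReduced [] := by simp [CoxeterSystem.IsReduced]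
  rw [toH0_xElt_eq_prod h (by rw [cs.wordProd_nil]; exact isLongest_empty)]
  rfl

theorem toH0_xElt_sing (i : B) : toH0 M (xElt cs (sing cs i)) = piGen i := by
  have h := Flag.single_adapted (cs := cs) i
  rw [toH0_xElt_eq_prod h.isReduced h.isLongest]
  simp

open Classical in
theorem e0Mat_freeToE0_pF (i : B) :
    e0Mat cs (freeToE0 cs (pF cs i)) = Matrix.single (emp cs) (emp cs) (piGen i) := by
  rw [pF, map_mul, e0Mat_mul, e0Mat_freeToE0_uF, e0Mat_freeToE0_dF,
    Matrix.single_mul_single_same, toH0_xElt_mul_xElt subset_rfl, toH0_xElt_sing]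

-- Non-emptiness matters: the empty product is 1, whose matrix has nonzero entries at every diagonal
-- place.
open Classical in
theorem e0Mat_freeToE0_prod_pF {ω : List B} (hω : ω ≠ []) :
    e0Mat cs (freeToE0 cs (ω.map (pF cs)).prod) =
      Matrix.single (emp cs) (emp cs) (ω.map piGen).prod := by
  induction ω with
  | nil => exact absurd rfl hω
  | cons i ω ih =>
    rw [List.map_cons, List.prod_cons, List.map_cons, List.prod_cons]
    by_cases h : ω = []
    · subst h
      rw [List.map_nil, List.prod_nil, List.map_nil, List.prod_nil, mul_one, mul_one,
        e0Mat_freeToE0_pF]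
    · rw [map_mul, e0Mat_mul, ih h, e0Mat_freeToE0_pF, Matrix.single_mul_single_same]

open Classical in
theorem Flag.freeToE0_prods {J : Finitary cs} (c : Flag cs J) :
    (J = emp cs ∧ freeToE0 cs c.uProd = 1 ∧ freeToE0 cs c.dProd = 1) ∨
      (e0Mat cs (freeToE0 cs c.uProd) = Matrix.single (emp cs) J (toH0 M (xElt cs J)) ∧
        e0Mat cs (freeToE0 cs c.dProd) = Matrix.single J (emp cs) (toH0 M (xElt cs J))) := by
  induction c with
  | nil => exact Or.inl ⟨rfl, freeToE0_one, freeToE0_one⟩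
  | @snoc I J c h ih =>
    right
    rw [Flag.uProd, Flag.dProd, map_mul (freeToE0 cs), map_mul (freeToE0 cs)]
    rcases ih with ⟨rfl, hu, hd⟩ | ⟨hu, hd⟩
    · rw [hu, hd, one_mul, mul_one]
      exact ⟨e0Mat_freeToE0_uF h, e0Mat_freeToE0_dF h⟩
    · rw [e0Mat_mul, e0Mat_mul, hu, hd, e0Mat_freeToE0_uF, e0Mat_freeToE0_dF,
        Matrix.single_mul_single_same, Matrix.single_mul_single_same,
        toH0_xElt_mul_xElt h.1.1, toH0_xElt_mul_xElt' h.1.1]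
      exact ⟨rfl, rfl⟩

theorem Flag.Adapted.ne_nil {J : Finitary cs} (hJ : J ≠ emp cs) {c : Flag cs J} {ω : List B}
    (h : c.Adapted ω) : ω ≠ [] := by
  rintro rfl
  have hl := h.isLongest
  rw [cs.wordProd_nil] at hl
  obtain ⟨i, hi⟩ := Finset.nonempty_iff_ne_empty.2 fun e => hJ (Subtype.ext e)
  have := hl.2 _ (simple_mem_parabolic cs hi)
  rw [cs.length_simple, cs.length_one] at this
  omega

/-- By injectivity of `e0Mat` all relations are checked on matrices, where they reduce to x_I x_J =
x_J = x_J x_I for I ⊆ J; relation 3 is the product formula for x_I. -/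
theorem freeToE0_rel {x y : Free cs} (h : Rel cs x y) : freeToE0 cs x = freeToE0 cs y := by
  classical
  apply e0Mat_injective
  cases h with
  | unit =>
    rw [freeToE0_one, e0Mat_one, map_sum, map_sum]
    simp_rw [e0Mat_freeToE0_oneF]
    ext J I
    rw [Matrix.sum_apply, Matrix.diagonal_apply, Finset.sum_eq_single J]
    · simp only [Matrix.single_apply, true_and]
    · intro K _ hK
      rw [Matrix.single_apply_of_ne _ _ _ _ _ fun e => hK e.1]
    · exact fun h => absurd (Finset.mem_univ _) h
  | idem h =>
    rw [map_mul, e0Mat_mul, e0Mat_freeToE0_uF, e0Mat_freeToE0_dF, e0Mat_freeToE0_oneF,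
      Matrix.single_mul_single_same, toH0_xElt_mul_xElt subset_rfl]
  | sandwich_u h k h' k' =>
    rw [map_mul (freeToE0 cs), map_mul (freeToE0 cs), e0Mat_mul, e0Mat_mul, e0Mat_freeToE0_uF, e0Mat_freeToE0_uF,
      e0Mat_freeToE0_uF, e0Mat_freeToE0_uF, Matrix.single_mul_single_same,
      Matrix.single_mul_single_same, toH0_xElt_mul_xElt k.1.1, toH0_xElt_mul_xElt k'.1.1]
  | sandwich_d h k h' k' =>
    rw [map_mul (freeToE0 cs), map_mul (freeToE0 cs), e0Mat_mul, e0Mat_mul, e0Mat_freeToE0_dF, e0Mat_freeToE0_dF,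
      e0Mat_freeToE0_dF, e0Mat_freeToE0_dF, Matrix.single_mul_single_same,
      Matrix.single_mul_single_same, toH0_xElt_mul_xElt' k.1.1, toH0_xElt_mul_xElt' k'.1.1]
  | braid hI c ω hω =>
    rcases c.freeToE0_prods with h | ⟨hu, hd⟩
    · exact absurd h.1 hI
    · rw [map_mul, e0Mat_mul, hu, hd, Matrix.single_mul_single_same,
        toH0_xElt_mul_xElt subset_rfl, e0Mat_freeToE0_prod_pF (hω.ne_nil hI),
        toH0_xElt_eq_prod hω.isReduced hω.isLongest]
  | u_one h =>
    rw [map_mul, e0Mat_mul, e0Mat_freeToE0_uF, e0Mat_freeToE0_oneF,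
      Matrix.single_mul_single_same, toH0_xElt_mul_xElt subset_rfl]
  | one_u h =>
    rw [map_mul, e0Mat_mul, e0Mat_freeToE0_uF, e0Mat_freeToE0_oneF,
      Matrix.single_mul_single_same, toH0_xElt_mul_xElt h.1.1]
  | d_one h =>
    rw [map_mul, e0Mat_mul, e0Mat_freeToE0_dF, e0Mat_freeToE0_oneF,
      Matrix.single_mul_single_same, toH0_xElt_mul_xElt' h.1.1]
  | one_d h =>
    rw [map_mul, e0Mat_mul, e0Mat_freeToE0_dF, e0Mat_freeToE0_oneF,
      Matrix.single_mul_single_same, toH0_xElt_mul_xElt subset_rfl]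
  | one_sq I =>
    rw [map_mul, e0Mat_mul, e0Mat_freeToE0_oneF, Matrix.single_mul_single_same,
      toH0_xElt_mul_xElt subset_rfl]
  | one_orth h =>
    rw [map_mul, e0Mat_mul, e0Mat_freeToE0_oneF, e0Mat_freeToE0_oneF,
      Matrix.single_mul_single_of_ne _ _ _ _ h, map_zero, map_zero]

variable (cs) in
/-- The homomorphism from the presented algebra to `E_0`. -/
def toE0 : Presented cs →ₐ[ℤ] E0 cs :=
  RingQuot.liftAlgHom ℤ ⟨freeToE0 cs, fun _ _ h => freeToE0_rel h⟩

theorem toE0_mk (x : Free cs) : toE0 cs (mk cs x) = freeToE0 cs x :=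
  RingQuot.liftAlgHom_mkAlgHom_apply ℤ _ _ _

/-! ### The homomorphism is bijective -/

open Classical in
theorem e0Mat_toE0_eP (K : Finitary cs) :
    e0Mat cs (toE0 cs (eP K)) = Matrix.single K K (toH0 M (xElt cs K)) := by
  rw [eP, toE0_mk, e0Mat_freeToE0_oneF]

open Classical in
theorem e0Mat_toE0_uTop (J : Finitary cs) :
    e0Mat cs (toE0 cs (uTop J)) = Matrix.single (emp cs) J (toH0 M (xElt cs J)) := by
  induction J using finitary_induction with
  | emp => rw [uTop_emp, e0Mat_toE0_eP]
  | step I J h ih =>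
    rw [← uTop_mul_uP h, map_mul, e0Mat_mul, ih, uP, toE0_mk, e0Mat_freeToE0_uF,
      Matrix.single_mul_single_same, toH0_xElt_mul_xElt h.1.1]

open Classical in
theorem e0Mat_toE0_dTop (J : Finitary cs) :
    e0Mat cs (toE0 cs (dTop J)) = Matrix.single J (emp cs) (toH0 M (xElt cs J)) := by
  induction J using finitary_induction with
  | emp => rw [dTop_emp, e0Mat_toE0_eP]
  | step I J h ih =>
    rw [← dP_mul_dTop h, map_mul, e0Mat_mul, ih, dP, toE0_mk, e0Mat_freeToE0_dF,
      Matrix.single_mul_single_same, toH0_xElt_mul_xElt' h.1.1]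

-- The idempotent 1_∅ commutes with the image of θ, so h ↦ 1_∅ θ(h) is multiplicative and the
-- formula need only be checked on integers and on the π_i.
open Classical in
theorem e0Mat_toE0_eP_mul_h0P (h : H0 M) :
    e0Mat cs (toE0 cs (eP (emp cs) * h0P cs h)) = Matrix.single (emp cs) (emp cs) h := by
  let F : H0 M →+ Matrix (Finitary cs) (Finitary cs) (H0 M) :=
    AddMonoidHom.mk' (fun h => e0Mat cs (toE0 cs (eP (emp cs) * h0P cs h)))
      fun a b => by rw [map_add, mul_add, map_add, map_add]
  have hF (h : H0 M) : F h = e0Mat cs (toE0 cs (eP (emp cs) * h0P cs h)) := rfl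
  rw [← hF]
  induction h using h0_induction with
  | int n =>
    rw [← zsmul_one, map_zsmul, hF, map_one, mul_one, e0Mat_toE0_eP, toH0_xElt_emp,
      Matrix.smul_single]
  | gen i => rw [hF, h0P_piGen, eP_mul_pP, pP, toE0_mk, e0Mat_freeToE0_pF]
  | add a b ha hb => rw [map_add, ha, hb, Matrix.single_add]
  | mul a b ha hb =>
    have : eP (emp cs) * h0P cs (a * b) = eP (emp cs) * h0P cs a * (eP (emp cs) * h0P cs b) := by
      rw [map_mul, mul_assoc, ← mul_assoc (h0P cs a), ← (eP_commute_h0P a).eq, ← mul_assoc,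
        ← mul_assoc, ← mul_assoc, eP_mul_self, mul_assoc]
    rw [hF, this, map_mul, e0Mat_mul, ← hF, ← hF, ha, hb, Matrix.single_mul_single_same]

open Classical in
theorem e0Mat_toE0_normalForm (J I : Finitary cs) (h : H0 M) :
    e0Mat cs (toE0 cs (normalForm J I h)) =
      Matrix.single J I (toH0 M (xElt cs J) * h * toH0 M (xElt cs I)) := by
  rw [normalForm_apply, ← dTop_mul_eP, mul_assoc (dTop J), map_mul (toE0 cs), map_mul (toE0 cs),
    e0Mat_mul, e0Mat_mul, e0Mat_toE0_dTop, e0Mat_toE0_eP_mul_h0P, e0Mat_toE0_uTop, Matrix.single_mul_single_same,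
    Matrix.single_mul_single_same]

variable (cs) in
/-- The sum of the normal forms of the entries of a matrix. -/
def ofMatrix : Matrix (Finitary cs) (Finitary cs) (H0 M) →+ Presented cs where
  toFun A := ∑ J, ∑ I, normalForm J I (A J I)
  map_zero' := by simp only [Matrix.zero_apply, map_zero, Finset.sum_const_zero]
  map_add' A A' := by simp only [Matrix.add_apply, map_add, Finset.sum_add_distrib]

theorem ofMatrix_apply (A : Matrix (Finitary cs) (Finitary cs) (H0 M)) :
    ofMatrix cs A = ∑ J, ∑ I, normalForm J I (A J I) := rfl

open Classical in
theorem ofMatrix_single (J I : Finitary cs) (h : H0 M) :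
    ofMatrix cs (Matrix.single J I h) = normalForm J I h := by
  rw [ofMatrix_apply, Fintype.sum_eq_single J, Fintype.sum_eq_single I, Matrix.single_apply_same]
  · intro I' hI'
    rw [Matrix.single_apply_of_ne _ _ _ _ _ fun e => hI' e.2.symm, map_zero]
  · intro J' hJ'
    refine Finset.sum_eq_zero fun I' _ => ?_
    rw [Matrix.single_apply_of_ne _ _ _ _ _ fun e => hJ' e.1.symm, map_zero]

/-- Both sides are additive, so z may be taken to be d_J θ(h) u_I. Its only entry x_J h x_I
reassembles to the same element, since d_J and u_I absorb θ(x_J) and θ(x_I). -/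
theorem ofMatrix_e0Mat_toE0 (z : Presented cs) : ofMatrix cs (e0Mat cs (toE0 cs z)) = z := by
  classical
  induction mem_normalSpan z using AddSubmonoid.closure_induction with
  | mem x hx =>
    obtain ⟨J, I, h, rfl⟩ := hx
    rw [e0Mat_toE0_normalForm, ofMatrix_single, normalForm_xElt_mul_mul]
  | zero => rw [map_zero, map_zero, map_zero]
  | add x y _ _ hx hy => rw [map_add, map_add, map_add, hx, hy]

/-- Reassembling replaces each entry a by x_J a x_I, which equals a for matrices coming from E_0. -/
theorem toE0_ofMatrix_e0Mat (t : E0 cs) : toE0 cs (ofMatrix cs (e0Mat cs t)) = t := by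
  classical
  apply e0Mat_injective
  rw [ofMatrix_apply]
  simp only [map_sum, e0Mat_toE0_normalForm, toH0_xElt_mul_e0Mat, e0Mat_mul_toH0_xElt]
  exact (Matrix.matrix_eq_sum_single _).symm

variable (cs) in
/-- The presented algebra is isomorphic to `E_0`. -/
def presentedEquivE0 : Presented cs ≃ₐ[ℤ] E0 cs :=
  AlgEquiv.ofBijective (toE0 cs)
    ⟨Function.LeftInverse.injective (g := fun t => ofMatrix cs (e0Mat cs t)) ofMatrix_e0Mat_toE0,
      Function.RightInverse.surjective (g := fun t => ofMatrix cs (e0Mat cs t))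
        toE0_ofMatrix_e0Mat⟩

theorem presentedEquivE0_mk (x : Free cs) : presentedEquivE0 cs (mk cs x) = freeToE0 cs x :=
  toE0_mk x

end Isomorphism
end
end HeckeEndo

/-- `IsLeftMul` prescribes every component of f y, so f is unique. The three conditions therefore
fix φ on the generators, and hence everywhere. -/
theorem theorem6p4 {B W : Type*} [Finite B] [Group W] {M : CoxeterMatrix B}
    (cs : CoxeterSystem M W) :
    ∃ φ : HeckeEndo.Presented cs ≃ₐ[ℤ] HeckeEndo.E0 cs,
      (∀ (I J : HeckeEndo.Finitary cs) (hIJ : HeckeEndo.Covers I J),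
        ∃ f : HeckeEndo.Endq cs, HeckeEndo.IsLeftMul cs 1 J I f ∧
          φ (HeckeEndo.mk cs (HeckeEndo.uF hIJ)) = 1 ⊗ₜ[ℤ[X]] f) ∧
      (∀ (I J : HeckeEndo.Finitary cs) (hIJ : HeckeEndo.Covers I J),
        ∃ f : HeckeEndo.Endq cs, HeckeEndo.IsLeftMul cs (HeckeEndo.hElt cs J I) I J f ∧
          φ (HeckeEndo.mk cs (HeckeEndo.dF hIJ)) = 1 ⊗ₜ[ℤ[X]] f) ∧
      (∀ K : HeckeEndo.Finitary cs,
        ∃ f : HeckeEndo.Endq cs, HeckeEndo.IsLeftMul cs 1 K K f ∧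
          φ (HeckeEndo.mk cs (HeckeEndo.oneF K)) = 1 ⊗ₜ[ℤ[X]] f) := by
  refine ⟨HeckeEndo.presentedEquivE0 cs, fun I J h => ⟨HeckeEndo.uMap h, ?_, ?_⟩,
    fun I J h => ⟨HeckeEndo.dMap h, ?_, ?_⟩, fun K => ⟨HeckeEndo.oneMap K, ?_, ?_⟩⟩
  · exact HeckeEndo.uMap_isLeftMul h
  · rw [HeckeEndo.presentedEquivE0_mk, HeckeEndo.freeToE0_uF]
  · exact HeckeEndo.dMap_isLeftMul h
  · rw [HeckeEndo.presentedEquivE0_mk, HeckeEndo.freeToE0_dF]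
  · exact HeckeEndo.oneMap_isLeftMul K
  · rw [HeckeEndo.presentedEquivE0_mk, HeckeEndo.freeToE0_oneF]
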